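/- **Theorem.** Let $N\ge 1$, let $\mathcal X_N$ be the set of $X=(x_1<\dots<x_N)\in\mathbb Z^N$, let $\Delta\in\mathbb R$, $\Delta\ne0$, and let $H=\sum_{j\in\mathbb Z}h_{j,j+1}$ with $h_{j,j+1}=\sigma_j^+\sigma_{j+1}^-+\sigma_j^-\sigma_{j+1}^++\frac{\Delta}{2}(\sigma_j^3\sigma_{j+1}^3-1)$ be the Heisenberg–Ising (XXZ) spin-$\frac12$ Hamiltonian on $\mathbb Z$, restricted to the $N$-particle sector $\ell^2(\mathcal X_N)$ with basis $e_X$ (up-spins exactly at the sites of $X$; $\sigma_j^3e_X=\pm e_X$ according to whether $j$ is occupied or not, and $\sigma^{+}_j$, $\sigma^-_j$ create and annihilate an up-spin at $j$). Fix $Y=(y_1<\dots<y_N)\in\mathcal X_N$, $t\in\mathbb R$ and $x\in\mathbb Z$, put $\Psi(t)=e^{-\mathrm i tH}e_Y=\sum_X\psi(X;t)e_X$, and let $$\mathbb P_Y(X_1(t)\ge x)=\sum_{m\ge x}\ \sum_{X\in\mathcal X_N,\ x_1=m}|\psi(X;t)|^2$$ be the probability that the left-most particle is at a site $\ge x$ at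 time $t$. For $0\le n\le N$ let $\mathcal T_n$ be the set of maps $\tau:\{1,\dots,N\}\to\{0,1,\dots,N\}$ with $|\tau^{-1}(0)|=n$ and $|\tau^{-1}(k)|\le1$ for $k=1,\dots,N$. For $\tau\in\mathcal T_n$ let $M=N-n$, $K_1=\tau^{-1}(0)$, $K_2=K_1^c=\{k_1<\dots<k_M\}$, $\tau_\ell=\tau(k_\ell)$, $J_2=\{\tau_1,\dots,\tau_M\}$, $J_1=J_2^c$ (complements in $\{1,\dots,N\}$), and let $\mathrm{inv}(\tau)$ be the number of pairs $\ell<\ell'$ with $\tau_\ell>\tau_{\ell'}$. Put $\varepsilon(z)=z+z^{-1}-2\Delta$, $d(x,y)=\dfrac1{(1-xy)(x+y-2\Delta xy)}$, $$D_N(\xi,\zeta;\tau)=(-1)^{\mathrm{inv}(\tau)+\sum_{\ell=1}^M(\tau_\ell-k_\ell)}\det\big(d(\xi_j,\zeta_k)\big)_{j\in J_1,\,k\in K_1},$$ where the rows and the columns are in increasing order (the empty determinant is $1$), $$I_N(\xi,\zeta;\tau)=\frac{\prod_{j\in J_1,k\in K_1}(\xi_j+\zeta_k-2\Delta\xi_j\zeta_k)\;D_N(\xi,\zeta;\tau)}{\prod_{j<k;\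 j,k\in J_1}(1+\xi_j\xi_k-2\Delta\xi_j)\prod_{j<k;\ j,k\in K_1}(1+\zeta_j\zeta_k-2\Delta\zeta_j)}\prod_{j\in J_1}\xi_j^{x-y_j-1}e^{-\mathrm it\varepsilon(\xi_j)}\prod_{k\in K_1}\zeta_k^{x-y_k-1}e^{\mathrm it\varepsilon(\zeta_k)},$$ $$f(\xi,\zeta;\tau)=\prod_{\ell=1}^M\left(\prod_{\substack{k>\tau_\ell\\ k\ne\tau_{\ell+1},\dots,\tau_M}}\frac{1+\xi_{\tau_\ell}\xi_k-2\Delta\xi_k}{1+\xi_{\tau_\ell}\xi_k-2\Delta\xi_{\tau_\ell}}\prod_{\substack{k>k_\ell\\ k\ne k_{\ell+1},\dots,k_M}}\frac{\xi_{\tau_\ell}+\zeta_k-2\Delta\xi_{\tau_\ell}\zeta_k}{\xi_{\tau_\ell}+\zeta_k-2\Delta}\right)\prod_{\ell=1}^M\xi_{\tau_\ell}^{\,y_{k_\ell}-y_{\tau_\ell}-1}.$$ Then, for all radii $R,R'>0$ with $$\max\{2|\Delta|^{-1},2(1+2|\Delta|)\}<R<\max\{4|\Delta|^{-1},4(1+2|\Delta|)\}<R'/2,$$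 $$\mathbb P_Y(X_1(t)\ge x)=\sum_{n=0}^N\sum_{\tau\in\mathcal T_n}\oint_{\mathcal C_R}\!\cdots\oint_{\mathcal C_R}\oint_{\mathcal C_{R'}}\!\cdots\oint_{\mathcal C_{R'}}I_N(\xi,\zeta;\tau)\,f(\xi,\zeta;\tau)\Big(\prod_{k\in K_1}d\zeta_k\Big)d^N\xi .$$ Here $\mathcal C_\rho$ is the positively oriented circle $|z|=\rho$, the $N$ variables $\xi_1,\dots,\xi_N$ run over $\mathcal C_R$, the $|K_1|=n$ variables $\zeta_k$ $(k\in K_1)$ run over $\mathcal C_{R'}$, and each differential $d\xi_j$, $d\zeta_k$ includes the factor $(2\pi\mathrm i)^{-1}$. -/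

import Mathlib

open scoped ENNReal

noncomputable section

namespace XXZ

/-! ### The spin chain on `ℤ` and its Hamiltonian -/

/-- Finite linear combinations of the basis states `e_A`, where `A` is the finite set of
sites that carry an up-spin. -/
abbrev FinState := Finset ℤ →₀ ℂ

/-- The Pauli operator `σ_j^3`: `e_A ↦ e_A` if `j ∈ A`, and `e_A ↦ -e_A` otherwise. -/
def sigma3 (j : ℤ) : FinState →ₗ[ℂ] FinState :=
  Finsupp.linearCombination ℂ fun A : Finset ℤ =>
    if j ∈ A then Finsupp.single A (1 : ℂ) else -Finsupp.single A (1 : ℂ)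

/-- The raising operator `σ_j^+`: `e_A ↦ 0` if `j ∈ A`, and `e_A ↦ e_{A ∪ {j}}` otherwise. -/
def sigmaPlus (j : ℤ) : FinState →ₗ[ℂ] FinState :=
  Finsupp.linearCombination ℂ fun A : Finset ℤ =>
    if j ∈ A then 0 else Finsupp.single (insert j A) (1 : ℂ)

/-- The lowering operator `σ_j^-`: `e_A ↦ e_{A \ {j}}` if `j ∈ A`, and `e_A ↦ 0` otherwise. -/
def sigmaMinus (j : ℤ) : FinState →ₗ[ℂ] FinState :=
  Finsupp.linearCombination ℂ fun A : Finset ℤ =>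
    if j ∈ A then Finsupp.single (A.erase j) (1 : ℂ) else 0

/-- `h_{j,j+1} = σ_j^+ σ_{j+1}^- + σ_j^- σ_{j+1}^+ + (Δ/2) (σ_j^3 σ_{j+1}^3 - 1)`. -/
def localH (Δ : ℝ) (j : ℤ) : FinState →ₗ[ℂ] FinState :=
  sigmaPlus j ∘ₗ sigmaMinus (j + 1) + sigmaMinus j ∘ₗ sigmaPlus (j + 1)
    + ((Δ : ℂ) / 2) • (sigma3 j ∘ₗ sigma3 (j + 1) - LinearMap.id)

/-- The matrix element `⟨e_A, H e_B⟩` of `H = ∑_{j ∈ ℤ} h_{j,j+1}`. Only finitely many `j`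
contribute, since `h_{j,j+1} e_B = 0` unless exactly one of `j`, `j + 1` lies in `B`. -/
def hamEntry (Δ : ℝ) (A B : Finset ℤ) : ℂ :=
  ∑ᶠ j : ℤ, localH Δ j (Finsupp.single B 1) A

/-- The configurations `x_1 < x_2 < ⋯ < x_N` of `N` particles (up-spins) on `ℤ`. -/
abbrev Config (N : ℕ) := {X : Fin N → ℤ // StrictMono X}

/-- The set of occupied sites of a configuration. -/
def sites {N : ℕ} (X : Config N) : Finset ℤ := Finset.univ.image X.1

theorem sites_injective {N : ℕ} : Function.Injective (sites (N := N)) := by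
  intro X Y h
  apply Subtype.ext
  refine (StrictMono.range_inj X.2 Y.2).1 ?_
  have := congrArg (fun s : Finset ℤ => (s : Set ℤ)) h
  simpa [sites] using this

theorem localH_single (Δ : ℝ) (j : ℤ) (B : Finset ℤ) :
    localH Δ j (Finsupp.single B 1) =
      if (j ∈ B ↔ j + 1 ∈ B) then 0
      else Finsupp.single (symmDiff B {j, j + 1}) 1 - (Δ : ℂ) • Finsupp.single B 1 := by
  have hne : j ≠ j + 1 := by omega
  by_cases h1 : j ∈ B <;> by_cases h2 : j + 1 ∈ B
  · simp [localH, sigmaPlus, sigmaMinus, sigma3, h1, h2]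
  · have e : (insert (j + 1) B).erase j = symmDiff B {j, j + 1} := by
      ext a
      simp only [Finset.mem_erase, Finset.mem_insert, Finset.mem_symmDiff, Finset.mem_singleton]
      by_cases ha : a = j
      · subst ha; simp [h1]
      · by_cases hb : a = j + 1
        · subst hb; simp [h2]
        · simp [ha, hb]
    have e' : -Finsupp.single B (1 : ℂ) - Finsupp.single B 1 = (-2 : ℂ) • Finsupp.single B 1 := by
      module
    simp only [localH, sigmaPlus, sigmaMinus, sigma3, LinearMap.add_apply, LinearMap.comp_apply,
      LinearMap.smul_apply, LinearMap.sub_apply, LinearMap.id_apply,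
      Finsupp.linearCombination_single, one_smul, h1, h2, if_true, if_false, map_zero, map_neg,
      Finset.mem_insert, or_true, e, e', zero_add, smul_smul, iff_false, not_true_eq_false]
    rw [sub_eq_add_neg, ← neg_smul]
    congr 2
    ring
  · have e : insert j (B.erase (j + 1)) = symmDiff B {j, j + 1} := by
      ext a
      simp only [Finset.mem_erase, Finset.mem_insert, Finset.mem_symmDiff, Finset.mem_singleton]
      by_cases ha : a = j
      · subst ha; simp [h1]
      · by_cases hb : a = j + 1
        · subst hb; simp [h2]
        · simp [ha, hb]
    have e' : -Finsupp.single B (1 : ℂ) - Finsupp.single B 1 = (-2 : ℂ) • Finsupp.single B 1 := by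
      module
    simp only [localH, sigmaPlus, sigmaMinus, sigma3, LinearMap.add_apply, LinearMap.comp_apply,
      LinearMap.smul_apply, LinearMap.sub_apply, LinearMap.id_apply,
      Finsupp.linearCombination_single, one_smul, h1, h2, if_true, if_false, map_zero,
      Finset.mem_erase, and_false, e, e', add_zero, smul_smul, iff_true]
    rw [sub_eq_add_neg, ← neg_smul]
    congr 2
    ring
  · simp [localH, sigmaPlus, sigmaMinus, sigma3, h1, h2]

theorem symmDiff_eq_comm {A B P : Finset ℤ} : symmDiff B P = A ↔ symmDiff A P = B := by
  constructor <;> rintro rfl <;> simp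

theorem localH_symm (Δ : ℝ) (j : ℤ) (A B : Finset ℤ) :
    localH Δ j (Finsupp.single B 1) A = localH Δ j (Finsupp.single A 1) B := by
  have key : ∀ A B : Finset ℤ, symmDiff B {j, j + 1} = A →
      ((j ∈ B ↔ j + 1 ∈ B) ↔ (j ∈ A ↔ j + 1 ∈ A)) := by
    rintro A B rfl
    simp only [Finset.mem_symmDiff, Finset.mem_insert, Finset.mem_singleton]
    tauto
  rw [localH_single, localH_single]
  by_cases hAB : A = B
  · subst hAB; rfl
  have hBA : B ≠ A := fun h => hAB h.symm
  by_cases hs : symmDiff B {j, j + 1} = A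
  · have h2 := key A B hs
    have hs' := symmDiff_eq_comm.1 hs
    by_cases h : (j ∈ B ↔ j + 1 ∈ B)
    · rw [if_pos h, if_pos (h2.1 h)]; rfl
    · rw [if_neg h, if_neg (fun h' => h (h2.2 h'))]
      simp [hs, hs', hAB, hBA]
  · have hs' : symmDiff A {j, j + 1} ≠ B := fun h => hs (symmDiff_eq_comm.1 h)
    split_ifs <;> simp [hs, hs', hAB, hBA]

theorem hamEntry_symm (Δ : ℝ) (A B : Finset ℤ) : hamEntry Δ A B = hamEntry Δ B A :=
  finsum_congr fun j => localH_symm Δ j A B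

/-- The bonds `(j, j + 1)` that touch a set of sites. -/
def bonds (B : Finset ℤ) : Finset ℤ := B ∪ B.image (fun a => a - 1)

theorem localH_single_eq_zero (Δ : ℝ) {j : ℤ} {B : Finset ℤ} (h : j ∉ bonds B) :
    localH Δ j (Finsupp.single B 1) = 0 := by
  rw [localH_single, if_pos]
  simp only [bonds, Finset.mem_union, Finset.mem_image, not_or, not_exists, not_and] at h
  have h2 : j + 1 ∉ B := fun h' => h.2 _ h' (by omega)
  simp [h.1, h2]

theorem hamEntry_eq_sum (Δ : ℝ) (A B : Finset ℤ) :
    hamEntry Δ A B = ∑ j ∈ bonds B, localH Δ j (Finsupp.single B 1) A := by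
  refine finsum_eq_sum_of_support_subset _ ?_
  intro j hj
  by_contra h
  exact hj (by simp [localH_single_eq_zero Δ (by simpa using h)])

theorem sum_norm_localH_le (Δ : ℝ) (j : ℤ) (B : Finset ℤ) (s : Finset (Finset ℤ)) :
    ∑ A ∈ s, ‖localH Δ j (Finsupp.single B 1) A‖ ≤ 1 + |Δ| := by
  have hb : ∀ A, ‖localH Δ j (Finsupp.single B 1) A‖ ≤
      (if symmDiff B {j, j + 1} = A then 1 else 0) + (if B = A then |Δ| else 0) := by
    intro A
    rw [localH_single]
    by_cases h : (j ∈ B ↔ j + 1 ∈ B)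
    · rw [if_pos h, Finsupp.coe_zero, Pi.zero_apply, norm_zero]
      positivity
    · rw [if_neg h, Finsupp.sub_apply, Finsupp.smul_apply, Finsupp.single_apply,
        Finsupp.single_apply]
      refine (norm_sub_le _ _).trans (add_le_add ?_ ?_) <;> split_ifs <;> simp
  calc _ ≤ ∑ A ∈ s, ((if symmDiff B {j, j + 1} = A then (1 : ℝ) else 0)
            + (if B = A then |Δ| else 0)) := Finset.sum_le_sum fun A _ => hb A
    _ ≤ _ := by
      rw [Finset.sum_add_distrib, Finset.sum_ite_eq, Finset.sum_ite_eq]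
      have := abs_nonneg Δ
      split_ifs <;> linarith

/-- A bound for the norm of `H` on the `N`-particle sector. -/
def hamBound (N : ℕ) (Δ : ℝ) : ℝ := (2 * N) * (1 + |Δ|)

theorem hamBound_nonneg (N : ℕ) (Δ : ℝ) : 0 ≤ hamBound N Δ := by
  unfold hamBound; positivity

theorem sum_norm_col_le {N : ℕ} (Δ : ℝ) (X' : Config N) (s : Finset (Config N)) :
    ∑ X ∈ s, ‖hamEntry Δ (sites X) (sites X')‖ ≤ hamBound N Δ := by
  set B := sites X' with hB
  have hcard : ((bonds B).card : ℝ) ≤ 2 * N := by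
    have h1 : B.card ≤ N := by
      simpa [hB, sites] using (Finset.card_image_le (s := Finset.univ) (f := X'.1))
    have h2 := Finset.card_union_le B (B.image (fun a => a - 1))
    have h3 := Finset.card_image_le (s := B) (f := fun a => a - 1)
    have : (bonds B).card ≤ 2 * N := by unfold bonds; omega
    exact_mod_cast this
  have e : ∑ X ∈ s, ‖hamEntry Δ (sites X) B‖ = ∑ A ∈ s.image sites, ‖hamEntry Δ A B‖ := by
    rw [Finset.sum_image]
    exact fun _ _ _ _ h => sites_injective h
  rw [e]
  calc _ ≤ ∑ A ∈ s.image sites, ∑ j ∈ bonds B, ‖localH Δ j (Finsupp.single B 1) A‖ := by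
        refine Finset.sum_le_sum fun A _ => ?_
        rw [hamEntry_eq_sum]
        exact norm_sum_le _ _
    _ = ∑ j ∈ bonds B, ∑ A ∈ s.image sites, ‖localH Δ j (Finsupp.single B 1) A‖ :=
        Finset.sum_comm
    _ ≤ ∑ _j ∈ bonds B, (1 + |Δ|) :=
        Finset.sum_le_sum fun j _ => sum_norm_localH_le Δ j B _
    _ = (bonds B).card * (1 + |Δ|) := by rw [Finset.sum_const, nsmul_eq_mul]
    _ ≤ _ := by unfold hamBound; gcongr

theorem sum_norm_row_le {N : ℕ} (Δ : ℝ) (X : Config N) (s : Finset (Config N)) :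
    ∑ X' ∈ s, ‖hamEntry Δ (sites X) (sites X')‖ ≤ hamBound N Δ := by
  simp_rw [hamEntry_symm Δ (sites X)]
  exact sum_norm_col_le Δ X s

/-- The `N`-particle Hilbert space `ℓ²` of the set of configurations. -/
abbrev HilbertN (N : ℕ) := lp (fun _ : Config N => ℂ) 2

theorem summable_row {N : ℕ} (Δ : ℝ) (X : Config N) :
    Summable fun X' : Config N => ‖hamEntry Δ (sites X) (sites X')‖ :=
  summable_of_sum_le (fun _ => norm_nonneg _) (sum_norm_row_le Δ X)

theorem summable_action_norm {N : ℕ} (Δ : ℝ) (ψ : HilbertN N) (X : Config N) :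
    Summable fun X' : Config N => ‖hamEntry Δ (sites X) (sites X') * ψ X'‖ := by
  simp_rw [norm_mul]
  refine Summable.of_nonneg_of_le (fun _ => by positivity) (fun X' => ?_)
    ((summable_row Δ X).mul_right ‖ψ‖)
  gcongr
  exact lp.norm_apply_le_norm (by norm_num) ψ X'

theorem summable_action {N : ℕ} (Δ : ℝ) (ψ : HilbertN N) (X : Config N) :
    Summable fun X' : Config N => hamEntry Δ (sites X) (sites X') * ψ X' :=
  (summable_action_norm Δ ψ X).of_norm

theorem summable_sq {N : ℕ} (ψ : HilbertN N) : Summable fun X : Config N => ‖ψ X‖ ^ 2 := by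
  have := (lp.memℓp ψ).summable (by norm_num)
  simpa using this

theorem tsum_sq {N : ℕ} (ψ : HilbertN N) : ∑' X : Config N, ‖ψ X‖ ^ 2 = ‖ψ‖ ^ 2 := by
  have := lp.norm_rpow_eq_tsum (p := 2) (by norm_num) ψ
  simpa using this.symm

theorem summable_row_sq {N : ℕ} (Δ : ℝ) (ψ : HilbertN N) (X : Config N) :
    Summable fun X' : Config N => ‖hamEntry Δ (sites X) (sites X')‖ * ‖ψ X'‖ ^ 2 := by
  refine Summable.of_nonneg_of_le (fun _ => by positivity) (fun X' => ?_)
    ((summable_row Δ X).mul_right (‖ψ‖ ^ 2))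
  gcongr
  exact lp.norm_apply_le_norm (by norm_num) ψ X'

theorem norm_action_sq_le {N : ℕ} (Δ : ℝ) (ψ : HilbertN N) (X : Config N) :
    ‖∑' X' : Config N, hamEntry Δ (sites X) (sites X') * ψ X'‖ ^ 2 ≤
      hamBound N Δ * ∑' X' : Config N, ‖hamEntry Δ (sites X) (sites X')‖ * ‖ψ X'‖ ^ 2 := by
  have h1 : ‖∑' X' : Config N, hamEntry Δ (sites X) (sites X') * ψ X'‖ ≤
      ∑' X' : Config N, ‖hamEntry Δ (sites X) (sites X') * ψ X'‖ :=
    norm_tsum_le_tsum_norm (summable_action_norm Δ ψ X)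
  refine (pow_le_pow_left₀ (norm_nonneg _) h1 2).trans ?_
  have h2 := ((summable_action_norm Δ ψ X).hasSum).pow 2
  refine le_of_tendsto h2 (Filter.Eventually.of_forall fun s => ?_)
  calc (∑ X' ∈ s, ‖hamEntry Δ (sites X) (sites X') * ψ X'‖) ^ 2
      ≤ (∑ X' ∈ s, ‖hamEntry Δ (sites X) (sites X')‖) *
          ∑ X' ∈ s, ‖hamEntry Δ (sites X) (sites X')‖ * ‖ψ X'‖ ^ 2 := by
        refine Finset.sum_sq_le_sum_mul_sum_of_sq_le_mul s (fun _ _ => norm_nonneg _)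
          (fun _ _ => by positivity) (fun X' _ => ?_)
        rw [norm_mul]; exact le_of_eq (by ring)
    _ ≤ _ := by
        refine mul_le_mul (sum_norm_row_le Δ X s) ?_ (Finset.sum_nonneg fun _ _ => by positivity)
          (hamBound_nonneg N Δ)
        exact (summable_row_sq Δ ψ X).sum_le_tsum s (fun _ _ => by positivity)

theorem sum_norm_action_sq_le {N : ℕ} (Δ : ℝ) (ψ : HilbertN N) (s : Finset (Config N)) :
    ∑ X ∈ s, ‖∑' X' : Config N, hamEntry Δ (sites X) (sites X') * ψ X'‖ ^ 2 ≤
      (hamBound N Δ * ‖ψ‖) ^ 2 := by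
  have hC := hamBound_nonneg N Δ
  calc _ ≤ ∑ X ∈ s, hamBound N Δ *
        ∑' X' : Config N, ‖hamEntry Δ (sites X) (sites X')‖ * ‖ψ X'‖ ^ 2 :=
        Finset.sum_le_sum fun X _ => norm_action_sq_le Δ ψ X
    _ = hamBound N Δ * ∑' X' : Config N,
          ∑ X ∈ s, ‖hamEntry Δ (sites X) (sites X')‖ * ‖ψ X'‖ ^ 2 := by
        rw [← Finset.mul_sum, Summable.tsum_finsetSum fun X _ => summable_row_sq Δ ψ X]
    _ ≤ hamBound N Δ * ∑' X' : Config N, hamBound N Δ * ‖ψ X'‖ ^ 2 := by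
        refine mul_le_mul_of_nonneg_left ?_ hC
        refine Summable.tsum_le_tsum (fun X' => ?_)
          (summable_sum fun X _ => summable_row_sq Δ ψ X) ((summable_sq ψ).mul_left _)
        rw [← Finset.sum_mul]
        gcongr
        exact sum_norm_col_le Δ X' s
    _ = _ := by rw [tsum_mul_left, tsum_sq]; ring

/-- The restriction of `H = ∑_{j ∈ ℤ} h_{j,j+1}` to the `N`-particle sector, as a bounded operator:
`(H ψ)(X) = ∑_{X'} ⟨e_X, H e_{X'}⟩ ψ(X')`. -/
def hamiltonian (N : ℕ) (Δ : ℝ) : HilbertN N →L[ℂ] HilbertN N :=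
  LinearMap.mkContinuous
    { toFun := fun ψ =>
        ⟨fun X => ∑' X' : Config N, hamEntry Δ (sites X) (sites X') * ψ X',
          memℓp_gen' (C := (hamBound N Δ * ‖ψ‖) ^ 2) fun s => by
            simpa using sum_norm_action_sq_le Δ ψ s⟩
      map_add' := fun ψ φ => by
        ext X
        simp only [lp.coeFn_add, Pi.add_apply, mul_add]
        exact (summable_action Δ ψ X).tsum_add (summable_action Δ φ X)
      map_smul' := fun c ψ => by
        ext X
        simp only [lp.coeFn_smul, Pi.smul_apply, smul_eq_mul, RingHom.id_apply, ← tsum_mul_left]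
        exact tsum_congr fun X' => by ring }
    (hamBound N Δ) fun ψ => by
      refine lp.norm_le_of_forall_sum_le (by norm_num)
        (mul_nonneg (hamBound_nonneg N Δ) (norm_nonneg _)) fun s => ?_
      simpa using sum_norm_action_sq_le Δ ψ s

/-- The state `Ψ_N(t) = exp(-i t H) e_Y`, i.e. the solution of `i ∂_t Ψ = H Ψ`, `Ψ(0) = e_Y`. -/
def state {N : ℕ} (Δ : ℝ) (Y : Config N) (t : ℝ) : HilbertN N :=
  NormedSpace.exp ((-(Complex.I * (t : ℂ))) • hamiltonian N Δ) (lp.single 2 Y (1 : ℂ))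

/-- The probability that at time `t` the left-most particle is at the site `m`, when the initial
state is `e_Y`. -/
def probLeftmostEq {N : ℕ} [NeZero N] (Δ : ℝ) (Y : Config N) (t : ℝ) (m : ℤ) : ℝ :=
  ∑' X : {X : Config N // X.1 0 = m}, ‖state Δ Y t X.1‖ ^ 2

/-- `P_Y(X_1(t) ≥ x) = ∑_{m ≥ x} P_Y(X_1(t) = m)`. -/
def probLeftmostGE {N : ℕ} [NeZero N] (Δ : ℝ) (Y : Config N) (t : ℝ) (x : ℤ) : ℝ :=
  ∑' m : Set.Ici x, probLeftmostEq Δ Y t (m : ℤ)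

/-! ### The index maps -/

/-- The set `T_n` of maps `τ : {1, …, N} → {0, 1, …, N}` with exactly `n` preimages of `0` that are
injective off `τ⁻¹(0)`. The value `0` is `none`, the value `j ∈ {1, …, N}` is `some j`. -/
def maps (N n : ℕ) : Finset (Fin N → Option (Fin N)) :=
  Finset.univ.filter fun τ =>
    (Finset.univ.filter fun k => τ k = none).card = n ∧
      ∀ j : Fin N, (Finset.univ.filter fun k => τ k = some j).card ≤ 1

/-- `K_1 = τ⁻¹(0)`. -/
def setK1 {N : ℕ} (τ : Fin N → Option (Fin N)) : Finset (Fin N) :=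
  Finset.univ.filter fun k => τ k = none

/-- `J_1`, the set of the `j ∈ {1, …, N}` that are not values of `τ`. -/
def setJ1 {N : ℕ} (τ : Fin N → Option (Fin N)) : Finset (Fin N) :=
  Finset.univ.filter fun j => ∀ k, τ k ≠ some j

theorem card_setK1 {N n : ℕ} (τ : maps N n) : (setK1 τ.1).card = n :=
  (Finset.mem_filter.1 τ.2).2.1

theorem card_setJ1 {N n : ℕ} (τ : maps N n) : (setJ1 τ.1).card = n := by
  have hinj := (Finset.mem_filter.1 τ.2).2.2
  have h1 : (Finset.univ : Finset (Fin N)).card =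
      ∑ o : Option (Fin N), (Finset.univ.filter fun k => τ.1 k = o).card :=
    Finset.card_eq_sum_card_fiberwise (fun _ _ => Finset.mem_univ _)
  rw [Fintype.sum_option] at h1
  have h2 : ∑ j : Fin N, (Finset.univ.filter fun k => τ.1 k = some j).card
      + (setJ1 τ.1).card = ∑ _j : Fin N, 1 := by
    rw [setJ1, Finset.card_filter, ← Finset.sum_add_distrib]
    refine Finset.sum_congr rfl fun j _ => ?_
    by_cases h : ∀ k, τ.1 k ≠ some j
    · rw [if_pos h]
      simp [h]
    · rw [if_neg h]
      push Not at h
      obtain ⟨k, hk⟩ := h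
      have : 0 < (Finset.univ.filter fun k => τ.1 k = some j).card :=
        Finset.card_pos.2 ⟨k, by simp [hk]⟩
      have := hinj j
      omega
  have h3 := card_setK1 τ
  unfold setK1 at h3
  simp only [Finset.card_univ, Fintype.card_fin, Finset.sum_const, smul_eq_mul, mul_one] at h1 h2
  omega

/-- The increasing enumeration of `K_1`. -/
def enumK1 {N n : ℕ} (τ : maps N n) : Fin n ↪o Fin N :=
  (setK1 τ.1).orderEmbOfFin (card_setK1 τ)

/-- The increasing enumeration of `J_1`. -/
def enumJ1 {N n : ℕ} (τ : maps N n) : Fin n ↪o Fin N :=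
  (setJ1 τ.1).orderEmbOfFin (card_setJ1 τ)

/-- `∑_ℓ (τ(k_ℓ) - k_ℓ)`, the sum over the `k_ℓ` with `τ(k_ℓ) ≠ 0`. -/
def shift {N : ℕ} (τ : Fin N → Option (Fin N)) : ℤ :=
  ∑ k : Fin N, match τ k with
    | none => 0
    | some a => ((a : ℕ) : ℤ) - ((k : ℕ) : ℤ)

/-- The number of inversions of `τ` off `τ⁻¹(0)`: the pairs `k < l` with
`τ(k) > τ(l)` and `τ(k), τ(l) ≠ 0`. -/
def inversions {N : ℕ} (τ : Fin N → Option (Fin N)) : ℕ :=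
  (Finset.univ.filter fun p : Fin N × Fin N =>
    p.1 < p.2 ∧ ∃ a b : Fin N, τ p.1 = some a ∧ τ p.2 = some b ∧ b < a).card

/-! ### The integrand

The `ξ`-variables are indexed by `{1, …, N}`, the `ζ`-variables by `K_1`: for `b : Fin n`, `ζ b` is
the variable `ζ_k` where `k = enumK1 τ b` is the `b`-th element of `K_1`. -/

/-- `ε(ξ) = ξ + 1/ξ - 2Δ`. -/
def energy (Δ : ℝ) (z : ℂ) : ℂ := z + z⁻¹ - 2 * Δ

/-- `d(x, y) = 1 / ((1 - x y) (x + y - 2 Δ x y))`. -/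
def dFun (Δ : ℝ) (a b : ℂ) : ℂ := 1 / ((1 - a * b) * (a + b - 2 * Δ * a * b))

/-- `D_N(ξ, ζ; τ)`: the signed minor of `(d(ξ_j, ζ_k))` with the rows `J_1` and the
columns `K_1`. -/
def detD {N n : ℕ} (Δ : ℝ) (τ : maps N n) (ξ : Fin N → ℂ) (ζ : Fin n → ℂ) : ℂ :=
  (-1) ^ shift τ.1 * (-1) ^ inversions τ.1 *
    Matrix.det (Matrix.of fun a b : Fin n => dFun Δ (ξ (enumJ1 τ a)) (ζ b))

/-- `I_N(ξ, ζ; τ)`. -/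
def integrandI {N n : ℕ} (Δ : ℝ) (Y : Config N) (t : ℝ) (x : ℤ) (τ : maps N n)
    (ξ : Fin N → ℂ) (ζ : Fin n → ℂ) : ℂ :=
  (∏ a : Fin n, ∏ b : Fin n,
      (ξ (enumJ1 τ a) + ζ b - 2 * Δ * ξ (enumJ1 τ a) * ζ b)) * detD Δ τ ξ ζ /
    ((∏ a : Fin n, ∏ b ∈ Finset.Ioi a,
        (1 + ξ (enumJ1 τ a) * ξ (enumJ1 τ b) - 2 * Δ * ξ (enumJ1 τ a))) *
      ∏ a : Fin n, ∏ b ∈ Finset.Ioi a, (1 + ζ a * ζ b - 2 * Δ * ζ a)) *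
    (∏ a : Fin n, ξ (enumJ1 τ a) ^ (x - Y.1 (enumJ1 τ a) - 1) *
      Complex.exp (-(Complex.I * t * energy Δ (ξ (enumJ1 τ a))))) *
    ∏ b : Fin n, ζ b ^ (x - Y.1 (enumK1 τ b) - 1) *
      Complex.exp (Complex.I * t * energy Δ (ζ b))

/-- `f(ξ, ζ; τ)`: the product over the `k` with `τ(k) = a ≠ 0`; the first inner product is over the
`j > a` that are not of the form `τ(k')` with `k' > k`, and the second one over
the elements of `K_1` beyond `k`. -/
def integrandF {N n : ℕ} (Δ : ℝ) (Y : Config N) (τ : maps N n)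
    (ξ : Fin N → ℂ) (ζ : Fin n → ℂ) : ℂ :=
  ∏ k : Fin N, match τ.1 k with
    | none => 1
    | some a =>
      (∏ j ∈ (Finset.Ioi a).filter (fun j => ∀ k', k < k' → τ.1 k' ≠ some j),
        (1 + ξ a * ξ j - 2 * Δ * ξ j) / (1 + ξ a * ξ j - 2 * Δ * ξ a)) *
      (∏ b ∈ Finset.univ.filter (fun b : Fin n => k < enumK1 τ b),
        (ξ a + ζ b - 2 * Δ * ξ a * ζ b) / (ξ a + ζ b - 2 * Δ)) *
      ξ a ^ (Y.1 k - Y.1 a - 1)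

/-- The `m`-fold contour integral over the positively oriented circle `|z| = R` in each variable,
with the measure `dz / (2 π i)` in each variable. -/
def contourIntegral (m : ℕ) (R : ℝ) (g : (Fin m → ℂ) → ℂ) : ℂ :=
  ((2 * Real.pi * Complex.I : ℂ) ^ m)⁻¹ * torusIntegral g 0 (fun _ => R)

end XXZ

end

noncomputable section

namespace XXZ

open Complex Filter Topology Asymptotics MeasureTheory Metric Set

/-! ### Contour integrals over circles and tori -/

/-! Let `Ψ = exp(-itH) e_Y`, and let `P` be the projection onto the configurations with left-most
particle at a site `≥ x`. The probability is `⟨Ψ, PΨ⟩`. Since `H` is bounded and self-adjoint, this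
is the value at `Y` of `exp(itH) P Ψ` (`probLeftmostGE_eq_inner`, `inner_state`). It remains to
write `PΨ` as a superposition of functions on which `H` acts by multiplying the integrand by an
energy.

For `Ψ` this is the Bethe ansatz. On a function of `ℤ^N` that satisfies a linear condition wherever
two consecutive particles are neighbours, `H` acts as a sum of free hops (`hamAct_eq_free`). The
antisymmetrised plane waves with scattering factors `1 + ξξ' - 2Δξ` satisfy the condition.
Integrated over `|ξ_j| = R` against `∏ ξ_j^(-y_j-1)`, they give `e_Y`
(`torusIntegral_betheIntegrand`), hence a contour integral for `Ψ`
(`state_apply_eq_contourIntegral`).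

The cut-off `P` destroys the free action. It is restored by an identity for fixed `ξ`
(`sum_contourIntegral_core`): the Bethe function cut off at `x` is the sum over all `n` and `τ` of
integrals over `ζ` of plane waves in which a particle of `K_1` carries the multiplier `1/ζ` and
every other particle `k` carries `ξ_{τ(k)}`. If all particles are at sites `≥ x`, a `ζ`-contour can
be pushed to infinity, and only `n = 0` survives, which is the Bethe function. Otherwise take `τ`
with the first particle in `K_1` and shrink the contour of its `ζ`. The residue at `ζ = 1/ξ_a` is
minus the term in which the first particle receives `ξ_a`, a term with one zero fewer; the remaining
integral over a small circle vanishes. The terms with the first particle in `K_1` thus cancel those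
with the first particle outside `K_1`, and the total is zero.

For each `n` the sum over `τ` satisfies the boundary condition (`boundaryCondition_waveIntegral`):
exchanging the values of `τ` at two neighbours cancels the defects in pairs, and if both lie in
`K_1`, exchanging their `ζ`-variables does. Powers of `H` thus insert powers of the energy
(`pow_hamiltonian_apply`). Summing the exponential series gives `exp(itH) P Ψ`, and `integrand_eq`
identifies the result with `I_N f`.

Orthogonality and the vanishing on the small circle share one mechanism,
`torusIntegral_scattering_eq_zero`: if the only poles in `z_0` come from the scattering factors with
the other variables, the residue at `z_0 = 1/(c - z_k)` is an integrand holomorphic in `z_k` outside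
a disc and quadratically small at infinity. -/

theorem torusMap_mem {m : ℕ} {ρ : Fin m → ℝ} (hρ : ∀ i, 0 < ρ i) (θ : Fin m → ℝ) (i : Fin m) :
    ‖torusMap 0 ρ θ i‖ = ρ i := by
  simp [torusMap, abs_of_pos (hρ i)]

theorem continuous_torusMap {m : ℕ} (ρ : Fin m → ℝ) : Continuous (torusMap 0 ρ) := by
  unfold torusMap
  fun_prop

theorem torusIntegrable_of_continuous {m : ℕ} {ρ : Fin m → ℝ} {f : (Fin m → ℂ) → ℂ}
    (hf : Continuous fun θ => f (torusMap 0 ρ θ)) : TorusIntegrable f 0 ρ :=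
  hf.continuousOn.integrableOn_compact isCompact_Icc

theorem torusIntegral_congr {m : ℕ} {ρ : Fin m → ℝ} (hρ : ∀ i, 0 < ρ i) {f g : (Fin m → ℂ) → ℂ}
    (h : ∀ z, (∀ i, ‖z i‖ = ρ i) → f z = g z) : torusIntegral f 0 ρ = torusIntegral g 0 ρ := by
  unfold torusIntegral
  congr 1
  funext θ
  rw [h _ (torusMap_mem hρ θ)]

theorem torusIntegral_eq_zero {m : ℕ} {ρ : Fin m → ℝ} (hρ : ∀ i, 0 < ρ i) {f : (Fin m → ℂ) → ℂ}
    (h : ∀ z, (∀ i, ‖z i‖ = ρ i) → f z = 0) : torusIntegral f 0 ρ = 0 := by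
  rw [torusIntegral_congr hρ h]
  simp [torusIntegral]

theorem torusIntegral_finsetSum {m : ℕ} {ι : Type*} (s : Finset ι) {ρ : Fin m → ℝ}
    {f : ι → (Fin m → ℂ) → ℂ} (hf : ∀ i ∈ s, Continuous fun θ => f i (torusMap 0 ρ θ)) :
    torusIntegral (fun z => ∑ i ∈ s, f i z) 0 ρ = ∑ i ∈ s, torusIntegral (f i) 0 ρ := by
  unfold torusIntegral
  simp_rw [Finset.smul_sum]
  exact integral_finsetSum s fun i hi =>
    (torusIntegrable_of_continuous (hf i hi)).function_integrable

/-- Fubini with the distinguished circle innermost, so that one variable can be deformed while the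
others stay fixed on their circles. -/
theorem torusIntegral_succAbove' {n : ℕ} {f : (Fin (n + 1) → ℂ) → ℂ} {ρ : Fin (n + 1) → ℝ}
    (hf : TorusIntegrable f 0 ρ) (i : Fin (n + 1)) :
    torusIntegral f 0 ρ =
      torusIntegral (fun y => ∮ x in C(0, ρ i), f (i.insertNth x y)) 0 (ρ ∘ i.succAbove) := by
  set e : ℝ × (Fin n → ℝ) ≃ᵐ (Fin (n + 1) → ℝ) :=
    (MeasurableEquiv.piFinSuccAbove (fun _ => ℝ) i).symm
  have hem : MeasurePreserving e :=
    (volume_preserving_piFinSuccAbove (fun _ : Fin (n + 1) => ℝ) i).symm _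
  have heπ : (e ⁻¹' Icc 0 fun _ => 2 * Real.pi) =
      Icc 0 (2 * Real.pi) ×ˢ Icc (0 : Fin n → ℝ) fun _ => 2 * Real.pi :=
    ((Fin.insertNthOrderIso (fun _ => ℝ) i).preimage_Icc _ _).trans (Icc_prod_eq _ _)
  have hint := hf.function_integrable
  rw [← hem.integrableOn_comp_preimage e.measurableEmbedding, heπ] at hint
  have key : ∀ (x : ℝ) (y : Fin n → ℝ), torusMap 0 ρ (e (x, y)) =
      i.insertNth (circleMap 0 (ρ i) x) (torusMap 0 (ρ ∘ i.succAbove) y) := by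
    intro x y
    funext k
    refine Fin.succAboveCases i ?_ (fun k => ?_) k
    · simp [e, torusMap, circleMap, Fin.insertNthEquiv]
    · simp [e, torusMap, Fin.insertNthEquiv]
  rw [torusIntegral, ← hem.map_eq, setIntegral_map_equiv, heπ, Measure.volume_eq_prod,
    ← setIntegral_prod_swap, setIntegral_prod]
  · rw [torusIntegral]
    refine setIntegral_congr_fun measurableSet_Icc fun y _ => ?_
    simp only [Prod.swap_prod_mk]
    rw [circleIntegral_def_Icc, ← integral_smul]
    refine setIntegral_congr_fun measurableSet_Icc fun x _ => ?_
    simp only [key, smul_smul, deriv_circleMap, circleMap_zero]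
    rw [i.prod_univ_succAbove]
    congr 1
    simp [e, Fin.insertNthEquiv]
    ring
  · exact hint.swap

theorem torusIntegral_cons {n : ℕ} {f : (Fin (n + 1) → ℂ) → ℂ} {ρ0 : ℝ} {ρ : Fin n → ℝ}
    (hf : Continuous fun θ => f (torusMap 0 (Fin.cons ρ0 ρ : Fin (n + 1) → ℝ) θ)) :
    torusIntegral f 0 (Fin.cons ρ0 ρ : Fin (n + 1) → ℝ) =
      torusIntegral (fun y => ∮ x in C(0, ρ0), f (Fin.cons x y)) 0 ρ := by
  rw [torusIntegral_succAbove' (torusIntegrable_of_continuous hf) 0]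
  simp only [Fin.cons_zero, Fin.insertNth_zero]
  rfl

/-- The integral over a circle of a function that is holomorphic outside and decays
quadratically vanishes. -/
theorem circleIntegral_eq_zero_of_isBigO {g : ℂ → ℂ} {r ρ : ℝ} (hr : 0 ≤ r) (hρ : r < ρ)
    (hg : DifferentiableOn ℂ g {w | r < ‖w‖})
    (hO : g =O[Bornology.cobounded ℂ] fun w => w ^ (-2 : ℤ)) : (∮ w in C(0, ρ), g w) = 0 := by
  have hopen : IsOpen {w : ℂ | r < ‖w‖} := isOpen_lt continuous_const continuous_norm
  obtain ⟨K, hK⟩ := hO.bound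
  rw [Filter.HasBasis.eventually_iff (hasBasis_cobounded_norm (E := ℂ))] at hK
  obtain ⟨T0, -, hT0⟩ := hK
  have hρ0 : 0 < ρ := hr.trans_lt hρ
  have hconst : ∀ T, ρ ≤ T → (∮ w in C(0, ρ), g w) = ∮ w in C(0, T), g w := by
    intro T hT
    refine (Complex.circleIntegral_eq_of_differentiable_on_annulus_off_countable hρ0 hT
      countable_empty ?_ ?_).symm
    · refine hg.continuousOn.mono fun z hz => ?_
      have := hz.2
      simp only [mem_ball, dist_zero_right, not_lt] at this
      exact hρ.trans_le this
    · intro z hz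
      refine hg.differentiableAt (hopen.mem_nhds ?_)
      have := hz.1.2
      simp only [mem_closedBall, dist_zero_right, not_le] at this
      exact hρ.trans this
  -- The circle has length `2πT` and the integrand is of order `T⁻²`, so the integral, which does
  -- not depend on `T`, is of order `1/T`.
  have hbound : ∀ T, max ρ T0 ≤ T → ‖∮ w in C(0, ρ), g w‖ ≤ 2 * Real.pi * |K| * T⁻¹ := by
    intro T hT
    have hTρ := (le_max_left _ _).trans hT
    have hTpos : 0 < T := hρ0.trans_le hTρ
    rw [hconst T hTρ]
    have : ‖∮ w in C(0, T), g w‖ ≤ 2 * Real.pi * T * (|K| * T ^ (-2 : ℤ)) := by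
      refine circleIntegral.norm_integral_le_of_norm_le_const hTpos.le fun z hz => ?_
      have hz' : ‖z‖ = T := by simpa using hz
      have h1 := hT0 (show T0 ≤ ‖z‖ by rw [hz']; exact (le_max_right _ _).trans hT)
      simp only [norm_zpow, hz'] at h1
      refine h1.trans ?_
      gcongr
      exact le_abs_self K
    refine this.trans (le_of_eq ?_)
    rw [zpow_neg]
    field_simp
  rw [← norm_le_zero_iff]
  refine ge_of_tendsto (x := atTop) (f := fun T : ℝ => 2 * Real.pi * |K| * T⁻¹) ?_ ?_
  · simpa using tendsto_inv_atTop_zero.const_mul (2 * Real.pi * |K|)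
  · filter_upwards [eventually_ge_atTop (max ρ T0)] with T hT using hbound T hT

theorem isBigO_inv_sub (a : ℂ) :
    (fun w : ℂ => (w - a)⁻¹) =O[Bornology.cobounded ℂ] fun w => w⁻¹ := by
  refine IsBigO.of_bound 2 ?_
  rw [Filter.HasBasis.eventually_iff (hasBasis_cobounded_norm (E := ℂ))]
  refine ⟨2 * ‖a‖ + 1, trivial, fun w hw => ?_⟩
  simp only [mem_ofPred_eq] at hw
  have ha := norm_nonneg a
  have h1 : ‖w‖ / 2 ≤ ‖w - a‖ := by
    have := norm_sub_norm_le w a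
    linarith
  have h2 : 0 < ‖w‖ := by linarith
  rw [norm_inv, norm_inv]
  calc ‖w - a‖⁻¹ ≤ (‖w‖ / 2)⁻¹ := by gcongr
    _ = 2 * ‖w‖⁻¹ := by field_simp

/-- Every zero of `g` removes one simple pole: `dslope g (a i)` is holomorphic outside the disc,
still vanishes at the other nodes, and grows one order more slowly. After all factors are gone,
quadratic decay remains. -/
theorem circleIntegral_div_prod_eq_zero {ι : Type*} (s : Finset ι) (a : ι → ℂ)
    (ha : Set.InjOn a s) {r ρ : ℝ} (hr : 0 ≤ r) (hρ : r < ρ) (har : ∀ i ∈ s, r < ‖a i‖)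
    (haρ : ∀ i ∈ s, ‖a i‖ ≠ ρ) {g : ℂ → ℂ}
    (hg : DifferentiableOn ℂ g {w | r < ‖w‖}) (hz : ∀ i ∈ s, g (a i) = 0)
    (hO : g =O[Bornology.cobounded ℂ] fun w => w ^ ((s.card : ℤ) - 2)) :
    (∮ w in C(0, ρ), g w / ∏ i ∈ s, (w - a i)) = 0 := by
  classical
  have hopen : IsOpen {w : ℂ | r < ‖w‖} := isOpen_lt continuous_const continuous_norm
  induction s using Finset.induction_on generalizing g with
  | empty => simpa using circleIntegral_eq_zero_of_isBigO hr hρ hg (by simpa using hO)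
  | insert i s hi ih =>
    have hia := har i (Finset.mem_insert_self i s)
    have hds : ∀ w, w ≠ a i → dslope g (a i) w = g w / (w - a i) := by
      intro w hw
      rw [dslope_of_ne _ hw, slope_def_field, hz i (Finset.mem_insert_self i s), sub_zero]
    have key : (∮ w in C(0, ρ), dslope g (a i) w / ∏ j ∈ s, (w - a j)) = 0 := by
      refine ih (ha.mono (by simp)) (fun j hj => har j (Finset.mem_insert_of_mem hj))
        (fun j hj => haρ j (Finset.mem_insert_of_mem hj))
        ((Complex.differentiableOn_dslope (E := ℂ) (hopen.mem_nhds hia)).2 hg) ?_ ?_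
      · intro j hj
        have hne : a j ≠ a i := fun h =>
          hi ((ha (Finset.mem_insert_of_mem hj) (Finset.mem_insert_self i s) h) ▸ hj)
        rw [hds _ hne, hz j (Finset.mem_insert_of_mem hj), zero_div]
      · have h1 : dslope g (a i) =ᶠ[Bornology.cobounded ℂ] fun w => g w * (w - a i)⁻¹ := by
          rw [EventuallyEq, Filter.HasBasis.eventually_iff (hasBasis_cobounded_norm (E := ℂ))]
          refine ⟨‖a i‖ + 1, trivial, fun w hw => ?_⟩
          rw [hds w ?_, div_eq_mul_inv]
          rintro rfl
          simp only [mem_ofPred_eq] at hw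
          linarith
        refine h1.trans_isBigO ((hO.mul (isBigO_inv_sub (a i))).congr' EventuallyEq.rfl ?_)
        rw [EventuallyEq, Filter.HasBasis.eventually_iff (hasBasis_cobounded_norm (E := ℂ))]
        refine ⟨1, trivial, fun w hw => ?_⟩
        have hw0 : w ≠ 0 := by
          rintro rfl
          simp only [mem_ofPred_eq, norm_zero] at hw
          linarith
        rw [← zpow_sub_one₀ hw0, Finset.card_insert_of_notMem hi]
        congr 1
        push_cast
        ring
    refine Eq.trans ?_ key
    refine circleIntegral.integral_congr (hr.trans hρ.le) fun w hw => ?_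
    have hw' : ‖w‖ = ρ := by simpa using hw
    have hne : w ≠ a i := by
      rintro rfl
      exact haρ i (Finset.mem_insert_self i s) hw'
    rw [hds w hne, Finset.prod_insert hi, div_div]

/-- The sum of the residues at finitely many simple poles. -/
theorem circleIntegral_div_prod_eq_sum {ι : Type*} [DecidableEq ι] (s : Finset ι) (a : ι → ℂ)
    (ha : Set.InjOn a s) {ρ : ℝ} (har : ∀ i ∈ s, ‖a i‖ < ρ) (hρ : 0 < ρ) {g : ℂ → ℂ}
    (hg : DifferentiableOn ℂ g (closedBall 0 ρ)) :
    (∮ w in C(0, ρ), g w / ∏ i ∈ s, (w - a i)) =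
      2 * Real.pi * I * ∑ i ∈ s, g (a i) / ∏ j ∈ s.erase i, (a i - a j) := by
  rcases s.eq_empty_or_nonempty with rfl | hs
  · simp only [Finset.prod_empty, div_one, Finset.sum_empty, mul_zero]
    exact (hg.mono closure_ball_subset_closedBall).diffContOnCl.circleIntegral_eq_zero hρ.le
  have hpf : ∀ w, (∀ i ∈ s, w ≠ a i) → g w / ∏ i ∈ s, (w - a i) =
      ∑ i ∈ s, (∏ j ∈ s.erase i, (a i - a j))⁻¹ * ((w - a i)⁻¹ * g w) := by
    intro w hw
    -- Interpolating the constant `1` at the nodes gives the partial fraction expansion of `1 / ∏ (w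
    -- - a i)`; Cauchy's formula then applies to each term.
    have h1 := Lagrange.eval_interpolate_not_at_node (s := s) (v := a) (fun _ => (1 : ℂ)) hw
    have h2 : Lagrange.interpolate s a (fun _ => (1 : ℂ)) = 1 := Lagrange.interpolate_one ha hs
    rw [h2, Polynomial.eval_one, Lagrange.eval_nodal] at h1
    have h3 : ∏ i ∈ s, (w - a i) ≠ 0 := Finset.prod_ne_zero_iff.2 fun i hi =>
      sub_ne_zero.2 (hw i hi)
    rw [div_eq_mul_inv, inv_eq_of_mul_eq_one_right h1.symm, Finset.mul_sum]
    refine Finset.sum_congr rfl fun i _ => ?_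
    rw [Lagrange.nodalWeight, Finset.prod_inv_distrib]
    ring
  rw [circleIntegral.integral_congr hρ.le (g := fun w => ∑ i ∈ s,
    (∏ j ∈ s.erase i, (a i - a j))⁻¹ * ((w - a i)⁻¹ * g w)), circleIntegral.integral_fun_sum,
    Finset.mul_sum]
  · refine Finset.sum_congr rfl fun i hi => ?_
    rw [circleIntegral.integral_const_mul]
    have := hg.circleIntegral_sub_inv_smul (w := a i) (by simpa using har i hi)
    simp only [smul_eq_mul] at this
    rw [this]
    ring
  · intro i hi
    refine ContinuousOn.circleIntegrable hρ.le ?_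
    refine continuousOn_const.mul (ContinuousOn.mul (ContinuousOn.inv₀ (by fun_prop) ?_)
      (hg.continuousOn.mono sphere_subset_closedBall))
    intro w hw h
    have hw' : ‖w‖ = ρ := by simpa using hw
    have := har i hi
    rw [← sub_eq_zero.1 h, hw'] at this
    exact lt_irrefl _ this
  · intro w hw
    refine hpf w fun i hi h => ?_
    have hw' : ‖w‖ = ρ := by simpa using hw
    have := har i hi
    rw [← h, hw'] at this
    exact lt_irrefl _ this

/-- A simple pole inside an annulus. -/
theorem circleIntegral_annulus_pole {r ρ : ℝ} (hr : 0 < r) {p : ℂ}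
    (hp1 : r < ‖p‖) (hp2 : ‖p‖ < ρ) {U : Set ℂ} (hU : IsOpen U)
    (hsub : ∀ w : ℂ, r ≤ ‖w‖ → ‖w‖ ≤ ρ → w ∈ U) {g : ℂ → ℂ} (hg : DifferentiableOn ℂ g U) :
    (∮ w in C(0, ρ), g w / (w - p)) = (∮ w in C(0, r), g w / (w - p)) + 2 * Real.pi * I * g p := by
  have hrρ : r < ρ := hp1.trans hp2
  have hpU : p ∈ U := hsub p hp1.le hp2.le
  -- On a circle avoiding `p`, `g w / (w - p)` equals `dslope g p w + g p / (w - p)`. The first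
  -- summand has equal integrals over both circles; the second contributes `2πi g(p)` on the outer
  -- circle and `0` on the inner one.
  have hd : DifferentiableOn ℂ (dslope g p) U :=
    (Complex.differentiableOn_dslope (hU.mem_nhds hpU)).2 hg
  have hann := Complex.circleIntegral_eq_of_differentiable_on_annulus_off_countable
    (c := 0) hr hrρ.le (f := dslope g p) countable_empty
    (hd.continuousOn.mono fun z hz => hsub z (by simpa using hz.2) (by simpa using hz.1))
    (fun z hz => hd.differentiableAt (hU.mem_nhds (hsub z
      (le_of_lt (by simpa using hz.1.2)) (le_of_lt (by simpa using hz.1.1)))))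
  have hsplit : ∀ T, 0 < T → T ≠ ‖p‖ → r ≤ T → T ≤ ρ → (∮ w in C(0, T), g w / (w - p)) =
      (∮ w in C(0, T), dslope g p w) + g p * ∮ w in C(0, T), (w - p)⁻¹ := by
    intro T hT hTp h1 h2
    have hne : ∀ w ∈ sphere (0 : ℂ) T, w - p ≠ 0 := by
      intro w hw h
      have hw' : ‖w‖ = T := by simpa using hw
      exact hTp (by rw [← hw', sub_eq_zero.1 h])
    rw [← circleIntegral.integral_const_mul, ← circleIntegral.integral_add]
    · refine circleIntegral.integral_congr hT.le fun w hw => ?_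
      have := hne w hw
      rw [dslope_of_ne _ (sub_ne_zero.1 this), slope_def_field]
      field_simp
      ring
    · refine ContinuousOn.circleIntegrable hT.le (hd.continuousOn.mono fun w hw => ?_)
      have hw' : ‖w‖ = T := by simpa using hw
      exact hsub w (by rw [hw']; exact h1) (by rw [hw']; exact h2)
    · exact ContinuousOn.circleIntegrable hT.le
        (continuousOn_const.mul (ContinuousOn.inv₀ (by fun_prop) hne))
  rw [hsplit ρ (hr.trans hrρ) hp2.ne' hrρ.le le_rfl, hsplit r hr hp1.ne le_rfl hrρ.le, hann]
  have e1 : (∮ w in C(0, ρ), (w - p)⁻¹) = 2 * Real.pi * I :=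
    circleIntegral.integral_sub_inv_of_mem_ball (by simpa using hp2)
  have e2 : (∮ w in C(0, r), (w - p)⁻¹) = 0 := by
    refine DiffContOnCl.circleIntegral_eq_zero hr.le ?_
    refine DifferentiableOn.diffContOnCl ?_
    intro w hw
    have hw' := closure_ball_subset_closedBall hw
    simp only [mem_closedBall, dist_zero_right] at hw'
    refine DifferentiableAt.differentiableWithinAt ?_
    refine DifferentiableAt.inv (by fun_prop) ?_
    intro h
    rw [sub_eq_zero.1 h] at hw'
    linarith
  rw [e1, e2]
  ring

/-- The radii are changed one coordinate at a time, each time by Cauchy's theorem in an annulus with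
the other variables frozen. -/
theorem torusIntegral_radii {m : ℕ} {ρ ρ' : Fin m → ℝ} (hρ : ∀ i, 0 < ρ i) (hle : ∀ i, ρ i ≤ ρ' i)
    {U : Set (Fin m → ℂ)} (hU : IsOpen U)
    (hsub : ∀ z : Fin m → ℂ, (∀ i, ρ i ≤ ‖z i‖ ∧ ‖z i‖ ≤ ρ' i) → z ∈ U)
    {f : (Fin m → ℂ) → ℂ} (hf : DifferentiableOn ℂ f U) :
    torusIntegral f 0 ρ = torusIntegral f 0 ρ' := by
  classical
  have key : ∀ s : Finset (Fin m), torusIntegral f 0 ρ = torusIntegral f 0 (s.piecewise ρ' ρ) := by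
    intro s
    induction s using Finset.induction_on with
    | empty => simp
    | insert i s hi ih =>
      rw [ih]
      obtain ⟨n, rfl⟩ : ∃ n, m = n + 1 := ⟨m - 1, by have := i.pos; omega⟩
      have hpw : ∀ t : Finset (Fin (n + 1)), ∀ k, ρ k ≤ t.piecewise ρ' ρ k ∧
          t.piecewise ρ' ρ k ≤ ρ' k := by
        intro t k
        by_cases h : k ∈ t <;> simp [h, hle k]
      have hcont : ∀ t : Finset (Fin (n + 1)),
          Continuous fun θ => f (torusMap 0 (t.piecewise ρ' ρ) θ) := by
        intro t
        refine hf.continuousOn.comp_continuous (continuous_torusMap _) fun θ => hsub _ fun k => ?_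
        rw [torusMap_mem (fun k => (hρ k).trans_le (hpw t k).1)]
        exact hpw t k
      rw [torusIntegral_succAbove' (torusIntegrable_of_continuous (hcont s)) i,
        torusIntegral_succAbove' (torusIntegrable_of_continuous (hcont (insert i s))) i]
      have e1 : (insert i s).piecewise ρ' ρ ∘ i.succAbove = s.piecewise ρ' ρ ∘ i.succAbove := by
        funext k
        simp [Finset.piecewise, Fin.succAbove_ne]
      have e2 : (insert i s).piecewise ρ' ρ i = ρ' i := by simp
      have e3 : s.piecewise ρ' ρ i = ρ i := by simp [hi]
      rw [e1, e2, e3]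
      refine torusIntegral_congr (fun k => (hρ _).trans_le (hpw s _).1) fun y hy => ?_
      have hmem : ∀ w : ℂ, ρ i ≤ ‖w‖ → ‖w‖ ≤ ρ' i →
          (i.insertNth w y : Fin (n + 1) → ℂ) ∈ U := by
        intro w h1 h2
        refine hsub _ fun k => ?_
        refine Fin.succAboveCases i ?_ (fun k => ?_) k
        · simpa using ⟨h1, h2⟩
        · simp only [Fin.insertNth_apply_succAbove]
          rw [hy k]
          exact hpw s _
      have hins : Differentiable ℂ fun w : ℂ => (i.insertNth w y : Fin (n + 1) → ℂ) := by
        rw [differentiable_pi]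
        intro k
        refine Fin.succAboveCases i ?_ (fun k => ?_) k
        · simp
        · simp
      refine (Complex.circleIntegral_eq_of_differentiable_on_annulus_off_countable (c := 0)
        (hρ i) (hle i) countable_empty ?_ ?_).symm
      · refine hf.continuousOn.comp hins.continuous.continuousOn fun w hw => ?_
        exact hmem w (by simpa using hw.2) (by simpa using hw.1)
      · intro w hw
        refine DifferentiableAt.comp (g := f) w (hf.differentiableAt (hU.mem_nhds (hmem w ?_ ?_)))
          (hins w)
        · exact le_of_lt (by simpa using hw.1.2)
        · exact le_of_lt (by simpa using hw.1.1)
  simpa using key Finset.univ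

theorem norm_sub_gt {c y : ℂ} {r0 : ℝ} (hy : r0 < ‖y‖) : r0 - ‖c‖ < ‖y - c‖ := by
  have := norm_sub_norm_le y c
  linarith

theorem isBigO_id_add (a b : ℂ) :
    (fun w : ℂ => a * w + b) =O[Bornology.cobounded ℂ] fun w => w := by
  refine IsBigO.add ((isBigO_refl _ _).const_mul_left a) ?_
  refine IsBigO.of_bound ‖b‖ ?_
  rw [Filter.HasBasis.eventually_iff (hasBasis_cobounded_norm (E := ℂ))]
  refine ⟨1, trivial, fun w hw => ?_⟩
  simp only [mem_ofPred_eq] at hw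
  exact le_mul_of_one_le_right (norm_nonneg _) hw

theorem eventually_ne_zero_cobounded : ∀ᶠ w in Bornology.cobounded ℂ, w ≠ 0 := by
  rw [Filter.HasBasis.eventually_iff (hasBasis_cobounded_norm (E := ℂ))]
  refine ⟨1, trivial, fun w hw => ?_⟩
  rintro rfl
  simp only [mem_ofPred_eq, norm_zero] at hw
  linarith

section
variable {E : Type*} [NormedAddCommGroup E] [NormedSpace ℂ E] {s : Set E}

theorem differentiableOn_prod {ι : Type*} {u : Finset ι} {f : ι → E → ℂ}
    (h : ∀ i ∈ u, DifferentiableOn ℂ (f i) s) :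
    DifferentiableOn ℂ (fun e => ∏ i ∈ u, f i e) s := by
  classical
  induction u using Finset.induction_on with
  | empty => simp
  | insert i u hi ih =>
    simp_rw [Finset.prod_insert hi]
    exact (h i (Finset.mem_insert_self i u)).fun_mul
      (ih fun j hj => h j (Finset.mem_insert_of_mem hj))

theorem differentiableOn_div {f g : E → ℂ} (hf : DifferentiableOn ℂ f s)
    (hg : DifferentiableOn ℂ g s) (h : ∀ e ∈ s, g e ≠ 0) :
    DifferentiableOn ℂ (fun e => f e / g e) s := by
  simp_rw [div_eq_mul_inv]
  exact hf.fun_mul (hg.fun_inv h)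

theorem differentiableOn_zpow {f : E → ℂ} (hf : DifferentiableOn ℂ f s) {a : ℤ}
    (h : (∀ e ∈ s, f e ≠ 0) ∨ 0 ≤ a) : DifferentiableOn ℂ (fun e => f e ^ a) s := by
  intro e he
  exact (differentiableAt_zpow.2 (h.imp_left fun h => h e he)).comp_differentiableWithinAt
    (f := f) (g := fun z : ℂ => z ^ a) e (hf e he)

end

theorem differentiable_cons {m : ℕ} {E : Type*} [NormedAddCommGroup E] [NormedSpace ℂ E]
    {f : E → ℂ} {g : E → Fin m → ℂ} {s : Set E} (hf : DifferentiableOn ℂ f s)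
    (hg : DifferentiableOn ℂ g s) :
    DifferentiableOn ℂ (fun e => (Fin.cons (f e) (g e) : Fin (m + 1) → ℂ)) s := by
  rw [differentiableOn_pi] at hg ⊢
  intro k
  refine Fin.cases ?_ (fun k => ?_) k
  · simpa using hf
  · simpa using hg k

theorem insertNth_eq_update {m : ℕ} (k : Fin (m + 1)) (a w : ℂ) (y : Fin m → ℂ) :
    (k.insertNth w y : Fin (m + 1) → ℂ) =
      Function.update (k.insertNth a y : Fin (m + 1) → ℂ) k w := by
  funext j
  refine Fin.succAboveCases k ?_ (fun j => ?_) j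
  · simp
  · simp [Fin.succAbove_ne]

theorem differentiable_insertNth {m : ℕ} (k : Fin (m + 1)) (y : Fin m → ℂ) :
    Differentiable ℂ fun w : ℂ => (k.insertNth w y : Fin (m + 1) → ℂ) := by
  rw [differentiable_pi]
  intro j
  refine Fin.succAboveCases k ?_ (fun j => ?_) j
  · simp
  · simp

/-! ### Vanishing of torus integrals with scattering denominators -/

section
variable {m : ℕ} {c : ℂ} {r0 r ρ0 ρ1 : ℝ}

/-- The contribution of one pole of `z_0`. The zeros of `H` at `y k = y l` cancel all `m - 1`
differences in the denominator, so the integrand is holomorphic in `y k` outside a disc, and growth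
of order `m - 3` leaves quadratic decay. The radii `r + k` are distinct, so that no difference
vanishes on the torus. -/
theorem torusIntegral_residue_eq_zero (hc : ‖c‖ < r0) (hr : r0 < r)
    (k : Fin m) {H : (Fin m → ℂ) → ℂ} (hH : DifferentiableOn ℂ H {y | ∀ k, r0 < ‖y k‖})
    (hvan : ∀ y : Fin m → ℂ, (∀ k, r0 < ‖y k‖) → ∀ l, l ≠ k → y k = y l → H y = 0)
    (hgr : ∀ y : Fin m → ℂ, (∀ k, r0 < ‖y k‖) →
      (fun w => H (Function.update y k w)) =O[Bornology.cobounded ℂ] fun w => w ^ ((m : ℤ) - 3)) :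
    (Continuous fun θ => H (torusMap 0 (fun k : Fin m => r + k) θ) /
      ∏ j ∈ Finset.univ.erase k, (torusMap 0 (fun k : Fin m => r + k) θ k
        - torusMap 0 (fun k : Fin m => r + k) θ j)) ∧
    torusIntegral (fun y => H y / ∏ j ∈ Finset.univ.erase k, (y k - y j)) 0
      (fun k : Fin m => r + k) = 0 := by
  have hr0 : 0 < r0 := (norm_nonneg c).trans_lt hc
  have hrad : ∀ k : Fin m, r0 < r + (k : ℕ) := fun k => by
    have : (0 : ℝ) ≤ (k : ℕ) := by positivity
    linarith
  have hpos : ∀ k : Fin m, 0 < r + (k : ℕ) := fun k => hr0.trans (hrad k)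
  have hcont : Continuous fun θ => H (torusMap 0 (fun k : Fin m => r + k) θ) /
      ∏ j ∈ Finset.univ.erase k, (torusMap 0 (fun k : Fin m => r + k) θ k
        - torusMap 0 (fun k : Fin m => r + k) θ j) := by
    refine Continuous.div ?_ ?_ ?_
    · refine hH.continuousOn.comp_continuous (continuous_torusMap _) fun θ k => ?_
      rw [torusMap_mem hpos]
      exact hrad k
    · have := continuous_torusMap (fun k : Fin m => r + k)
      fun_prop
    · intro θ
      refine Finset.prod_ne_zero_iff.2 fun j hj h => ?_
      have h1 := congrArg norm (sub_eq_zero.1 h)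
      rw [torusMap_mem hpos, torusMap_mem hpos] at h1
      have h2 : ((k : ℕ) : ℝ) = (j : ℕ) := by linarith
      exact (Finset.ne_of_mem_erase hj) (Fin.ext (by exact_mod_cast h2.symm))
  refine ⟨hcont, ?_⟩
  obtain ⟨n, rfl⟩ : ∃ n, m = n + 1 := ⟨m - 1, by have := k.pos; omega⟩
  rw [torusIntegral_succAbove' (torusIntegrable_of_continuous hcont) k]
  refine torusIntegral_eq_zero (fun i => hpos _) fun y hy => ?_
  simp only [Fin.insertNth_apply_same] at hy ⊢
  have hmem : ∀ w : ℂ, r0 < ‖w‖ → ∀ j, r0 < ‖(k.insertNth w y : Fin (n + 1) → ℂ) j‖ := by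
    intro w hw j
    refine Fin.succAboveCases k ?_ (fun j => ?_) j
    · simpa using hw
    · simp only [Fin.insertNth_apply_succAbove, hy]
      exact hrad _
  have e : ∀ w : ℂ, ∏ j ∈ Finset.univ.erase k, (w - (k.insertNth w y : Fin (n + 1) → ℂ) j) =
      ∏ j : Fin n, (w - y j) := by
    intro w
    have : (Finset.univ.erase k : Finset (Fin (n + 1))) = Finset.univ.map k.succAboveEmb := by
      ext j
      simp only [Finset.mem_erase, Finset.mem_univ, and_true, Finset.mem_map, true_and,
        Fin.coe_succAboveEmb]
      exact Fin.exists_succAbove_eq_iff.symm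
    rw [this, Finset.prod_map]
    simp
  simp_rw [e]
  refine circleIntegral_div_prod_eq_zero Finset.univ y ?_ hr0.le (hrad k) ?_ ?_
    (g := fun w => H (k.insertNth w y)) ?_ ?_ ?_
  · intro i _ j _ hij
    have h1 := congrArg norm hij
    rw [hy, hy] at h1
    have h2 : ((k.succAbove i : ℕ) : ℝ) = (k.succAbove j : ℕ) := by linarith
    exact Fin.succAbove_right_injective (Fin.ext (by exact_mod_cast h2))
  · intro i _
    rw [hy]
    exact hrad _
  · intro i _ h
    rw [hy] at h
    have h2 : ((k.succAbove i : ℕ) : ℝ) = (k : ℕ) := by linarith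
    exact Fin.succAbove_ne k i (Fin.ext (by exact_mod_cast h2))
  · exact hH.comp (differentiable_insertNth k y).differentiableOn fun w hw => hmem w hw
  · intro i _
    refine hvan _ (hmem _ ?_) (k.succAbove i) (Fin.succAbove_ne k i) (by simp)
    rw [hy]
    exact hrad _
  · have h1 := hgr (k.insertNth (r : ℂ) y) (hmem _ (by
      simpa [abs_of_pos (hr0.trans hr)] using hr))
    simp_rw [← insertNth_eq_update] at h1
    convert h1 using 3
    simp
    ring

/-- The vanishing of a contour integral whose only poles in `z_0` are those of the factors
`1 + z_0 z_k - c z_0`. -/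
theorem torusIntegral_scattering_eq_zero (hc : ‖c‖ < r0) (hr : r0 < r) (hρ0 : (r0 - ‖c‖)⁻¹ < ρ0)
    (hρ1 : ρ0 < ρ1) {Φ : (Fin (m + 1) → ℂ) → ℂ}
    (hΦ : DifferentiableOn ℂ Φ {z | ‖z 0‖ < ρ1 ∧ ∀ k : Fin m, r0 < ‖z k.succ‖})
    (hvan : ∀ y : Fin m → ℂ, (∀ k, r0 < ‖y k‖) → ∀ k l, l ≠ k → y k = y l →
      Φ (Fin.cons (c - y k)⁻¹ y) = 0)
    (hgr : ∀ y : Fin m → ℂ, (∀ k, r0 < ‖y k‖) → ∀ k,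
      (fun w => Φ (Fin.cons (c - w)⁻¹ (Function.update y k w))) =O[Bornology.cobounded ℂ]
        fun w => w⁻¹) :
    torusIntegral (fun z => Φ z / ∏ k : Fin m, (1 + z 0 * z k.succ - c * z 0)) 0
      (Fin.cons ρ0 fun _ => r : Fin (m + 1) → ℝ) = 0 := by
  have hr0 : 0 < r0 := (norm_nonneg c).trans_lt hc
  have hd : 0 < r0 - ‖c‖ := by linarith
  have hρ0pos : 0 < ρ0 := (inv_pos.2 hd).trans hρ0
  have hrad : ∀ k : Fin m, r0 < r + (k : ℕ) := fun k => by
    have : (0 : ℝ) ≤ (k : ℕ) := by positivity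
    linarith
  have hpos : ∀ k : Fin m, 0 < r + (k : ℕ) := fun k => hr0.trans (hrad k)
  set U : Set (Fin (m + 1) → ℂ) :=
    {z | (r0 - ‖c‖)⁻¹ < ‖z 0‖ ∧ ‖z 0‖ < ρ1 ∧ ∀ k : Fin m, r0 < ‖z k.succ‖} with hUdef
  have hU : IsOpen U := by
    have e : U = {z | (r0 - ‖c‖)⁻¹ < ‖z 0‖} ∩ ({z | ‖z 0‖ < ρ1} ∩
        ⋂ k : Fin m, {z | r0 < ‖z k.succ‖}) := by
      ext z
      simp [hUdef]
    rw [e]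
    exact (isOpen_lt continuous_const (by fun_prop)).inter
      ((isOpen_lt (by fun_prop) continuous_const).inter
        (isOpen_iInter_of_finite fun k => isOpen_lt continuous_const (by fun_prop)))
  -- A zero of the factor has `z 0 = 1 / (c - z k)`, of modulus below `1 / (r0 - ‖c‖)`: every such
  -- pole lies inside the circle of radius `ρ0`.
  have hden : ∀ z ∈ U, ∀ k : Fin m, 1 + z 0 * z k.succ - c * z 0 ≠ 0 := by
    intro z hz k h
    have h1 : z 0 * (z k.succ - c) = -1 := by linear_combination h
    have h2 := congrArg norm h1
    rw [norm_mul, norm_neg, norm_one] at h2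
    have h3 := norm_sub_gt (c := c) (hz.2.2 k)
    have h4 : 1 < ‖z 0‖ * ‖z k.succ - c‖ := by
      calc (1 : ℝ) = (r0 - ‖c‖)⁻¹ * (r0 - ‖c‖) := by field_simp
        _ < _ := by
          apply mul_lt_mul'' hz.1 h3 (inv_pos.2 hd).le hd.le
    linarith
  have hf : DifferentiableOn ℂ
      (fun z => Φ z / ∏ k : Fin m, (1 + z 0 * z k.succ - c * z 0)) U := by
    refine differentiableOn_div (hΦ.mono fun z hz => hz.2)
      (Differentiable.differentiableOn (by fun_prop)) ?_
    exact fun z hz => Finset.prod_ne_zero_iff.2 fun k _ => hden z hz k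
  have hρcons : ∀ (z : Fin (m + 1) → ℂ), ‖z 0‖ = ρ0 → (∀ k : Fin m, r0 < ‖z k.succ‖) → z ∈ U :=
    fun z h1 h2 => ⟨by rw [h1]; exact hρ0, by rw [h1]; exact hρ1, h2⟩
  -- Distinct radii for the remaining variables make the points `1 / (c - y k)` distinct, so that
  -- all poles in `z 0` are simple.
  rw [torusIntegral_radii (ρ' := Fin.cons ρ0 fun k : Fin m => r + (k : ℕ)) _ _ hU _ hf]
  rotate_left
  · exact Fin.cases (by simpa using hρ0pos) fun k => by simpa using hr0.trans hr
  · exact Fin.cases (by simp) fun k => by simp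
  · intro z hz
    refine hρcons z ?_ fun k => ?_
    · have := hz 0
      simp only [Fin.cons_zero] at this
      exact le_antisymm this.2 this.1
    · have := (hz k.succ).1
      simp only [Fin.cons_succ] at this
      exact hr.trans_le this
  have hcontf : Continuous fun θ => (fun z => Φ z / ∏ k : Fin m, (1 + z 0 * z k.succ - c * z 0))
      (torusMap 0 (Fin.cons ρ0 fun k : Fin m => r + (k : ℕ) : Fin (m + 1) → ℝ) θ) := by
    have hp : ∀ i, 0 < (Fin.cons ρ0 fun k : Fin m => r + (k : ℕ) : Fin (m + 1) → ℝ) i :=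
      Fin.cases (by simpa using hρ0pos) fun k => by simpa using hpos k
    refine hf.continuousOn.comp_continuous (continuous_torusMap _) fun θ => ?_
    refine hρcons _ ?_ fun k => ?_
    · rw [torusMap_mem hp]; simp
    · rw [torusMap_mem hp]; simpa using hrad k
  rw [torusIntegral_cons hcontf]
  -- The residue at `1 / (c - y k)` after clearing denominators by means of `1/(c - y k) - 1/(c - y
  -- j) = (y k - y j) / ((c - y k)(c - y j))`.
  set H : Fin m → (Fin m → ℂ) → ℂ := fun k y => Φ (Fin.cons (c - y k)⁻¹ y) / (∏ j, (y j - c)) *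
    ∏ j ∈ Finset.univ.erase k, ((c - y k) * (c - y j)) with hHdef
  have hinner : ∀ y : Fin m → ℂ, (∀ i, ‖y i‖ = r + (i : ℕ)) →
      (∮ x in C(0, ρ0), Φ (Fin.cons x y) / ∏ k : Fin m,
        (1 + (Fin.cons x y : Fin (m + 1) → ℂ) 0 * (Fin.cons x y : Fin (m + 1) → ℂ) k.succ
          - c * (Fin.cons x y : Fin (m + 1) → ℂ) 0)) =
      2 * Real.pi * I * ∑ k : Fin m, H k y / ∏ j ∈ Finset.univ.erase k, (y k - y j) := by
    intro y hy
    have hy0 : ∀ k, r0 < ‖y k‖ := fun k => by rw [hy]; exact hrad k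
    have hyc : ∀ k, y k - c ≠ 0 := fun k h => by
      have := norm_sub_gt (c := c) (hy0 k)
      rw [h, norm_zero] at this
      linarith
    have hcy : ∀ k, c - y k ≠ 0 := fun k h => hyc k (by rw [← neg_sub, h, neg_zero])
    have hyinj : Function.Injective y := by
      intro i j hij
      have h1 := congrArg norm hij
      rw [hy, hy] at h1
      have h2 : ((i : ℕ) : ℝ) = (j : ℕ) := by linarith
      exact Fin.ext (by exact_mod_cast h2)
    have h1 : ∀ x : ℂ, Φ (Fin.cons x y) / ∏ k : Fin m,
        (1 + (Fin.cons x y : Fin (m + 1) → ℂ) 0 * (Fin.cons x y : Fin (m + 1) → ℂ) k.succ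
          - c * (Fin.cons x y : Fin (m + 1) → ℂ) 0) =
        (Φ (Fin.cons x y) / ∏ k, (y k - c)) / ∏ k, (x - (c - y k)⁻¹) := by
      intro x
      rw [div_div, ← Finset.prod_mul_distrib]
      congr 1
      refine Finset.prod_congr rfl fun k _ => ?_
      have := hcy k
      simp only [Fin.cons_zero, Fin.cons_succ]
      field_simp
      ring
    simp_rw [h1]
    rw [circleIntegral_div_prod_eq_sum Finset.univ (fun k => (c - y k)⁻¹) ?_ ?_ hρ0pos
      (g := fun x => Φ (Fin.cons x y) / ∏ k, (y k - c))]
    · congr 1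
      refine Finset.sum_congr rfl fun k _ => ?_
      have h2 : ∏ j ∈ Finset.univ.erase k, ((c - y k)⁻¹ - (c - y j)⁻¹) =
          (∏ j ∈ Finset.univ.erase k, (y k - y j)) /
            ∏ j ∈ Finset.univ.erase k, ((c - y k) * (c - y j)) := by
        rw [← Finset.prod_div_distrib]
        refine Finset.prod_congr rfl fun j _ => ?_
        have := hcy k
        have := hcy j
        field_simp
        ring
      rw [h2, hHdef]
      simp only
      rw [div_div_eq_mul_div]
    · refine DifferentiableOn.div_const ?_ _
      refine hΦ.comp (differentiable_cons differentiableOn_id (differentiableOn_const _))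
        fun x hx => ?_
      refine ⟨?_, fun k => by simpa using hy0 k⟩
      have : ‖x‖ ≤ ρ0 := by simpa using hx
      simpa using this.trans_lt hρ1
    · intro i _ j _ hij
      exact hyinj (by simpa using hij)
    · intro k _
      rw [norm_inv, norm_sub_rev]
      refine lt_of_le_of_lt ?_ hρ0
      exact inv_anti₀ hd (norm_sub_gt (hy0 k)).le
  rw [torusIntegral_congr hpos hinner, torusIntegral_const_mul]
  have hres : ∀ k : Fin m, _ := fun k => torusIntegral_residue_eq_zero (m := m) hc hr k (H := H k)
    ?_ ?_ ?_
  · rw [torusIntegral_finsetSum Finset.univ fun k _ => (hres k).1,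
      Finset.sum_eq_zero fun k _ => (hres k).2, mul_zero]
  · have hyc : ∀ y ∈ {y : Fin m → ℂ | ∀ k, r0 < ‖y k‖}, ∀ k, y k - c ≠ 0 := fun y hy k h => by
      have := norm_sub_gt (c := c) (hy k)
      rw [h, norm_zero] at this
      linarith
    refine DifferentiableOn.fun_mul (differentiableOn_div ?_
      (Differentiable.differentiableOn (by fun_prop)) ?_)
      (Differentiable.differentiableOn (by fun_prop))
    · refine hΦ.comp (differentiable_cons (DifferentiableOn.fun_inv (by fun_prop) ?_)
        differentiableOn_id) fun y hy => ?_
      · exact fun y hy h => hyc y hy k (by rw [← neg_sub, h, neg_zero])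
      · refine ⟨?_, fun j => by simpa using hy j⟩
        simp only [Fin.cons_zero]
        rw [norm_inv, norm_sub_rev]
        exact (inv_anti₀ hd (norm_sub_gt (hy k)).le).trans_lt (hρ0.trans hρ1)
    · exact fun y hy => Finset.prod_ne_zero_iff.2 fun j _ => hyc y hy j
  · intro y hy l hl h
    simp only [hHdef]
    rw [hvan y hy k l hl h, zero_div, zero_mul]
  · intro y hy
    have hm : (Finset.univ.erase k).card + 1 = m := by
      rw [Finset.card_erase_add_one (Finset.mem_univ k), Finset.card_univ, Fintype.card_fin]
    have e : ∀ w, H k (Function.update y k w) =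
        Φ (Fin.cons (c - w)⁻¹ (Function.update y k w)) * (w - c)⁻¹ *
        (∏ j ∈ Finset.univ.erase k, (y j - c))⁻¹ *
        ∏ j ∈ Finset.univ.erase k, ((c - w) * (c - y j)) := by
      intro w
      have e1 : ∏ j, (Function.update y k w j - c) =
          (w - c) * ∏ j ∈ Finset.univ.erase k, (y j - c) := by
        rw [← Finset.mul_prod_erase _ _ (Finset.mem_univ k), Function.update_self]
        congr 1
        refine Finset.prod_congr rfl fun j hj => ?_
        rw [Function.update_of_ne (Finset.ne_of_mem_erase hj)]
      have e2 : ∏ j ∈ Finset.univ.erase k, ((c - Function.update y k w k) *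
          (c - Function.update y k w j)) =
          ∏ j ∈ Finset.univ.erase k, ((c - w) * (c - y j)) := by
        refine Finset.prod_congr rfl fun j hj => ?_
        rw [Function.update_of_ne (Finset.ne_of_mem_erase hj), Function.update_self]
      simp only [hHdef]
      rw [e1, e2, Function.update_self, div_eq_mul_inv, mul_inv]
      ring
    simp_rw [e]
    have hprod : (fun w : ℂ => ∏ j ∈ Finset.univ.erase k, ((c - w) * (c - y j)))
        =O[Bornology.cobounded ℂ] fun w => w ^ (Finset.univ.erase k).card := by
      simp_rw [← Finset.prod_const]
      refine IsBigO.finsetProd fun j _ => ?_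
      refine (isBigO_id_add (-(c - y j)) (c * (c - y j))).congr_left fun w => ?_
      ring
    have hall := (((hgr y hy k).mul (isBigO_inv_sub c)).mul
      (isBigO_refl (fun _ : ℂ => (∏ j ∈ Finset.univ.erase k, (y j - c))⁻¹) _)).mul hprod
    refine hall.trans ?_
    refine IsBigO.of_bound ‖(∏ j ∈ Finset.univ.erase k, (y j - c))⁻¹‖ ?_
    filter_upwards [eventually_ne_zero_cobounded] with w hw
    -- One power of `w⁻¹` comes from `Φ`, one from the factor `w - c`, and `m - 1` positive powers
    -- come from the cleared denominators.
    have e3 : w ^ ((m : ℤ) - 3) = w⁻¹ * w⁻¹ * w ^ (Finset.univ.erase k).card := by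
      rw [show (m : ℤ) - 3 = -1 + -1 + ((Finset.univ.erase k).card : ℤ) by omega, zpow_add₀ hw, zpow_add₀ hw,
        zpow_neg_one, zpow_natCast]
    rw [e3]
    simp only [norm_mul]
    exact le_of_eq (by ring)

end

/-! ### The action of the Hamiltonian on functions of the configuration -/

section
variable {N : ℕ} (Δ : ℝ)

/-- The column of the matrix of `H` with index `X`. -/
def hamColumn (X : Config N) : Config N →₀ ℂ :=
  Finsupp.comapDomain sites (∑ j ∈ bonds (sites X), localH Δ j (Finsupp.single (sites X) 1))
    sites_injective.injOn

theorem hamColumn_apply (X X' : Config N) :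
    hamColumn Δ X X' = hamEntry Δ (sites X') (sites X) := by
  simp [hamColumn, hamEntry_eq_sum, Finsupp.finsetSum_apply]

/-- The action of `H` on arbitrary functions on the configurations. -/
def hamAct (φ : Config N → ℂ) (X : Config N) : ℂ :=
  Finsupp.linearCombination ℂ φ (hamColumn Δ X)

/-- `hamAct` sums over the finite support of a column, so it makes sense for functions outside `ℓ²`;
by the symmetry of the matrix the column is also the row. -/
theorem hamAct_eq_tsum (φ : Config N → ℂ) (X : Config N) :
    hamAct Δ φ X = ∑' X' : Config N, hamEntry Δ (sites X) (sites X') * φ X' := by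
  rw [hamAct, Finsupp.linearCombination_apply, Finsupp.sum, tsum_eq_sum]
  · refine Finset.sum_congr rfl fun X' _ => ?_
    rw [hamColumn_apply, hamEntry_symm, smul_eq_mul]
  · intro X' hX'
    rw [hamEntry_symm, ← hamColumn_apply, Finsupp.notMem_support_iff.1 hX', zero_mul]

theorem hamAct_eq_sum_bonds (φ : Config N → ℂ) (X : Config N) :
    hamAct Δ φ X = ∑ j ∈ bonds (sites X), Finsupp.linearCombination ℂ φ
      (Finsupp.comapDomain sites (localH Δ j (Finsupp.single (sites X) 1))
        sites_injective.injOn) := by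
  rw [hamAct, hamColumn, ← map_sum]
  congr 1
  ext X'
  simp [Finsupp.finsetSum_apply]

theorem strictMono_update_succ {X : Fin N → ℤ} (hX : StrictMono X) {i : Fin N}
    (h : ∀ k, X k ≠ X i + 1) : StrictMono (Function.update X i (X i + 1)) := by
  intro a b hab
  have h1 := hX hab
  by_cases ha : a = i
  · subst ha
    have := h b
    rw [Function.update_self, Function.update_of_ne hab.ne']
    omega
  · by_cases hb : b = i
    · subst hb
      rw [Function.update_self, Function.update_of_ne ha]
      omega
    · rwa [Function.update_of_ne ha, Function.update_of_ne hb]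

theorem strictMono_update_pred {X : Fin N → ℤ} (hX : StrictMono X) {i : Fin N}
    (h : ∀ k, X k ≠ X i - 1) : StrictMono (Function.update X i (X i - 1)) := by
  intro a b hab
  have h1 := hX hab
  by_cases ha : a = i
  · subst ha
    rw [Function.update_self, Function.update_of_ne hab.ne']
    omega
  · by_cases hb : b = i
    · subst hb
      have := h a
      rw [Function.update_self, Function.update_of_ne ha]
      omega
    · rwa [Function.update_of_ne ha, Function.update_of_ne hb]

theorem mem_sites {X : Config N} {a : ℤ} : a ∈ sites X ↔ ∃ k, X.1 k = a := by
  simp [sites]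

theorem sites_update {X X' : Config N} {i : Fin N} {v : ℤ} (hv : v ∉ sites X)
    (hX' : X'.1 = Function.update X.1 i v) : sites X' = symmDiff (sites X) {X.1 i, v} := by
  ext a
  have hmem : a ∈ sites X' ↔ a = v ∨ (a ≠ X.1 i ∧ a ∈ sites X) := by
    simp only [mem_sites, hX']
    constructor
    · rintro ⟨k, rfl⟩
      by_cases hk : k = i
      · subst hk
        simp
      · rw [Function.update_of_ne hk]
        exact Or.inr ⟨fun h => hk (X.2.injective h), k, rfl⟩
    · rintro (rfl | ⟨h, k, rfl⟩)
      · exact ⟨i, by simp⟩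
      · exact ⟨k, Function.update_of_ne (fun hk => h (by rw [hk])) _ _⟩
  have hXi : X.1 i ∈ sites X := mem_sites.2 ⟨i, rfl⟩
  have hne : X.1 i ≠ v := fun h => hv (h ▸ hXi)
  rw [hmem, Finset.mem_symmDiff, Finset.mem_insert, Finset.mem_singleton]
  by_cases h1 : a = v
  · subst h1
    simp [hv]
  · by_cases h2 : a = X.1 i
    · subst h2
      simp [h1, hXi]
    · simp [h1, h2]

theorem linearCombination_bond (φ : Config N → ℂ) (X X' : Config N) :
    Finsupp.linearCombination ℂ φ (Finsupp.comapDomain sites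
      (Finsupp.single (sites X') (1 : ℂ) - (Δ : ℂ) • Finsupp.single (sites X) (1 : ℂ))
        sites_injective.injOn) = φ X' - Δ * φ X := by
  have : Finsupp.comapDomain sites
      (Finsupp.single (sites X') (1 : ℂ) - (Δ : ℂ) • Finsupp.single (sites X) (1 : ℂ))
        sites_injective.injOn = Finsupp.single X' (1 : ℂ) - (Δ : ℂ) • Finsupp.single X (1 : ℂ) := by
    ext Z
    simp [Finsupp.single_apply, sites_injective.eq_iff]
  rw [this]
  simp

theorem adjacent_of_sites {X : Fin N → ℤ} (hX : StrictMono X) {i j : Fin N}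
    (h : X j = X i + 1) : j.val = i.val + 1 := by
  have h1 : i < j := hX.lt_iff_lt.1 (by omega)
  by_contra hne
  have h2 : i.val + 1 < j.val := by
    have : i.val < j.val := h1
    omega
  have h3 := hX (show i < ⟨i.val + 1, by omega⟩ by simp [Fin.lt_def])
  have h4 := hX (show (⟨i.val + 1, by omega⟩ : Fin N) < j by simpa [Fin.lt_def] using h2)
  omega

/-- The boundary condition that makes `H` act freely. -/
def BoundaryCondition (φ : (Fin N → ℤ) → ℂ) : Prop :=
  ∀ (X : Fin N → ℤ) (i j : Fin N), j.val = i.val + 1 → X j = X i + 1 →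
    φ (Function.update X i (X i + 1)) + φ (Function.update X j (X j - 1)) - 2 * Δ * φ X = 0

/-- The free sum contains, for each pair of neighbouring particles, two forbidden hops that would
put one particle on top of the other, together with a diagonal term that `H` lacks. The boundary
condition says exactly that these three terms add up to zero. -/
theorem hamAct_eq_free {φ : (Fin N → ℤ) → ℂ} (hφ : BoundaryCondition Δ φ) (X : Config N) :
    hamAct Δ (fun X' => φ X'.1) X = ∑ i, (φ (Function.update X.1 i (X.1 i + 1))
      + φ (Function.update X.1 i (X.1 i - 1)) - 2 * Δ * φ X.1) := by
  set A := sites X with hA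
  set t : ℤ → ℂ := fun j => Finsupp.linearCombination ℂ (fun X' : Config N => φ X'.1)
      (Finsupp.comapDomain sites (localH Δ j (Finsupp.single (sites X) 1))
        sites_injective.injOn) with ht
  have hXA : ∀ i, X.1 i ∈ A := fun i => mem_sites.2 ⟨i, rfl⟩
  have ht0 : ∀ j, (j ∈ A ↔ j + 1 ∈ A) → t j = 0 := by
    intro j hj
    simp only [ht]
    rw [localH_single, if_pos hj]
    simp
  have htr : ∀ i, X.1 i + 1 ∉ A →
      t (X.1 i) = φ (Function.update X.1 i (X.1 i + 1)) - Δ * φ X.1 := by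
    intro i hi
    simp only [ht]
    rw [localH_single, if_neg (by have := hXA i; tauto),
      ← sites_update (X' := ⟨_, strictMono_update_succ X.2 fun k hk => hi (hk ▸ hXA k)⟩) hi rfl,
      linearCombination_bond]
  have htl : ∀ i, X.1 i - 1 ∉ A →
      t (X.1 i - 1) = φ (Function.update X.1 i (X.1 i - 1)) - Δ * φ X.1 := by
    intro i hi
    simp only [ht]
    rw [localH_single, if_neg (by have := hXA i; rw [sub_add_cancel]; tauto), sub_add_cancel,
      Finset.pair_comm,
      ← sites_update (X' := ⟨_, strictMono_update_pred X.2 fun k hk => hi (hk ▸ hXA k)⟩) hi rfl,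
      linearCombination_bond]
  -- Only bonds with exactly one occupied end act. They are the bonds to the right of a particle
  -- with empty right neighbour and those to the left of a particle with empty left neighbour.
  have hsum : ∑ j ∈ bonds A, t j = (∑ j ∈ A.filter (fun j => j + 1 ∉ A), t j) +
      ∑ j ∈ (A.image fun a => a - 1).filter (fun j => j ∉ A), t j := by
    rw [← Finset.sum_union]
    · refine (Finset.sum_subset ?_ ?_).symm
      · intro j hj
        simp only [bonds, Finset.mem_union, Finset.mem_filter] at hj ⊢
        tauto
      · intro j hj hj'
        refine ht0 j ?_
        simp only [bonds, Finset.mem_union, Finset.mem_filter, not_or, not_and, not_not,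
          Finset.mem_image] at hj hj'
        constructor
        · exact hj'.1
        · exact fun h => hj'.2 ⟨j + 1, h, by ring⟩
    · refine Finset.disjoint_left.2 fun j h1 h2 => ?_
      exact (Finset.mem_filter.1 h2).2 (Finset.mem_filter.1 h1).1
  have hAimg : A = Finset.univ.image X.1 := rfl
  have hs1 : ∑ j ∈ A.filter (fun j => j + 1 ∉ A), t j = ∑ i, if X.1 i + 1 ∉ A then
      φ (Function.update X.1 i (X.1 i + 1)) - Δ * φ X.1 else 0 := by
    rw [Finset.sum_filter]
    nth_rewrite 1 [hAimg]
    rw [Finset.sum_image fun a _ b _ h => X.2.injective h]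
    refine Finset.sum_congr rfl fun i _ => ?_
    split_ifs with h
    · rfl
    · exact htr i h
  have hs2 : ∑ j ∈ (A.image fun a => a - 1).filter (fun j => j ∉ A), t j =
      ∑ i, if X.1 i - 1 ∉ A then
        φ (Function.update X.1 i (X.1 i - 1)) - Δ * φ X.1 else 0 := by
    rw [Finset.sum_filter, Finset.sum_image fun a _ b _ h => by simpa using h]
    nth_rewrite 1 [hAimg]
    rw [Finset.sum_image fun a _ b _ h => X.2.injective h]
    refine Finset.sum_congr rfl fun i _ => ?_
    split_ifs with h
    · rfl
    · exact htl i h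
  -- The restriction to allowed hops is written as the unrestricted term minus a sum over the
  -- particle, if any, that occupies the target site.
  have hb1 : ∀ (i : Fin N) (a : ℂ), (if X.1 i + 1 ∉ A then a else 0) =
      a - ∑ k, if X.1 k = X.1 i + 1 then a else 0 := by
    intro i a
    by_cases h : X.1 i + 1 ∈ A
    · obtain ⟨k0, hk0⟩ := mem_sites.1 h
      rw [if_neg (by simpa using h), Finset.sum_eq_single k0, if_pos hk0, sub_self]
      · intro k _ hk
        exact if_neg fun h' => hk (X.2.injective (h'.trans hk0.symm))
      · simp
    · rw [if_pos h, Finset.sum_eq_zero, sub_zero]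
      intro k _
      refine if_neg fun h' => h ?_
      rw [← h']
      exact hXA k
  have hb2 : ∀ (i : Fin N) (a : ℂ), (if X.1 i - 1 ∉ A then a else 0) =
      a - ∑ k, if X.1 i = X.1 k + 1 then a else 0 := by
    intro i a
    by_cases h : X.1 i - 1 ∈ A
    · obtain ⟨k0, hk0⟩ := mem_sites.1 h
      rw [if_neg (by simpa using h), Finset.sum_eq_single k0, if_pos (by omega), sub_self]
      · intro k _ hk
        exact if_neg fun h' => hk (X.2.injective (by omega))
      · simp
    · rw [if_pos h, Finset.sum_eq_zero, sub_zero]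
      intro k _
      refine if_neg fun h' => h ?_
      have := hXA k
      rwa [show X.1 i - 1 = X.1 k by omega]
  -- The forbidden right hop of the left neighbour is matched with the forbidden left hop of the
  -- right neighbour.
  have hcancel : (∑ i, ∑ k, if X.1 k = X.1 i + 1 then
        φ (Function.update X.1 i (X.1 i + 1)) - Δ * φ X.1 else 0) +
      (∑ i, ∑ k, if X.1 i = X.1 k + 1 then
        φ (Function.update X.1 i (X.1 i - 1)) - Δ * φ X.1 else 0) = 0 := by
    rw [Finset.sum_comm (f := fun i k => if X.1 i = X.1 k + 1 then
        φ (Function.update X.1 i (X.1 i - 1)) - Δ * φ X.1 else 0), ← Finset.sum_add_distrib]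
    refine Finset.sum_eq_zero fun i _ => ?_
    rw [← Finset.sum_add_distrib]
    refine Finset.sum_eq_zero fun k _ => ?_
    by_cases h : X.1 k = X.1 i + 1
    · rw [if_pos h, if_pos h]
      have := hφ X.1 i k (adjacent_of_sites X.2 h) h
      linear_combination this
    · rw [if_neg h, if_neg h, add_zero]
  rw [hamAct_eq_sum_bonds, ← hA, hsum, hs1, hs2]
  simp_rw [hb1, hb2, Finset.sum_sub_distrib]
  rw [Finset.sum_add_distrib]
  have e : ∑ i : Fin N, 2 * (Δ : ℂ) * φ X.1 = ∑ i : Fin N, (Δ : ℂ) * φ X.1 +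
      ∑ i : Fin N, (Δ : ℂ) * φ X.1 := by
    rw [← Finset.sum_add_distrib]
    exact Finset.sum_congr rfl fun _ _ => by ring
  rw [e]
  linear_combination -hcancel

end

/-! ### Growth at infinity -/

/-- A fixed index lies in exactly `n - 1` of the pairs `i < j`. This gives the degree in one
variable of a product over pairs. -/
theorem sum_Ioi_pair {n : ℕ} (k0 : Fin n) (e : ℤ) :
    ∑ i, ∑ j ∈ Finset.Ioi i, (if i = k0 ∨ j = k0 then e else 0) = e * (n - 1) := by
  have h : ∀ i, ∑ j ∈ Finset.Ioi i, (if i = k0 ∨ j = k0 then e else 0) =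
      (if i = k0 then ((n : ℤ) - 1 - k0) * e else 0) + if i < k0 then e else 0 := by
    intro i
    by_cases hi : i = k0
    · subst hi
      have := i.isLt
      simp only [true_or, if_true, Finset.sum_const, Fin.card_Ioi, lt_irrefl, if_false, add_zero,
        nsmul_eq_mul]
      rw [Nat.cast_sub (by omega), Nat.cast_sub (by omega)]
      push_cast
      ring
    · simp [hi]
  simp_rw [h, Finset.sum_add_distrib]
  rw [Finset.sum_ite_eq', if_pos (Finset.mem_univ _), ← Finset.sum_filter, Finset.sum_const]
  have : (Finset.univ.filter fun i => i < k0) = Finset.Iio k0 := by ext; simp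
  rw [this, Fin.card_Iio, nsmul_eq_mul]
  ring

theorem isBigO_prod_zpow {ι : Type*} {s : Finset ι} {f : ι → ℂ → ℂ} {e : ι → ℤ}
    (h : ∀ i ∈ s, f i =O[Bornology.cobounded ℂ] fun w => w ^ e i) :
    (fun w => ∏ i ∈ s, f i w) =O[Bornology.cobounded ℂ] fun w => w ^ ∑ i ∈ s, e i := by
  refine (IsBigO.finsetProd h).trans_eventuallyEq ?_
  filter_upwards [eventually_ne_zero_cobounded] with w hw
  classical
  induction s using Finset.induction_on with
  | empty => simp
  | insert i s hi ih =>
    rw [Finset.prod_insert hi, Finset.sum_insert hi, zpow_add₀ hw,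
      ih fun j hj => h j (Finset.mem_insert_of_mem hj)]

theorem isBigO_mul_zpow {f g : ℂ → ℂ} {a b : ℤ}
    (hf : f =O[Bornology.cobounded ℂ] fun w => w ^ a)
    (hg : g =O[Bornology.cobounded ℂ] fun w => w ^ b) :
    (fun w => f w * g w) =O[Bornology.cobounded ℂ] fun w => w ^ (a + b) := by
  refine (hf.mul hg).trans_eventuallyEq ?_
  filter_upwards [eventually_ne_zero_cobounded] with w hw
  rw [zpow_add₀ hw]

theorem isBigO_zpow_of_le {f : ℂ → ℂ} {a b : ℤ} (hf : f =O[Bornology.cobounded ℂ] fun w => w ^ a)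
    (hab : a ≤ b) : f =O[Bornology.cobounded ℂ] fun w => w ^ b := by
  refine hf.trans (IsBigO.of_bound 1 ?_)
  rw [Filter.HasBasis.eventually_iff (hasBasis_cobounded_norm (E := ℂ))]
  refine ⟨1, trivial, fun w hw => ?_⟩
  simp only [mem_ofPred_eq] at hw
  rw [norm_zpow, norm_zpow, one_mul]
  exact zpow_le_zpow_right₀ hw hab

theorem isBigO_const_zpow (a : ℂ) :
    (fun _ : ℂ => a) =O[Bornology.cobounded ℂ] fun w => w ^ (0 : ℤ) := by
  simp only [zpow_zero]
  exact isBigO_const_const _ one_ne_zero _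

theorem isBigO_affine (a b : ℂ) :
    (fun w : ℂ => a * w + b) =O[Bornology.cobounded ℂ] fun w => w ^ (1 : ℤ) := by
  simpa using isBigO_id_add a b

theorem isBigO_affine_inv {a : ℂ} (ha : a ≠ 0) (b : ℂ) :
    (fun w : ℂ => (a * w + b)⁻¹) =O[Bornology.cobounded ℂ] fun w => w ^ (-1 : ℤ) := by
  have h : (fun w : ℂ => (a * w + b)⁻¹) = fun w => a⁻¹ * (w - -(b / a))⁻¹ := by
    funext w
    rw [← mul_inv]
    congr 1
    field_simp
    ring
  rw [h]
  simpa using (isBigO_inv_sub (-(b / a))).const_mul_left a⁻¹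

theorem isBigO_inv_zpow (c : ℂ) (e : ℤ) :
    (fun w : ℂ => ((c - w)⁻¹) ^ e) =O[Bornology.cobounded ℂ] fun w => w ^ (-e) := by
  have h1 : (fun w : ℂ => (c - w)⁻¹) =O[Bornology.cobounded ℂ] fun w => w ^ (-1 : ℤ) := by
    refine (isBigO_affine_inv (a := -1) (by norm_num) c).congr_left fun w => ?_
    congr 1
    ring
  have h2 : (fun w : ℂ => c - w) =O[Bornology.cobounded ℂ] fun w => w ^ (1 : ℤ) := by
    refine (isBigO_affine (-1) c).congr_left fun w => ?_
    ring
  rcases e with n | n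
  · refine (h1.pow n).congr (fun w => ?_) fun w => ?_
    · rw [Int.ofNat_eq_natCast, zpow_natCast]
    · rw [← zpow_natCast, ← zpow_mul, Int.ofNat_eq_natCast, neg_one_mul]
  · refine (h2.pow (n + 1)).congr (fun w => ?_) fun w => ?_
    · rw [zpow_negSucc, inv_pow, inv_inv]
    · rw [zpow_one, Int.neg_negSucc, ← zpow_natCast]

/-! ### The scattering factors -/

/-- The scattering factor `1 + a b - c a`. -/
def scat (c a b : ℂ) : ℂ := 1 + a * b - c * a

theorem scat_ne_zero {c a b : ℂ} (ha : 1 + ‖c‖ < ‖a‖) (hb : 1 + ‖c‖ < ‖b‖) : scat c a b ≠ 0 := by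
  intro h
  have h1 : a * (b - c) = -1 := by unfold scat at h; linear_combination h
  have h2 := congrArg norm h1
  rw [norm_mul, norm_neg, norm_one] at h2
  have h3 := norm_sub_gt (c := c) hb
  have h4 := norm_nonneg c
  have : 1 * 1 < ‖a‖ * ‖b - c‖ := mul_lt_mul'' (by linarith) (by linarith) (by simp) (by simp)
  linarith

theorem prod_Ioi_succ_eq {M : Type*} [CommMonoid M] {n : ℕ} (g : Fin (n + 1) → Fin (n + 1) → M) :
    ∏ i, ∏ j ∈ Finset.Ioi i, g i j =
      (∏ k : Fin n, g 0 k.succ) * ∏ i : Fin n, ∏ j ∈ Finset.Ioi i, g i.succ j.succ := by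
  rw [Fin.prod_univ_succ, Fin.prod_Ioi_zero]
  simp_rw [Fin.prod_Ioi_succ]

theorem scat_update_isBigO {ι : Type*} [DecidableEq ι] (c : ℂ) (y : ι → ℂ) (k i j : ι)
    (hij : i ≠ j) :
    (fun w => scat c (Function.update y k w i) (Function.update y k w j))
      =O[Bornology.cobounded ℂ] fun w => w ^ (if i = k ∨ j = k then (1 : ℤ) else 0) := by
  unfold scat
  by_cases hi : i = k
  · subst hi
    simp only [true_or, if_true, Function.update_self, Function.update_of_ne hij.symm]
    exact (isBigO_affine (y j - c) 1).congr_left fun w => by ring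
  · by_cases hj : j = k
    · subst hj
      simp only [or_true, if_true, Function.update_self, Function.update_of_ne hij]
      exact (isBigO_affine (y i) (1 - c * y i)).congr_left fun w => by ring
    · simp only [hi, hj, or_self, if_false, Function.update_of_ne, ne_eq, not_false_iff]
      exact isBigO_const_zpow _

theorem scat_update_inv_isBigO {ι : Type*} [DecidableEq ι] {c : ℂ} {y : ι → ℂ}
    (hy : ∀ k, 1 + ‖c‖ < ‖y k‖) (k i j : ι) (hij : i ≠ j) :
    (fun w => (scat c (Function.update y k w i) (Function.update y k w j))⁻¹)
      =O[Bornology.cobounded ℂ] fun w => w ^ (if i = k ∨ j = k then (-1 : ℤ) else 0) := by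
  unfold scat
  by_cases hi : i = k
  · subst hi
    simp only [true_or, if_true, Function.update_self, Function.update_of_ne hij.symm]
    have : y j - c ≠ 0 := fun h => by
      have := norm_sub_gt (c := c) (hy j)
      rw [h, norm_zero] at this
      linarith
    exact (isBigO_affine_inv this 1).congr_left fun w => by ring_nf
  · by_cases hj : j = k
    · subst hj
      simp only [or_true, if_true, Function.update_self, Function.update_of_ne hij]
      have : y i ≠ 0 := fun h => by
        have := hy i
        rw [h, norm_zero] at this
        have := norm_nonneg c
        linarith
      exact (isBigO_affine_inv this (1 - c * y i)).congr_left fun w => by ring_nf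
    · simp only [hi, hj, or_self, if_false, Function.update_of_ne, ne_eq, not_false_iff]
      exact isBigO_const_zpow _

/-- `∏_{i < j} (1 + y_i y_j - c y_i)`. -/
def scatProd {n : ℕ} (c : ℂ) (y : Fin n → ℂ) : ℂ :=
  ∏ i, ∏ j ∈ Finset.Ioi i, scat c (y i) (y j)

theorem scatProd_succ {n : ℕ} (c : ℂ) (z : Fin (n + 1) → ℂ) :
    scatProd c z = (∏ k : Fin n, scat c (z 0) (z k.succ)) * scatProd c fun i : Fin n => z i.succ :=
  prod_Ioi_succ_eq fun i j => scat c (z i) (z j)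

theorem scatProd_ne_zero {n : ℕ} {c : ℂ} {y : Fin n → ℂ} (hy : ∀ k, 1 + ‖c‖ < ‖y k‖) :
    scatProd c y ≠ 0 :=
  Finset.prod_ne_zero_iff.2 fun i _ => Finset.prod_ne_zero_iff.2 fun j _ =>
    scat_ne_zero (hy i) (hy j)

/-- The moving variable enters `n - 1` factors, each affine in it with leading coefficient `y j - c`
or `y i`, which is nonzero for large arguments. -/
theorem scatProd_update_inv_isBigO {n : ℕ} {c : ℂ} {y : Fin n → ℂ} (hy : ∀ k, 1 + ‖c‖ < ‖y k‖)
    (k : Fin n) : (fun w => (scatProd c (Function.update y k w))⁻¹)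
      =O[Bornology.cobounded ℂ] fun w => w ^ (1 - (n : ℤ)) := by
  have h := isBigO_prod_zpow (s := Finset.univ) fun i _ => isBigO_prod_zpow (s := Finset.Ioi i)
    fun j hj => scat_update_inv_isBigO hy k i j (Finset.mem_Ioi.1 hj).ne
  rw [sum_Ioi_pair] at h
  refine h.congr (fun w => ?_) fun w => ?_
  · simp [scatProd]
  · congr 1
    ring

theorem differentiable_scatProd {n : ℕ} (c : ℂ) :
    Differentiable ℂ fun y : Fin n → ℂ => scatProd c y := by
  unfold scatProd scat
  fun_prop

theorem differentiable_scatProd_comp {n m : ℕ} (c : ℂ) (e : Fin n → Fin m) :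
    Differentiable ℂ fun y : Fin m → ℂ => scatProd c fun i => y (e i) := by
  unfold scatProd scat
  fun_prop

/-! ### Orthogonality of the Bethe functions -/

section
variable {N : ℕ} (c : ℂ)

/-- The term with the permutation `σ` of the Bethe function, without the denominator and
multiplied with the plane wave `∏ ξ_j ^ (-y_j - 1)`. -/
def betheTerm (X Y : Fin N → ℤ) (σ : Equiv.Perm (Fin N)) (ξ : Fin N → ℂ) : ℂ :=
  ((Equiv.Perm.sign σ : ℤ) : ℂ) * scatProd c (fun i => ξ (σ i)) *
    ∏ j, ξ j ^ (X (σ.symm j) - Y j - 1)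

theorem betheTerm_differentiableOn (X Y : Fin N → ℤ) (σ : Equiv.Perm (Fin N))
    {s : Set (Fin N → ℂ)} (hs : ∀ j, (∀ ξ ∈ s, ξ j ≠ 0) ∨ 0 ≤ X (σ.symm j) - Y j - 1) :
    DifferentiableOn ℂ (betheTerm c X Y σ) s := by
  unfold betheTerm
  refine DifferentiableOn.fun_mul ?_ ?_
  · exact ((differentiable_scatProd_comp c σ).const_mul _).differentiableOn
  · exact differentiableOn_prod fun j _ =>
      differentiableOn_zpow (Differentiable.differentiableOn (by fun_prop)) (hs j)

/-- At `ξ k = ξ l` the terms of `σ` and `(k l) σ` differ only by the sign of the permutation. -/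
theorem sum_betheTerm_eq_zero (X Y : Fin N → ℤ) {ξ : Fin N → ℂ} (h0 : ∀ j, ξ j ≠ 0) {k l : Fin N}
    (hkl : k ≠ l) (h : ξ k = ξ l) : ∑ σ, betheTerm c X Y σ ξ = 0 := by
  have hsw : ∀ j, ξ (Equiv.swap k l j) = ξ j := by
    intro j
    by_cases h1 : j = k
    · subst h1; simp [h]
    · by_cases h2 : j = l
      · subst h2; simp [h]
      · rw [Equiv.swap_apply_of_ne_of_ne h1 h2]
  refine Finset.sum_involution (fun σ _ => Equiv.swap k l * σ) ?_ ?_ ?_ ?_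
  · intro σ _
    have e1 : (fun i => ξ ((Equiv.swap k l * σ) i)) = fun i => ξ (σ i) := by
      funext i
      rw [Equiv.Perm.mul_apply, hsw]
    have e2 : ∏ j, ξ j ^ (X ((Equiv.swap k l * σ).symm j) - Y j - 1) =
        ∏ j, ξ j ^ (X (σ.symm j) - Y j - 1) := by
      have split : ∀ τ : Equiv.Perm (Fin N), ∏ j, ξ j ^ (X (τ.symm j) - Y j - 1) =
          (∏ j, ξ j ^ (X (τ.symm j))) * ∏ j, ξ j ^ (-Y j - 1) := by
        intro τ
        rw [← Finset.prod_mul_distrib]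
        refine Finset.prod_congr rfl fun j _ => ?_
        rw [← zpow_add₀ (h0 j)]
        congr 1
        ring
      rw [split, split]
      congr 1
      rw [← Equiv.prod_comp (Equiv.swap k l)]
      refine Finset.prod_congr rfl fun j _ => ?_
      rw [hsw]
      congr 2
      rw [Equiv.symm_apply_eq, Equiv.Perm.mul_apply, Equiv.apply_symm_apply]
    unfold betheTerm
    rw [e1, e2, Equiv.Perm.sign_mul, Equiv.Perm.sign_swap hkl]
    push_cast
    ring
  · intro σ _ _ h'
    exact hkl (by simpa using h')
  · intro σ _
    exact Finset.mem_univ _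
  · intro σ _
    rw [← mul_assoc, Equiv.swap_mul_self, one_mul]

theorem betheTerm_isBigO_single (X Y : Fin N → ℤ) (σ : Equiv.Perm (Fin N)) (y : Fin N → ℂ)
    (k : Fin N) : (fun w => betheTerm c X Y σ (Function.update y k w))
      =O[Bornology.cobounded ℂ] fun w => w ^ ((N : ℤ) - 1 + (X (σ.symm k) - Y k - 1)) := by
  unfold betheTerm
  refine isBigO_mul_zpow ?_ ?_
  · refine IsBigO.const_mul_left ?_ _
    have h := isBigO_prod_zpow (s := Finset.univ) fun i _ => isBigO_prod_zpow (s := Finset.Ioi i)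
      fun j hj => scat_update_isBigO c y k (σ i) (σ j)
        (σ.injective.ne (Finset.mem_Ioi.1 hj).ne)
    have e : ∀ i, (σ i = k) = (i = σ.symm k) := fun i => propext (Equiv.eq_symm_apply σ).symm
    simp_rw [e, sum_Ioi_pair, one_mul] at h
    exact h
  · have h := isBigO_prod_zpow (s := Finset.univ)
      (f := fun j w => Function.update y k w j ^ (X (σ.symm j) - Y j - 1))
      (e := fun j => if j = k then X (σ.symm k) - Y k - 1 else 0) fun j _ => by
        by_cases hj : j = k
        · subst hj
          simpa using isBigO_refl _ _
        · simp only [Function.update_of_ne hj, hj, if_false]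
          exact isBigO_const_zpow _
    simpa using h

/-- The integrand whose contour integral is the coefficient of `e_X` in `e_Y`. -/
def betheIntegrand (X Y : Fin N → ℤ) (ξ : Fin N → ℂ) : ℂ :=
  (∑ σ, betheTerm c X Y σ ξ) / scatProd c ξ

variable {c}

theorem one_add_norm_pos (c : ℂ) : 0 < 1 + ‖c‖ := by positivity

theorem ne_zero_of_large {z : ℂ} (h : 1 + ‖c‖ < ‖z‖) : z ≠ 0 :=
  norm_pos_iff.1 ((one_add_norm_pos c).trans h)

theorem continuous_betheTerm_div {R : ℝ} (hR : 1 + ‖c‖ < R) (X Y : Fin N → ℤ)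
    (σ : Equiv.Perm (Fin N)) : Continuous fun θ =>
      betheTerm c X Y σ (torusMap 0 (fun _ : Fin N => R) θ) /
        scatProd c (torusMap 0 (fun _ : Fin N => R) θ) := by
  have hm : ∀ (θ : Fin N → ℝ) k, 1 + ‖c‖ < ‖torusMap 0 (fun _ : Fin N => R) θ k‖ := fun θ k => by
    rwa [torusMap_mem fun _ => (one_add_norm_pos c).trans hR]
  refine Continuous.div ?_ ((differentiable_scatProd c).continuous.comp (continuous_torusMap _))
    fun θ => scatProd_ne_zero (hm θ)
  exact (betheTerm_differentiableOn c X Y σ (s := {ξ | ∀ j, ξ j ≠ 0})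
    fun j => Or.inl fun ξ hξ => hξ j).continuousOn.comp_continuous (continuous_torusMap _)
    fun θ j => ne_zero_of_large (hm θ j)

/-- The variable `ξ k` is pushed to infinity. The scattering factors in numerator and denominator
have the same degree `N - 1` in it, which leaves the exponent `X (σ⁻¹ k) - Y k - 1 ≤ -2`. -/
theorem torusIntegral_betheTerm_eq_zero {R : ℝ} (hR : 1 + ‖c‖ < R) {X Y : Fin N → ℤ}
    {σ : Equiv.Perm (Fin N)} {k : Fin N} (h : X (σ.symm k) < Y k) :
    torusIntegral (fun ξ => betheTerm c X Y σ ξ / scatProd c ξ) 0 (fun _ => R) = 0 := by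
  have hR0 : 0 < R := (one_add_norm_pos c).trans hR
  obtain ⟨n, rfl⟩ : ∃ n, N = n + 1 := ⟨N - 1, by have := k.pos; omega⟩
  rw [torusIntegral_succAbove' (torusIntegrable_of_continuous (continuous_betheTerm_div hR X Y σ)) k]
  refine torusIntegral_eq_zero (fun _ => hR0) fun y hy => ?_
  have hmem : ∀ w : ℂ, 1 + ‖c‖ < ‖w‖ → ∀ j, 1 + ‖c‖ < ‖(k.insertNth w y : Fin (n + 1) → ℂ) j‖ := by
    intro w hw j
    refine Fin.succAboveCases k ?_ (fun j => ?_) j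
    · simpa using hw
    · simp only [Fin.insertNth_apply_succAbove, hy]
      exact hR
  refine circleIntegral_eq_zero_of_isBigO (one_add_norm_pos c).le hR ?_ ?_
  · refine DifferentiableOn.comp (t := {ξ | ∀ j, 1 + ‖c‖ < ‖ξ j‖})
      (g := fun ξ => betheTerm c X Y σ ξ / scatProd c ξ)
      ?_ (differentiable_insertNth k y).differentiableOn fun w hw => hmem w hw
    refine differentiableOn_div (betheTerm_differentiableOn c X Y σ fun j => Or.inl fun ξ hξ =>
      ne_zero_of_large (hξ j)) (differentiable_scatProd c).differentiableOn fun ξ hξ =>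
      scatProd_ne_zero hξ
  · have hy' := hmem R (by simpa [abs_of_pos hR0] using hR)
    have h1 := isBigO_mul_zpow (betheTerm_isBigO_single c X Y σ (k.insertNth (R : ℂ) y) k)
      (scatProd_update_inv_isBigO hy' k)
    simp_rw [← insertNth_eq_update, ← div_eq_mul_inv] at h1
    exact isBigO_zpow_of_le h1 (by omega)

theorem isBigO_zpow_update {ι : Type*} [DecidableEq ι] (y : ι → ℂ) (k j : ι) (e : ℤ) :
    (fun w => Function.update y k w j ^ e) =O[Bornology.cobounded ℂ]
      fun w => w ^ (if j = k then e else 0) := by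
  by_cases hj : j = k
  · subst hj
    simpa using isBigO_refl _ _
  · simp only [Function.update_of_ne hj, hj, if_false]
    exact isBigO_const_zpow _

theorem scat_inv_left {w : ℂ} (hw : w ≠ c) : scat c (c - w)⁻¹ w = 0 := by
  have : c - w ≠ 0 := sub_ne_zero.2 hw.symm
  unfold scat
  field_simp
  ring

theorem eventually_ne_cobounded (a : ℂ) : ∀ᶠ w in Bornology.cobounded ℂ, w ≠ a := by
  rw [Filter.HasBasis.eventually_iff (hasBasis_cobounded_norm (E := ℂ))]
  refine ⟨‖a‖ + 1, trivial, fun w hw => ?_⟩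
  rintro rfl
  simp only [mem_ofPred_eq] at hw
  linarith

/-- The growth at the pole `ξ_0 = 1 / (c - ξ_{k+1})` as `ξ_{k+1} → ∞`. If `σ` places `0` before `k +
1`, the numerator contains the factor that vanishes at this pole. Otherwise the plane wave decays
like `w^(-2)` or faster, because both `X` and `Y` are strictly increasing, against growth of order
`m` of the scattering factors. -/
theorem betheTerm_isBigO_pair {m : ℕ} {X Y : Fin (m + 1) → ℤ} (hX : StrictMono X)
    (hY : StrictMono Y) (σ : Equiv.Perm (Fin (m + 1))) (y : Fin m → ℂ) (k : Fin m) :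
    (fun w => betheTerm c X Y σ (Fin.cons (c - w)⁻¹ (Function.update y k w)))
      =O[Bornology.cobounded ℂ] fun w => w ^ ((m : ℤ) - 2) := by
  rcases lt_or_gt_of_ne (σ.symm.injective.ne (Fin.succ_ne_zero k)) with hlt | hgt
  · unfold betheTerm
    have hb : ∀ a : Fin (m + 1), ∀ b : Fin (m + 1), σ a ≠ σ b →
        (fun w => scat c ((Fin.cons (c - w)⁻¹ (Function.update y k w) : Fin (m + 1) → ℂ) (σ a))
          ((Fin.cons (c - w)⁻¹ (Function.update y k w) : Fin (m + 1) → ℂ) (σ b)))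
        =O[Bornology.cobounded ℂ] fun w => w ^ (if a = σ.symm k.succ ∨ b = σ.symm k.succ
          then (1 : ℤ) else 0) := by
      intro a b hab
      simp_rw [Equiv.eq_symm_apply]
      generalize σ a = a' at *
      generalize σ b = b' at *
      have hinv0 : (fun w : ℂ => (c - w)⁻¹) =O[Bornology.cobounded ℂ] fun w => w ^ (0 : ℤ) :=
        isBigO_zpow_of_le (by simpa using isBigO_inv_zpow c 1) (by norm_num : (-1 : ℤ) ≤ 0)
      have hupd : ∀ j, (fun w => Function.update y k w j) =O[Bornology.cobounded ℂ]
          fun w => w ^ (if j = k then (1 : ℤ) else 0) := fun j => by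
        simpa using isBigO_zpow_update y k j 1
      have hle : (0 : ℤ) ≤ if a' = k.succ ∨ b' = k.succ then 1 else 0 := by
        split_ifs <;> norm_num
      have h1 := isBigO_zpow_of_le (isBigO_const_zpow 1) hle
      induction a' using Fin.cases with
      | zero =>
        induction b' using Fin.cases with
        | zero => exact absurd rfl hab
        | succ b' =>
          simp only [scat, Fin.cons_zero, Fin.cons_succ]
          refine (h1.add ?_).sub ?_
          · refine isBigO_zpow_of_le (isBigO_mul_zpow hinv0 (hupd b')) ?_
            simp [Fin.ext_iff]
          · exact isBigO_zpow_of_le (hinv0.const_mul_left c) hle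
      | succ a' =>
        induction b' using Fin.cases with
        | zero =>
          simp only [scat, Fin.cons_zero, Fin.cons_succ]
          refine (h1.add ?_).sub ?_
          · refine isBigO_zpow_of_le (isBigO_mul_zpow (hupd a') hinv0) ?_
            simp [Fin.ext_iff]
          · refine isBigO_zpow_of_le ((hupd a').const_mul_left c) ?_
            simp [Fin.ext_iff]
        | succ b' =>
          simp only [Fin.cons_succ, Fin.succ_inj]
          exact scat_update_isBigO c y k a' b' fun h => hab (by rw [h])
    have h2 := isBigO_prod_zpow (s := Finset.univ) fun i _ => isBigO_prod_zpow (s := Finset.Ioi i)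
      fun j hj => hb i j (σ.injective.ne (Finset.mem_Ioi.1 hj).ne)
    simp_rw [sum_Ioi_pair, one_mul] at h2
    have h3 : (fun w => ∏ j, (Fin.cons (c - w)⁻¹ (Function.update y k w) : Fin (m + 1) → ℂ) j ^
        (X (σ.symm j) - Y j - 1)) =O[Bornology.cobounded ℂ]
        fun w => w ^ (-(X (σ.symm 0) - Y 0 - 1) + (X (σ.symm k.succ) - Y k.succ - 1)) := by
      simp_rw [Fin.prod_univ_succ, Fin.cons_zero, Fin.cons_succ]
      refine isBigO_mul_zpow (isBigO_inv_zpow c _) ?_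
      have := isBigO_prod_zpow (s := Finset.univ) fun j _ =>
        isBigO_zpow_update y k j (X (σ.symm j.succ) - Y j.succ - 1)
      simpa using this
    have h4 := isBigO_mul_zpow (h2.const_mul_left ((Equiv.Perm.sign σ : ℤ) : ℂ)) h3
    refine isBigO_zpow_of_le h4 ?_
    -- The exponent is `m + (X (σ⁻¹ (k+1)) - X (σ⁻¹ 0)) + (Y 0 - Y (k+1))`, and both differences are
    -- at most `-1`.
    have := hX hlt
    have := hY (Fin.succ_pos k)
    push_cast
    omega
  · refine EventuallyEq.trans_isBigO (f₂ := fun _ => (0 : ℂ)) ?_ (isBigO_zero _ _)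
    filter_upwards [eventually_ne_cobounded c] with w hw
    unfold betheTerm scatProd
    rw [Finset.prod_eq_zero (Finset.mem_univ (σ.symm 0)), mul_zero, zero_mul]
    refine Finset.prod_eq_zero (Finset.mem_Ioi.2 hgt) ?_
    simp [scat_inv_left hw]

/-- Since `Y 0 < X 0`, all exponents of `ξ_0` are nonnegative, so the only poles in `ξ_0` inside the
contour come from scattering factors. The numerator vanishes at coinciding momenta, as
`torusIntegral_scattering_eq_zero` requires. -/
theorem torusIntegral_betheIntegrand_eq_zero_of_gt {m : ℕ} {R : ℝ} (hR : 1 + ‖c‖ < R)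
    {X Y : Fin (m + 1) → ℤ} (hX : StrictMono X) (hY : StrictMono Y) (h : Y 0 < X 0) :
    torusIntegral (betheIntegrand c X Y) 0 (fun _ => R) = 0 := by
  have hc0 := norm_nonneg c
  have hexp : ∀ σ : Equiv.Perm (Fin (m + 1)), 0 ≤ X (σ.symm 0) - Y 0 - 1 := fun σ => by
    have := hX.monotone (Fin.zero_le (σ.symm 0))
    omega
  have key := torusIntegral_scattering_eq_zero (m := m) (c := c) (r0 := 1 + ‖c‖) (r := R) (ρ0 := R)
    (ρ1 := R + 1)
    (Φ := fun z => (∑ σ, betheTerm c X Y σ z) / scatProd c fun i : Fin m => z i.succ)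
    (by linarith) hR (by rw [add_sub_cancel_right, inv_one]; linarith) (by linarith) ?_ ?_ ?_
  · rw [← key]
    have e : (Fin.cons R fun _ => R : Fin (m + 1) → ℝ) = fun _ => R := by
      funext k
      refine Fin.cases ?_ (fun k => ?_) k <;> simp
    rw [e]
    congr 1
    funext z
    rw [betheIntegrand, scatProd_succ, mul_comm, div_mul_eq_div_div]
    rfl
  · refine differentiableOn_div ?_ (differentiable_scatProd_comp c _).differentiableOn
      fun z hz => scatProd_ne_zero hz.2
    refine DifferentiableOn.fun_sum fun σ _ => betheTerm_differentiableOn c X Y σ fun j => ?_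
    induction j using Fin.cases with
    | zero => exact Or.inr (hexp σ)
    | succ j => exact Or.inl fun z hz => ne_zero_of_large (hz.2 j)
  · intro y hy k l hlk hkl
    rw [sum_betheTerm_eq_zero c X Y (k := k.succ) (l := l.succ), zero_div]
    · intro j
      induction j using Fin.cases with
      | zero =>
        simp only [Fin.cons_zero]
        refine inv_ne_zero fun h => ?_
        have := norm_sub_gt (c := c) (hy k)
        rw [norm_sub_rev, h, norm_zero] at this
        linarith
      | succ j => simpa using ne_zero_of_large (hy j)
    · simpa using hlk.symm
    · simpa using hkl
  · intro y hy k
    have h1 := isBigO_mul_zpow (IsBigO.sum fun σ (_ : σ ∈ Finset.univ) =>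
      betheTerm_isBigO_pair (c := c) hX hY σ y k) (scatProd_update_inv_isBigO hy k)
    refine h1.congr (fun w => ?_) fun w => ?_
    · simp [div_eq_mul_inv]
    · rw [← zpow_neg_one]
      congr 1
      ring

/-- For `σ 0 = 0` the scattering factors with `ξ_0` cancel between numerator and denominator, and `X
0 = Y 0` leaves only `ξ_0⁻¹`. -/
theorem betheTerm_decomposeFin {m : ℕ} (X Y : Fin (m + 1) → ℤ) (h : X 0 = Y 0)
    (e : Equiv.Perm (Fin m)) (x : ℂ) (y : Fin m → ℂ) (hx : 1 + ‖c‖ < ‖x‖)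
    (hy : ∀ k, 1 + ‖c‖ < ‖y k‖) :
    betheTerm c X Y (Equiv.Perm.decomposeFin.symm (0, e)) (Fin.cons x y) /
        scatProd c (Fin.cons x y : Fin (m + 1) → ℂ) =
      x⁻¹ * (betheTerm c (fun i => X i.succ) (fun i => Y i.succ) e y / scatProd c y) := by
  have hs : ∀ j : Fin m, (Equiv.Perm.decomposeFin.symm (0, e)).symm j.succ = (e.symm j).succ := by
    intro j
    rw [Equiv.symm_apply_eq, Equiv.Perm.decomposeFin_symm_apply_succ]
    simp
  have h0 : (Equiv.Perm.decomposeFin.symm ((0 : Fin (m + 1)), e)).symm 0 = 0 := by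
    rw [Equiv.symm_apply_eq, Equiv.Perm.decomposeFin_symm_apply_zero]
  unfold betheTerm
  rw [scatProd_succ, scatProd_succ, Fin.prod_univ_succ]
  simp only [Fin.cons_zero, Fin.cons_succ, Equiv.Perm.decomposeFin_symm_apply_succ,
    Equiv.Perm.decomposeFin_symm_apply_zero, Equiv.swap_self, Equiv.refl_apply, hs, h0,
    Equiv.Perm.decomposeFin.symm_sign, if_true, one_mul, h, sub_self, zero_sub, zpow_neg_one]
  rw [Equiv.prod_comp e fun k => scat c x (y k)]
  have h1 : ∏ k, scat c x (y k) ≠ 0 := Finset.prod_ne_zero_iff.2 fun k _ => scat_ne_zero hx (hy k)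
  field_simp

/-- Completeness of the Bethe functions, by induction on `N`. The case `Y 0 < X 0` is settled for
the whole sum. In the other cases each permutation with `X 0 < Y (σ 0)` drops out by decay, so only
`σ 0 = 0` with `X 0 = Y 0` survives, and integrating out `ξ_0` reduces it to one particle fewer. -/
theorem torusIntegral_betheIntegrand {R : ℝ} (hR : 1 + ‖c‖ < R) :
    ∀ {N : ℕ} {X Y : Fin N → ℤ}, StrictMono X → StrictMono Y →
    torusIntegral (betheIntegrand c X Y) 0 (fun _ => R) =
      if X = Y then (2 * Real.pi * I) ^ N else 0 := by
  intro N
  have hR0 : 0 < R := (one_add_norm_pos c).trans hR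
  induction N with
  | zero =>
    intro X Y _ _
    rw [if_pos (Subsingleton.elim X Y)]
    simp [betheIntegrand, betheTerm, scatProd]
  | succ m ih =>
    intro X Y hX hY
    rcases lt_or_ge (Y 0) (X 0) with hlt | hle
    · rw [torusIntegral_betheIntegrand_eq_zero_of_gt hR hX hY hlt, if_neg]
      rintro rfl
      exact lt_irrefl _ hlt
    · have hsum : torusIntegral (betheIntegrand c X Y) 0 (fun _ => R) =
          ∑ σ, torusIntegral (fun ξ => betheTerm c X Y σ ξ / scatProd c ξ) 0 (fun _ => R) := by
        rw [← torusIntegral_finsetSum Finset.univ fun σ _ => continuous_betheTerm_div hR X Y σ]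
        congr 1
        funext ξ
        rw [betheIntegrand, Finset.sum_div]
      have hvan : ∀ σ : Equiv.Perm (Fin (m + 1)), X 0 < Y (σ 0) →
          torusIntegral (fun ξ => betheTerm c X Y σ ξ / scatProd c ξ) 0 (fun _ => R) = 0 :=
        fun σ h => torusIntegral_betheTerm_eq_zero hR (k := σ 0) (by simpa using h)
      rw [hsum]
      rcases hle.lt_or_eq with hlt | heq
      · rw [if_neg (by rintro rfl; exact lt_irrefl _ hlt)]
        exact Finset.sum_eq_zero fun σ _ =>
          hvan σ (hlt.trans_le (hY.monotone (Fin.zero_le _)))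
      -- A permutation is split into the value `σ 0` and a permutation of the remaining indices.
      · rw [← Equiv.sum_comp Equiv.Perm.decomposeFin.symm, Fintype.sum_prod_type,
          Finset.sum_eq_single 0]
        · have hX' : StrictMono fun i : Fin m => X i.succ :=
            hX.comp (Fin.strictMono_succ)
          have hY' : StrictMono fun i : Fin m => Y i.succ :=
            hY.comp (Fin.strictMono_succ)
          have hterm : ∀ e : Equiv.Perm (Fin m), torusIntegral (fun ξ =>
              betheTerm c X Y (Equiv.Perm.decomposeFin.symm (0, e)) ξ / scatProd c ξ) 0
              (fun _ => R) = 2 * Real.pi * I * torusIntegral (fun y =>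
                betheTerm c (fun i => X i.succ) (fun i => Y i.succ) e y / scatProd c y) 0
                (fun _ => R) := by
            intro e
            have hc := continuous_betheTerm_div hR X Y (Equiv.Perm.decomposeFin.symm (0, e))
            rw [torusIntegral_succAbove' (torusIntegrable_of_continuous hc) 0,
              ← torusIntegral_const_mul]
            refine torusIntegral_congr (fun _ => hR0) fun y hy => ?_
            have hy' : ∀ k, 1 + ‖c‖ < ‖y k‖ := fun k => by rw [hy]; exact hR
            simp only [Fin.insertNth_zero]
            rw [circleIntegral.integral_congr hR0.le (g := fun x => (x - 0)⁻¹ *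
              (betheTerm c (fun i => X i.succ) (fun i => Y i.succ) e y / scatProd c y))]
            · have := circleIntegral.integral_sub_center_inv (0 : ℂ) hR0.ne'
              simp_rw [mul_comm _ (betheTerm c (fun i => X i.succ) (fun i => Y i.succ) e y /
                scatProd c y)]
              rw [circleIntegral.integral_const_mul, this]
            · intro x hx
              have hx' : ‖x‖ = R := by simpa using hx
              simp only [sub_zero]
              exact betheTerm_decomposeFin X Y heq e x y (by rw [hx']; exact hR) hy'
          simp_rw [hterm]
          rw [← Finset.mul_sum, ← torusIntegral_finsetSum Finset.univ fun σ _ =>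
            continuous_betheTerm_div hR _ _ σ]
          have := ih hX' hY'
          unfold betheIntegrand at this
          simp_rw [← Finset.sum_div]
          rw [this]
          have hiff : (X = Y) ↔ ((fun i : Fin m => X i.succ) = fun i => Y i.succ) := by
            constructor
            · rintro rfl; rfl
            · intro h
              funext i
              refine Fin.cases heq (fun i => congrFun h i) i
          by_cases h : X = Y
          · rw [if_pos h, if_pos (hiff.1 h), pow_succ]
            ring
          · rw [if_neg h, if_neg (fun h' => h (hiff.2 h')), mul_zero]
        · intro p _ hp
          refine Finset.sum_eq_zero fun e _ => hvan _ ?_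
          rw [heq, Equiv.Perm.decomposeFin_symm_apply_zero]
          exact hY (Fin.pos_of_ne_zero hp)
        · simp

end

/-! ### Combinatorics of the index maps -/

section
variable {N n : ℕ} (τ : maps N n)

theorem maps_injective {k k' : Fin N} {a : Fin N} (h : τ.1 k = some a) (h' : τ.1 k' = some a) :
    k = k' :=
  Finset.card_le_one.1 ((Finset.mem_filter.1 τ.2).2.2 a) k (by simp [h]) k' (by simp [h'])

theorem mem_setK1 {τ : Fin N → Option (Fin N)} {k : Fin N} : k ∈ setK1 τ ↔ τ k = none := by
  simp [setK1]

theorem mem_setJ1 {τ : Fin N → Option (Fin N)} {j : Fin N} :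
    j ∈ setJ1 τ ↔ ∀ k, τ k ≠ some j := by
  simp [setJ1]

theorem enumK1_mem (b : Fin n) : τ.1 (enumK1 τ b) = none :=
  mem_setK1.1 (Finset.orderEmbOfFin_mem _ _ _)

theorem enumJ1_mem (a : Fin n) (k : Fin N) : τ.1 k ≠ some (enumJ1 τ a) :=
  mem_setJ1.1 (Finset.orderEmbOfFin_mem _ _ _) k

theorem exists_enumK1 {k : Fin N} (h : τ.1 k = none) : ∃ b, enumK1 τ b = k := by
  have : k ∈ Set.range (enumK1 τ) := by
    rw [enumK1, Finset.range_orderEmbOfFin]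
    exact mem_setK1.2 h
  exact this

theorem exists_enumJ1 {j : Fin N} (h : ∀ k, τ.1 k ≠ some j) : ∃ a, enumJ1 τ a = j := by
  have : j ∈ Set.range (enumJ1 τ) := by
    rw [enumJ1, Finset.range_orderEmbOfFin]
    exact mem_setJ1.2 h
  exact this

theorem enumK1_unique {f : Fin n → Fin N} (hf : ∀ b, τ.1 (f b) = none) (hm : StrictMono f) :
    f = enumK1 τ :=
  Finset.orderEmbOfFin_unique _ (fun b => mem_setK1.2 (hf b)) hm

theorem enumJ1_unique {f : Fin n → Fin N} (hf : ∀ b k, τ.1 k ≠ some (f b)) (hm : StrictMono f) :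
    f = enumJ1 τ :=
  Finset.orderEmbOfFin_unique _ (fun b => mem_setJ1.2 (hf b)) hm

theorem image_enumK1 : Finset.univ.map (enumK1 τ).toEmbedding =
    Finset.univ.filter fun k => τ.1 k = none := by
  ext k
  simp only [Finset.mem_map, Finset.mem_univ, true_and, Finset.mem_filter]
  constructor
  · rintro ⟨b, rfl⟩
    exact enumK1_mem τ b
  · exact exists_enumK1 τ

theorem image_enumJ1 : Finset.univ.map (enumJ1 τ).toEmbedding =
    Finset.univ.filter fun j => ∀ k, τ.1 k ≠ some j := by
  ext k
  simp only [Finset.mem_map, Finset.mem_univ, true_and, Finset.mem_filter]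
  constructor
  · rintro ⟨b, rfl⟩
    exact enumJ1_mem τ b
  · exact exists_enumJ1 τ

/-- The sites of the particles split into `K_1` and its complement. -/
theorem prod_particles {M : Type*} [CommMonoid M] (g : Fin N → M) :
    ∏ k, g k = (∏ b, g (enumK1 τ b)) * ∏ k, (τ.1 k).elim 1 fun _ => g k := by
  have h1 : ∏ b, g (enumK1 τ b) = ∏ k, if τ.1 k = none then g k else 1 := by
    rw [← Finset.prod_filter, ← image_enumK1, Finset.prod_map]
    rfl
  rw [h1, ← Finset.prod_mul_distrib]
  refine Finset.prod_congr rfl fun k _ => ?_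
  cases τ.1 k <;> simp

/-- The momenta split into `J_1` and the values of `τ`. -/
theorem prod_momenta {M : Type*} [CommMonoid M] (g : Fin N → M) :
    ∏ j, g j = (∏ a, g (enumJ1 τ a)) * ∏ k, (τ.1 k).elim 1 g := by
  have h1 : ∏ a, g (enumJ1 τ a) = ∏ j, if ∀ k, τ.1 k ≠ some j then g j else 1 := by
    rw [← Finset.prod_filter, ← image_enumJ1, Finset.prod_map]
    rfl
  have h2 : ∏ k, (τ.1 k).elim 1 g = ∏ j, if ∀ k, τ.1 k ≠ some j then 1 else g j := by
    have e1 : ∏ k, (τ.1 k).elim 1 g = ∏ k, ∏ j, if τ.1 k = some j then g j else 1 := by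
      refine Finset.prod_congr rfl fun k _ => ?_
      cases hk : τ.1 k with
      | none => simp
      | some a => simp
    rw [e1, Finset.prod_comm]
    refine Finset.prod_congr rfl fun j _ => ?_
    by_cases h : ∀ k, τ.1 k ≠ some j
    · rw [if_pos h]
      exact Finset.prod_eq_one fun k _ => if_neg (h k)
    · rw [if_neg h]
      push Not at h
      obtain ⟨k, hk⟩ := h
      rw [Finset.prod_eq_single k, if_pos hk]
      · intro k' _ hne
        exact if_neg fun h' => hne (maps_injective τ h' hk)
      · simp
  rw [h1, h2, ← Finset.prod_mul_distrib]
  refine Finset.prod_congr rfl fun j _ => ?_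
  by_cases h : ∀ k, τ.1 k ≠ some j
  · simp only [if_pos h, mul_one]
  · simp only [if_neg h, one_mul]

/-- Below the `a`-th element of `J_1` there are `a` elements of `J_1`; all others are values of `τ`.
This links the position in `J_1` to the number of inversions created by filling in that element. -/
theorem card_lt_enumJ1 (a : Fin n) :
    (a : ℕ) + (Finset.univ.filter fun b : Fin N => b < enumJ1 τ a ∧ ∃ k, τ.1 k = some b).card =
      (enumJ1 τ a : ℕ) := by
  have h1 : (a : ℕ) = ((Finset.Iio a).map (enumJ1 τ).toEmbedding).card := by simp
  have h2 : (enumJ1 τ a : ℕ) = (Finset.Iio (enumJ1 τ a)).card := by simp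
  rw [h2, h1, ← Finset.card_union_of_disjoint]
  · congr 1
    ext j
    simp only [Finset.mem_union, Finset.mem_map, Finset.mem_Iio, Finset.mem_filter,
      Finset.mem_univ, true_and]
    constructor
    · rintro (⟨b, hb, rfl⟩ | ⟨h, -⟩)
      · exact (enumJ1 τ).strictMono hb
      · exact h
    · intro h
      by_cases hj : ∃ k, τ.1 k = some j
      · exact Or.inr ⟨h, hj⟩
      · push Not at hj
        obtain ⟨b, rfl⟩ := exists_enumJ1 τ hj
        exact Or.inl ⟨b, (enumJ1 τ).lt_iff_lt.1 h, rfl⟩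
  · refine Finset.disjoint_left.2 fun j hj hj' => ?_
    obtain ⟨b, -, rfl⟩ := Finset.mem_map.1 hj
    obtain ⟨-, -, k, hk⟩ := Finset.mem_filter.1 hj'
    exact enumJ1_mem τ b k hk

theorem sum_particles {M : Type*} [AddCommMonoid M] (g : Fin N → M) :
    ∑ k, g k = (∑ b, g (enumK1 τ b)) + ∑ k, (τ.1 k).elim 0 fun _ => g k := by
  have h1 : ∑ b, g (enumK1 τ b) = ∑ k, if τ.1 k = none then g k else 0 := by
    rw [← Finset.sum_filter, ← image_enumK1, Finset.sum_map]
    rfl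
  rw [h1, ← Finset.sum_add_distrib]
  refine Finset.sum_congr rfl fun k _ => ?_
  cases τ.1 k <;> simp

end

/-! ### The integrand as a superposition of plane waves -/

section
variable {N n : ℕ} (Δ : ℝ) (x : ℤ) (τ : maps N n) (ξ : Fin N → ℂ) (ζ : Fin n → ℂ)

/-- The sign of `τ`. -/
def mapSign {N : ℕ} (τ : Fin N → Option (Fin N)) : ℂ := (-1) ^ shift τ * (-1) ^ inversions τ

/-- The factor `ξ + ζ - c ξ ζ`. -/
def link (c a z : ℂ) : ℂ := a + z - c * a * z

/-- `det d(ξ_j, ζ_k)`. -/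
def detJK {n : ℕ} (Δ : ℝ) (u ζ : Fin n → ℂ) : ℂ :=
  Matrix.det (Matrix.of fun a b : Fin n => dFun Δ (u a) (ζ b))

/-- The factor of `f(ξ, ζ; τ)` that belongs to a particle `k` with `τ(k) = a ≠ 0`, without the
power of `ξ_a`. -/
def ampSome (k a : Fin N) : ℂ :=
  (∏ j ∈ (Finset.Ioi a).filter (fun j => ∀ k', k < k' → τ.1 k' ≠ some j),
      scat (2 * Δ) (ξ j) (ξ a) / scat (2 * Δ) (ξ a) (ξ j)) *
    ∏ b ∈ Finset.univ.filter (fun b : Fin n => k < enumK1 τ b),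
      link (2 * Δ) (ξ a) (ζ b) / (ξ a + ζ b - 2 * Δ)

/-- The factor of `f(ξ, ζ; τ)` that belongs to a particle, without the power of `ξ_a`. -/
def amp (k : Fin N) : ℂ := (τ.1 k).elim 1 fun a => ampSome Δ τ ξ ζ k a

/-- The rational factor of the integrand. -/
def coefI : ℂ :=
  mapSign τ.1 * (∏ a, ∏ b, link (2 * Δ) (ξ (enumJ1 τ a)) (ζ b)) *
    detJK Δ (fun a => ξ (enumJ1 τ a)) ζ /
    (scatProd (2 * Δ) (fun a => ξ (enumJ1 τ a)) * scatProd (2 * Δ) ζ)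

/-- The part of the integrand that depends on the initial configuration in the `ζ`-sector. -/
def core (Y : Fin N → ℤ) : ℂ :=
  coefI Δ τ ξ ζ * (∏ a, ξ (enumJ1 τ a) ^ x) * (∏ b, ζ b ^ (x - Y (enumK1 τ b) - 1)) *
    (∏ k, amp Δ τ ξ ζ k) * ∏ k, (τ.1 k).elim 1 fun a => ξ a ^ Y k

/-- The energy of the plane waves. -/
def mapEnergy : ℂ :=
  (∑ b, energy Δ (ζ b)) + ∑ k, (τ.1 k).elim 0 fun a => energy Δ (ξ a)

/-- The right side displays the structure of the proof: the plane wave selecting the initial state,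
its evolution `exp(-itH)`, the cut-off `core`, and the backward evolution `exp(itH)`. For a momentum
`ξ_{τ(k)}` the two phases cancel, so only the momenta in `J_1` and the `ζ` keep exponentials in
`I_N`. -/
theorem integrand_eq (Y : Config N) (t : ℝ) (hξ : ∀ j, ξ j ≠ 0) :
    integrandI Δ Y t x τ ξ ζ * integrandF Δ Y τ ξ ζ =
      (∏ j, ξ j ^ (-Y.1 j - 1)) * (exp (-(I * t * ∑ j, energy Δ (ξ j))) *
        (core Δ x τ ξ ζ Y.1 * exp (I * t * mapEnergy Δ τ ξ ζ))) := by
  have hF : integrandF Δ Y τ ξ ζ = (∏ k, amp Δ τ ξ ζ k) *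
      ((∏ k, (τ.1 k).elim 1 fun a => ξ a ^ Y.1 k) *
        ∏ k, (τ.1 k).elim 1 fun a => ξ a ^ (-Y.1 a - 1)) := by
    rw [integrandF, ← Finset.prod_mul_distrib, ← Finset.prod_mul_distrib]
    refine Finset.prod_congr rfl fun k _ => ?_
    unfold amp
    cases hk : τ.1 k with
    | none => simp
    | some a =>
      simp only [Option.elim_some]
      rw [← zpow_add₀ (hξ a), ampSome]
      congr 1
      · congr 1
        refine Finset.prod_congr rfl fun j _ => ?_
        unfold scat
        ring_nf
      · congr 1
        ring
  have hI : integrandI Δ Y t x τ ξ ζ = coefI Δ τ ξ ζ * ((∏ a, ξ (enumJ1 τ a) ^ x) *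
      (∏ a, ξ (enumJ1 τ a) ^ (-Y.1 (enumJ1 τ a) - 1)) *
      ∏ a, exp (-(I * t * energy Δ (ξ (enumJ1 τ a))))) *
      ((∏ b, ζ b ^ (x - Y.1 (enumK1 τ b) - 1)) * ∏ b, exp (I * t * energy Δ (ζ b))) := by
    have h1 : ∏ a, ξ (enumJ1 τ a) ^ (x - Y.1 (enumJ1 τ a) - 1) *
        exp (-(I * t * energy Δ (ξ (enumJ1 τ a)))) = (∏ a, ξ (enumJ1 τ a) ^ x) *
        (∏ a, ξ (enumJ1 τ a) ^ (-Y.1 (enumJ1 τ a) - 1)) *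
        ∏ a, exp (-(I * t * energy Δ (ξ (enumJ1 τ a)))) := by
      rw [← Finset.prod_mul_distrib, ← Finset.prod_mul_distrib]
      refine Finset.prod_congr rfl fun a _ => ?_
      rw [← zpow_add₀ (hξ _)]
      congr 2
      ring
    have h2 : ∏ b, ζ b ^ (x - Y.1 (enumK1 τ b) - 1) * exp (I * t * energy Δ (ζ b)) =
        (∏ b, ζ b ^ (x - Y.1 (enumK1 τ b) - 1)) * ∏ b, exp (I * t * energy Δ (ζ b)) :=
      Finset.prod_mul_distrib
    rw [integrandI, h1, h2]
    congr 2
    rw [coefI, detD, detJK, mapSign]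
    unfold scatProd scat link
    ring
  have hE : exp (-(I * t * ∑ j, energy Δ (ξ j))) * exp (I * t * mapEnergy Δ τ ξ ζ) =
      (∏ a, exp (-(I * t * energy Δ (ξ (enumJ1 τ a))))) * ∏ b, exp (I * t * energy Δ (ζ b)) := by
    have h1 : exp (-(I * t * ∑ j, energy Δ (ξ j))) =
        (∏ a, exp (-(I * t * energy Δ (ξ (enumJ1 τ a))))) *
          ∏ k, (τ.1 k).elim 1 fun a => exp (-(I * t * energy Δ (ξ a))) := by
      rw [← prod_momenta τ fun j => exp (-(I * t * energy Δ (ξ j))), ← exp_sum, Finset.mul_sum,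
        Finset.sum_neg_distrib]
    have h2 : exp (I * t * mapEnergy Δ τ ξ ζ) = (∏ b, exp (I * t * energy Δ (ζ b))) *
        ∏ k, (τ.1 k).elim 1 fun a => exp (I * t * energy Δ (ξ a)) := by
      rw [mapEnergy, mul_add, exp_add, Finset.mul_sum, Finset.mul_sum, exp_sum, exp_sum]
      congr 1
      refine Finset.prod_congr rfl fun k _ => ?_
      cases τ.1 k <;> simp
    have h3 : (∏ k, (τ.1 k).elim 1 fun a => exp (-(I * t * energy Δ (ξ a)))) *
        (∏ k, (τ.1 k).elim 1 fun a => exp (I * t * energy Δ (ξ a))) = 1 := by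
      rw [← Finset.prod_mul_distrib]
      refine Finset.prod_eq_one fun k _ => ?_
      cases τ.1 k with
      | none => simp
      | some a => simp [← exp_add]
    rw [h1, h2]
    linear_combination (∏ a, exp (-(I * t * energy Δ (ξ (enumJ1 τ a))))) *
      (∏ b, exp (I * t * energy Δ (ζ b))) * h3
  rw [hF, hI, prod_momenta τ fun j => ξ j ^ (-Y.1 j - 1), core]
  linear_combination -(∏ a, ξ (enumJ1 τ a) ^ (-Y.1 (enumJ1 τ a) - 1)) *
    (∏ k, (τ.1 k).elim 1 fun a => ξ a ^ (-Y.1 a - 1)) * coefI Δ τ ξ ζ *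
    (∏ a, ξ (enumJ1 τ a) ^ x) * (∏ b, ζ b ^ (x - Y.1 (enumK1 τ b) - 1)) *
    (∏ k, amp Δ τ ξ ζ k) * (∏ k, (τ.1 k).elim 1 fun a => ξ a ^ Y.1 k) * hE

/-- The factor by which the plane wave changes when the particle `k` moves to the right. -/
def waveMult (k : Fin N) : ℂ :=
  (τ.1 k).elim (∏ b, if enumK1 τ b = k then (ζ b)⁻¹ else 1) ξ

theorem waveMult_enumK1 (b : Fin n) : waveMult τ ξ ζ (enumK1 τ b) = (ζ b)⁻¹ := by
  rw [waveMult, enumK1_mem, Option.elim_none, Finset.prod_eq_single b]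
  · simp
  · intro b' _ hb
    rw [if_neg fun h => hb ((enumK1 τ).injective h)]
  · simp

theorem waveMult_some {k a : Fin N} (h : τ.1 k = some a) : waveMult τ ξ ζ k = ξ a := by
  rw [waveMult, h, Option.elim_some]

theorem waveMult_ne_zero (hξ : ∀ j, ξ j ≠ 0) (hζ : ∀ b, ζ b ≠ 0) (k : Fin N) :
    waveMult τ ξ ζ k ≠ 0 := by
  cases h : τ.1 k with
  | none =>
    obtain ⟨b, rfl⟩ := exists_enumK1 τ h
    rw [waveMult_enumK1]
    exact inv_ne_zero (hζ b)
  | some a =>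
    rw [waveMult_some τ ξ ζ h]
    exact hξ a

/-- The part of the integrand that does not depend on the initial configuration. -/
def coreCoef : ℂ :=
  coefI Δ τ ξ ζ * (∏ a, ξ (enumJ1 τ a) ^ x) * (∏ b, ζ b ^ (x - 1)) * ∏ k, amp Δ τ ξ ζ k

/-- As a function of the configuration `core` is one plane wave: particle `k` has multiplier
`ξ_{τ(k)}`, or `1/ζ` if it lies in `K_1`. -/
theorem core_eq_wave (hζ : ∀ b, ζ b ≠ 0) (Y : Fin N → ℤ) :
    core Δ x τ ξ ζ Y = coreCoef Δ x τ ξ ζ * ∏ k, waveMult τ ξ ζ k ^ Y k := by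
  have h1 : ∏ k, waveMult τ ξ ζ k ^ Y k = (∏ b, ζ b ^ (-Y (enumK1 τ b))) *
      ∏ k, (τ.1 k).elim 1 fun a => ξ a ^ Y k := by
    rw [prod_particles τ]
    congr 1
    · refine Finset.prod_congr rfl fun b _ => ?_
      rw [waveMult_enumK1, inv_zpow']
    · refine Finset.prod_congr rfl fun k _ => ?_
      cases h : τ.1 k with
      | none => rfl
      | some a => rw [Option.elim_some, Option.elim_some, waveMult_some τ ξ ζ h]
  have h2 : ∏ b, ζ b ^ (x - Y (enumK1 τ b) - 1) =
      (∏ b, ζ b ^ (x - 1)) * ∏ b, ζ b ^ (-Y (enumK1 τ b)) := by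
    rw [← Finset.prod_mul_distrib]
    refine Finset.prod_congr rfl fun b _ => ?_
    rw [← zpow_add₀ (hζ b)]
    congr 1
    ring
  rw [core, coreCoef, h1, h2]
  ring

/-- Uses `ε(1/ζ) = ε(ζ)`. -/
theorem mapEnergy_eq_sum : mapEnergy Δ τ ξ ζ = ∑ k, energy Δ (waveMult τ ξ ζ k) := by
  rw [mapEnergy, sum_particles τ fun k => energy Δ (waveMult τ ξ ζ k)]
  congr 1
  · refine Finset.sum_congr rfl fun b _ => ?_
    rw [waveMult_enumK1, energy, energy, inv_inv]
    ring
  · refine Finset.sum_congr rfl fun k _ => ?_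
    cases h : τ.1 k with
    | none => rfl
    | some a => rw [Option.elim_some, Option.elim_some, waveMult_some τ ξ ζ h]

end

/-! ### Removing the first particle from `K_1` -/

section
variable {N n : ℕ} [NeZero N] (τ : maps N (n + 1))

theorem enumK1_zero (h0 : τ.1 0 = none) : enumK1 τ 0 = 0 := by
  obtain ⟨b, hb⟩ := exists_enumK1 τ h0
  have h1 : enumK1 τ 0 ≤ enumK1 τ b := (enumK1 τ).monotone (Fin.zero_le b)
  rw [hb] at h1
  exact le_antisymm h1 (Fin.zero_le _)

variable (h0 : τ.1 0 = none)

/-- The map `τ` with the value at the first particle changed from `0` to the `a`-th element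
of `J_1`. -/
def fill (a : Fin (n + 1)) : maps N n :=
  ⟨Function.update τ.1 0 (some (enumJ1 τ a)), by
    refine Finset.mem_filter.2 ⟨Finset.mem_univ _, ?_, fun j => ?_⟩
    · have h1 : (Finset.univ.filter fun k => Function.update τ.1 0 (some (enumJ1 τ a)) k = none) =
          (setK1 τ.1).erase 0 := by
        ext k
        by_cases hk : k = 0
        · subst hk; simp
        · simp [setK1, hk]
      rw [h1, Finset.card_erase_of_mem (mem_setK1.2 h0), card_setK1]
      rfl
    · rw [Finset.card_le_one]
      intro k hk k' hk'
      simp only [Finset.mem_filter, Finset.mem_univ, true_and] at hk hk'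
      by_cases h1 : k = 0 <;> by_cases h2 : k' = 0
      · rw [h1, h2]
      · subst h1
        rw [Function.update_self] at hk
        rw [Function.update_of_ne h2, ← hk] at hk'
        exact absurd hk' (enumJ1_mem τ a k')
      · subst h2
        rw [Function.update_self] at hk'
        rw [Function.update_of_ne h1, ← hk'] at hk
        exact absurd hk (enumJ1_mem τ a k)
      · rw [Function.update_of_ne h1] at hk
        rw [Function.update_of_ne h2] at hk'
        exact maps_injective τ hk hk'⟩

theorem fill_zero (a : Fin (n + 1)) : (fill τ h0 a).1 0 = some (enumJ1 τ a) := by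
  simp [fill]

theorem fill_of_ne (a : Fin (n + 1)) {k : Fin N} (hk : k ≠ 0) : (fill τ h0 a).1 k = τ.1 k :=
  Function.update_of_ne hk _ _

theorem enumK1_fill (a : Fin (n + 1)) (b : Fin n) :
    enumK1 (fill τ h0 a) b = enumK1 τ b.succ := by
  have hpos : ∀ b : Fin n, enumK1 τ b.succ ≠ 0 := fun b h => by
    rw [← enumK1_zero τ h0] at h
    exact Fin.succ_ne_zero b ((enumK1 τ).injective h)
  refine (congrFun (enumK1_unique (fill τ h0 a) (f := fun b => enumK1 τ b.succ)
    (fun b => ?_) ?_) b).symm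
  · rw [fill_of_ne τ h0 a (hpos b)]
    exact enumK1_mem τ _
  · exact (enumK1 τ).strictMono.comp Fin.strictMono_succ

theorem enumJ1_fill (a : Fin (n + 1)) (b : Fin n) :
    enumJ1 (fill τ h0 a) b = enumJ1 τ (a.succAbove b) := by
  refine (congrFun (enumJ1_unique (fill τ h0 a) (f := fun b => enumJ1 τ (a.succAbove b))
    (fun b k => ?_) ?_) b).symm
  · by_cases hk : k = 0
    · subst hk
      rw [fill_zero]
      intro h
      exact Fin.succAbove_ne a b ((enumJ1 τ).injective (Option.some.inj h)).symm
    · rw [fill_of_ne τ h0 a hk]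
      exact enumJ1_mem τ _ k
  · exact (enumJ1 τ).strictMono.comp (Fin.strictMono_succAbove a)

theorem shift_fill (a : Fin (n + 1)) :
    shift (fill τ h0 a).1 = shift τ.1 + ((enumJ1 τ a : ℕ) : ℤ) := by
  have key : ∀ σ : Fin N → Option (Fin N), shift σ =
      (σ 0).elim 0 (fun a => ((a : ℕ) : ℤ) - (((0 : Fin N) : ℕ) : ℤ)) +
      ∑ k ∈ Finset.univ.erase (0 : Fin N),
        (σ k).elim 0 fun a => ((a : ℕ) : ℤ) - ((k : ℕ) : ℤ) := by
    intro σ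
    rw [Finset.add_sum_erase _ (fun k => (σ k).elim (0 : ℤ) fun a => ((a : ℕ) : ℤ) - ((k : ℕ) : ℤ))
      (Finset.mem_univ (0 : Fin N))]
    refine Finset.sum_congr rfl fun k _ => ?_
    cases σ k <;> rfl
  rw [key, key, fill_zero, h0, Finset.sum_congr rfl fun k hk => by
    rw [fill_of_ne τ h0 a (Finset.ne_of_mem_erase hk)]]
  simp
  ring

/-- The first particle precedes all others, so the new inversions are exactly the values of `τ`
below the value filled in. -/
theorem inversions_fill (a : Fin (n + 1)) :
    inversions (fill τ h0 a).1 = inversions τ.1 +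
      (Finset.univ.filter fun b : Fin N => b < enumJ1 τ a ∧ ∃ k, τ.1 k = some b).card := by
  unfold inversions
  have h1 : (Finset.univ.filter fun p : Fin N × Fin N => p.1 < p.2 ∧ ∃ b c : Fin N,
      (fill τ h0 a).1 p.1 = some b ∧ (fill τ h0 a).1 p.2 = some c ∧ c < b) =
      (Finset.univ.filter fun p : Fin N × Fin N => p.1 < p.2 ∧ ∃ b c : Fin N,
        τ.1 p.1 = some b ∧ τ.1 p.2 = some c ∧ c < b) ∪
      (Finset.univ.filter fun k : Fin N => ∃ c, τ.1 k = some c ∧ c < enumJ1 τ a).image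
        fun k => (0, k) := by
    ext ⟨k, l⟩
    simp only [Finset.mem_union, Finset.mem_filter, Finset.mem_univ, true_and,
      Finset.mem_image, Prod.mk.injEq]
    by_cases hk : k = 0
    · subst hk
      rw [h0, fill_zero]
      constructor
      · rintro ⟨hl, b, c, hb, hc, hcb⟩
        rw [fill_of_ne τ h0 a hl.ne'] at hc
        refine Or.inr ⟨l, ⟨c, hc, ?_⟩, rfl, rfl⟩
        rwa [Option.some.inj hb]
      · rintro (⟨_, b, c, hb, _⟩ | ⟨l', ⟨c, hc, hcb⟩, -, rfl⟩)
        · cases hb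
        · have hl : l' ≠ 0 := fun h => by rw [h, h0] at hc; cases hc
          refine ⟨Fin.pos_iff_ne_zero.2 hl, _, c, rfl, ?_, hcb⟩
          rw [fill_of_ne τ h0 a hl, hc]
    · rw [fill_of_ne τ h0 a hk]
      constructor
      · rintro ⟨hl, b, c, hb, hc, hcb⟩
        have hl0 : l ≠ 0 := fun h => by
          rw [h] at hl
          exact absurd hl (not_lt.2 (Fin.zero_le k))
        rw [fill_of_ne τ h0 a hl0] at hc
        exact Or.inl ⟨hl, b, c, hb, hc, hcb⟩
      · rintro (⟨hl, b, c, hb, hc, hcb⟩ | ⟨l', _, h, _⟩)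
        · have hl0 : l ≠ 0 := fun h => by
            rw [h] at hl
            exact absurd hl (not_lt.2 (Fin.zero_le k))
          refine ⟨hl, b, c, hb, ?_, hcb⟩
          rw [fill_of_ne τ h0 a hl0, hc]
        · exact absurd h.symm hk
  rw [h1, Finset.card_union_of_disjoint,
    Finset.card_image_of_injective _ fun _ _ h => (Prod.mk.inj h).2]
  · congr 1
    refine Finset.card_bij (fun k hk => (Finset.mem_filter.1 hk).2.choose) ?_ ?_ ?_
    · intro k hk
      have := (Finset.mem_filter.1 hk).2.choose_spec
      exact Finset.mem_filter.2 ⟨Finset.mem_univ _, this.2, k, this.1⟩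
    · intro k hk k' hk' h
      have h1 := (Finset.mem_filter.1 hk).2.choose_spec
      have h2 := (Finset.mem_filter.1 hk').2.choose_spec
      rw [← h] at h2
      exact maps_injective τ h1.1 h2.1
    · intro b hb
      obtain ⟨-, hb1, k, hk⟩ := Finset.mem_filter.1 hb
      have hk' : k ∈ Finset.univ.filter fun k : Fin N => ∃ c, τ.1 k = some c ∧ c < enumJ1 τ a :=
        Finset.mem_filter.2 ⟨Finset.mem_univ _, b, hk, hb1⟩
      refine ⟨k, hk', ?_⟩
      have := (Finset.mem_filter.1 hk').2.choose_spec
      exact Option.some.inj (this.1.symm.trans hk)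
  · refine Finset.disjoint_left.2 fun p hp hp' => ?_
    obtain ⟨k, -, rfl⟩ := Finset.mem_image.1 hp'
    obtain ⟨-, -, b, c, hb, -⟩ := Finset.mem_filter.1 hp
    exact absurd (h0.symm.trans hb) (by simp)

/-- The shift grows by the index `enumJ1 τ a`, the first particle having index `0`, and the
inversions grow by the number of values below it. The two numbers differ by `a`, so the total sign
is the cofactor sign of row `a` in the expansion of the determinant along its first column. -/
theorem mapSign_fill (a : Fin (n + 1)) :
    mapSign (fill τ h0 a).1 = mapSign τ.1 * (-1) ^ (a : ℕ) := by
  unfold mapSign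
  rw [shift_fill, inversions_fill, zpow_add₀ (by norm_num), zpow_natCast, pow_add,
    ← card_lt_enumJ1 τ a, pow_add]
  generalize (Finset.univ.filter fun b : Fin N => b < enumJ1 τ a ∧ ∃ k, τ.1 k = some b).card = q
  have : ((-1 : ℂ) ^ q) * (-1) ^ q = 1 := by rw [← mul_pow]; simp
  linear_combination (-1 : ℂ) ^ shift τ.1 * (-1) ^ inversions τ.1 * (-1) ^ (a : ℕ) * this

end

/-! ### Analysis of the integrand in the `ζ`-variables -/

section
variable {Δ R : ℝ}

/-- The term `cξζ` dominates: its modulus is at least `4|ζ|`, while `|ξ + ζ| < 2|ζ|`. -/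
theorem link_ne_zero {a z : ℂ} (hcR : 4 < ‖(2 * Δ : ℂ)‖ * R) (ha : ‖a‖ = R) (hz : R < ‖z‖) :
    link (2 * Δ) a z ≠ 0 := by
  intro h
  have h1 : 2 * (Δ : ℂ) * a * z = a + z := by unfold link at h; linear_combination -h
  have h2 := congrArg norm h1
  rw [norm_mul, norm_mul, ha] at h2
  have h3 := norm_add_le a z
  have h4 := norm_nonneg a
  have h5 : 4 * ‖z‖ ≤ ‖(2 * Δ : ℂ)‖ * R * ‖z‖ := by gcongr
  linarith

theorem one_sub_mul_ne_zero {a z : ℂ} (hR : 1 < R) (ha : ‖a‖ = R) (hz : R < ‖z‖) :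
    1 - a * z ≠ 0 := by
  intro h
  have h1 : a * z = 1 := by linear_combination -h
  have h2 := congrArg norm h1
  rw [norm_mul, ha, norm_one] at h2
  nlinarith

theorem add_sub_ne_zero {c a z : ℂ} (ha : ‖a‖ = R) (hz : R + ‖c‖ < ‖z‖) : a + z - c ≠ 0 := by
  intro h
  have h1 : z = c - a := by linear_combination h
  have h2 := norm_sub_le c a
  rw [← h1] at h2
  linarith

/-- Here `|ξζ| < 1`, so `cξζ` and `ζ` together have modulus below `|c| + 1 < |ξ|`. -/
theorem link_ne_zero_of_small {c a z : ℂ} (hR : 1 + ‖c‖ < R) (ha : ‖a‖ = R) (hz : ‖z‖ < R⁻¹) :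
    link c a z ≠ 0 := by
  intro h
  have hc := norm_nonneg c
  have hR0 : 0 < R := by linarith
  have h1 : a = c * (a * z) - z := by unfold link at h; linear_combination h
  have h2 := norm_sub_le (c * (a * z)) z
  rw [← h1, ha, norm_mul, norm_mul, ha] at h2
  have h3 : R * ‖z‖ < 1 := by
    calc R * ‖z‖ < R * R⁻¹ := by gcongr
      _ = 1 := by field_simp
  have h4 : ‖c‖ * (R * ‖z‖) ≤ ‖c‖ * 1 := by gcongr
  have h5 : ‖z‖ ≤ R * ‖z‖ := le_mul_of_one_le_left (norm_nonneg z) (by linarith)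
  linarith

theorem one_sub_mul_ne_zero_of_small {a z : ℂ} (hR : 0 < R) (ha : ‖a‖ = R) (hz : ‖z‖ < R⁻¹) :
    1 - a * z ≠ 0 := by
  intro h
  have h1 : a * z = 1 := by linear_combination -h
  have h2 := congrArg norm h1
  rw [norm_mul, ha, norm_one] at h2
  have h3 : R * ‖z‖ < R * R⁻¹ := by gcongr
  rw [mul_inv_cancel₀ hR.ne'] at h3
  linarith

end

section
variable {E : Type*} [NormedAddCommGroup E] [NormedSpace ℂ E] {s : Set E} {N n : ℕ} {Δ R : ℝ}

theorem detJK_differentiableOn {u v : E → Fin n → ℂ} (hu : DifferentiableOn ℂ u s)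
    (hv : DifferentiableOn ℂ v s) (h1 : ∀ e ∈ s, ∀ a b, 1 - u e a * v e b ≠ 0)
    (h2 : ∀ e ∈ s, ∀ a b, link (2 * Δ) (u e a) (v e b) ≠ 0) :
    DifferentiableOn ℂ (fun e => detJK Δ (u e) (v e)) s := by
  rw [differentiableOn_pi] at hu hv
  unfold detJK
  simp_rw [Matrix.det_apply']
  refine DifferentiableOn.fun_sum fun σ _ => DifferentiableOn.fun_mul
    (differentiableOn_const _) (differentiableOn_prod fun b _ => ?_)
  simp only [Matrix.of_apply, dFun]
  have ha := hu (σ b)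
  have hb := hv b
  refine differentiableOn_div (differentiableOn_const _) ?_
    fun e he => mul_ne_zero (h1 e he _ _) (h2 e he _ _)
  fun_prop

theorem link_differentiableOn {c : ℂ} {u v : E → ℂ} (hu : DifferentiableOn ℂ u s)
    (hv : DifferentiableOn ℂ v s) : DifferentiableOn ℂ (fun e => link c (u e) (v e)) s := by
  unfold link
  fun_prop

theorem amp_differentiableOn (τ : maps N n) {ξ : E → Fin N → ℂ} {ζ : E → Fin n → ℂ}
    (hξ : DifferentiableOn ℂ ξ s) (hζ : DifferentiableOn ℂ ζ s)
    (h1 : ∀ e ∈ s, ∀ i j, scat (2 * Δ) (ξ e i) (ξ e j) ≠ 0)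
    (h2 : ∀ e ∈ s, ∀ k b, k < enumK1 τ b → ∀ a, ξ e a + ζ e b - 2 * Δ ≠ 0) (k : Fin N) :
    DifferentiableOn ℂ (fun e => amp Δ τ (ξ e) (ζ e) k) s := by
  rw [differentiableOn_pi] at hξ hζ
  unfold amp
  cases hk : τ.1 k with
  | none => simp
  | some a =>
    simp only [Option.elim_some, ampSome]
    have ha := hξ a
    refine DifferentiableOn.fun_mul (differentiableOn_prod fun j _ => ?_)
      (differentiableOn_prod fun b hb => ?_)
    · have hj := hξ j
      refine differentiableOn_div ?_ ?_ fun e he => h1 e he a j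
      · unfold scat; fun_prop
      · unfold scat; fun_prop
    · have hb' := hζ b
      refine differentiableOn_div (link_differentiableOn ha hb') (by fun_prop) fun e he =>
        h2 e he k b (Finset.mem_filter.1 hb).2 a

/-- Stated for `ξ` and `ζ` depending on a common parameter. It serves both for deforming `ζ` at
fixed `ξ` and for joint continuity on the product of tori. -/
theorem core_differentiableOn (x : ℤ) (τ : maps N n) (Y : Fin N → ℤ) {ξ : E → Fin N → ℂ}
    {ζ : E → Fin n → ℂ} (hξ : DifferentiableOn ℂ ξ s) (hζ : DifferentiableOn ℂ ζ s)
    (hR : 1 + ‖(2 * Δ : ℂ)‖ < R) (hcR : 4 < ‖(2 * Δ : ℂ)‖ * R)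
    (h1 : ∀ e ∈ s, ∀ j, ‖ξ e j‖ = R) (h2 : ∀ e ∈ s, ∀ b, R + ‖(2 * Δ : ℂ)‖ + 1 < ‖ζ e b‖) :
    DifferentiableOn ℂ (fun e => core Δ x τ (ξ e) (ζ e) Y) s := by
  have hc := norm_nonneg (2 * Δ : ℂ)
  have hξ' := hξ
  have hζ' := hζ
  rw [differentiableOn_pi] at hξ' hζ'
  have hξl : ∀ e ∈ s, ∀ j, 1 + ‖(2 * Δ : ℂ)‖ < ‖ξ e j‖ := fun e he j => by rw [h1 e he]; exact hR
  have hζl : ∀ e ∈ s, ∀ b, 1 + ‖(2 * Δ : ℂ)‖ < ‖ζ e b‖ := fun e he b => by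
    have := h2 e he b
    linarith
  have hζR : ∀ e ∈ s, ∀ b, R < ‖ζ e b‖ := fun e he b => by
    have := h2 e he b
    linarith
  unfold core coefI
  refine ((((DifferentiableOn.fun_mul (differentiableOn_div ?_ ?_ ?_) ?_).fun_mul ?_).fun_mul
    ?_).fun_mul ?_)
  · refine DifferentiableOn.fun_mul (DifferentiableOn.fun_mul (differentiableOn_const _)
      (differentiableOn_prod fun a _ => differentiableOn_prod fun b _ =>
        link_differentiableOn (hξ' _) (hζ' b)))
      (detJK_differentiableOn (differentiableOn_pi.2 fun a => hξ' _) hζ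
        (fun e he a b => one_sub_mul_ne_zero (by linarith) (h1 e he _) (hζR e he b))
        fun e he a b => link_ne_zero hcR (h1 e he _) (hζR e he b))
  · refine DifferentiableOn.fun_mul ?_ ?_
    · exact (differentiable_scatProd_comp _ _).differentiableOn.comp hξ fun e _ => mem_univ _
    · exact (differentiable_scatProd _).differentiableOn.comp hζ fun e _ => mem_univ _
  · exact fun e he => mul_ne_zero (scatProd_ne_zero fun a => hξl e he _)
      (scatProd_ne_zero fun b => hζl e he b)
  · exact differentiableOn_prod fun a _ => differentiableOn_zpow (hξ' _)
      (Or.inl fun e he => ne_zero_of_large (hξl e he _))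
  · exact differentiableOn_prod fun b _ => differentiableOn_zpow (hζ' _)
      (Or.inl fun e he => ne_zero_of_large (hζl e he _))
  · exact differentiableOn_prod fun k _ => amp_differentiableOn τ hξ hζ
      (fun e he i j => scat_ne_zero (hξl e he i) (hξl e he j))
      (fun e he k b _ a => add_sub_ne_zero (h1 e he a) (by have := h2 e he b; linarith)) k
  · refine differentiableOn_prod fun k _ => ?_
    cases hk : τ.1 k with
    | none => simp
    | some a =>
      simp only [Option.elim_some]
      exact differentiableOn_zpow (hξ' a) (Or.inl fun e he => ne_zero_of_large (hξl e he _))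

end

section
variable {N n : ℕ} {Δ R : ℝ}

theorem link_update_isBigO (c a : ℂ) {ι : Type*} [DecidableEq ι] (y : ι → ℂ) (k b : ι) :
    (fun w => link c a (Function.update y k w b)) =O[Bornology.cobounded ℂ]
      fun w => w ^ (if b = k then (1 : ℤ) else 0) := by
  unfold link
  by_cases hb : b = k
  · subst hb
    simp only [Function.update_self, if_true]
    exact (isBigO_affine (1 - c * a) a).congr_left fun w => by ring
  · simp only [Function.update_of_ne hb, hb, if_false]
    exact isBigO_const_zpow _

theorem dFun_update_isBigO {a : ℂ} (ha : a ≠ 0) (hca : 1 - 2 * (Δ : ℂ) * a ≠ 0) {ι : Type*}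
    [DecidableEq ι] (y : ι → ℂ) (k b : ι) :
    (fun w => dFun Δ a (Function.update y k w b)) =O[Bornology.cobounded ℂ]
      fun w => w ^ (if b = k then (-2 : ℤ) else 0) := by
  unfold dFun
  by_cases hb : b = k
  · subst hb
    simp only [Function.update_self, if_true]
    have h := isBigO_mul_zpow (isBigO_affine_inv (neg_ne_zero.2 ha) 1) (isBigO_affine_inv hca a)
    refine h.congr_left fun w => ?_
    rw [one_div, mul_inv]
    congr 2 <;> ring
  · simp only [Function.update_of_ne hb, hb, if_false]
    exact isBigO_const_zpow _

theorem isBigO_inv_shift (c : ℂ) :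
    (fun w : ℂ => (c - w)⁻¹) =O[Bornology.cobounded ℂ] fun w => w ^ (0 : ℤ) :=
  isBigO_zpow_of_le (by simpa using isBigO_inv_zpow c 1) (by norm_num : (-1 : ℤ) ≤ 0)

theorem link_inv_isBigO (c a : ℂ) :
    (fun w => link c a (c - w)⁻¹) =O[Bornology.cobounded ℂ] fun w => w ^ (0 : ℤ) := by
  unfold link
  exact ((isBigO_const_zpow a).add (isBigO_inv_shift c)).sub
    ((isBigO_inv_shift c).const_mul_left (c * a))

/-- As `w → ∞` the argument `1 / (c - w)` tends to `0` and `d(a, ·)` tends to the finite value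
`1/a`. -/
theorem dFun_inv_isBigO {a : ℂ} (ha : a ≠ 0) :
    (fun w => dFun Δ a (2 * Δ - w)⁻¹) =O[Bornology.cobounded ℂ] fun w => w ^ (0 : ℤ) := by
  set c : ℂ := 2 * Δ with hc
  have h1 := isBigO_mul_zpow (isBigO_affine (-1) c)
    (isBigO_affine_inv (a := -1) (by norm_num) (c - a))
  have h2 := isBigO_mul_zpow (isBigO_affine (-1) c) (isBigO_affine_inv (neg_ne_zero.2 ha) 1)
  refine EventuallyEq.trans_isBigO ?_ (isBigO_mul_zpow h1 h2)
  filter_upwards [eventually_ne_cobounded c] with w hw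
  have hcw : c - w ≠ 0 := sub_ne_zero.2 hw.symm
  have e1 : 1 - a * (c - w)⁻¹ = (-1 * w + (c - a)) / (-1 * w + c) := by
    rw [show -1 * w + c = c - w by ring, eq_div_iff hcw]
    linear_combination -a * inv_mul_cancel₀ hcw
  have e2 : a + (c - w)⁻¹ - c * a * (c - w)⁻¹ = (-a * w + 1) / (-1 * w + c) := by
    rw [show -1 * w + c = c - w by ring, eq_div_iff hcw]
    linear_combination (1 - c * a) * inv_mul_cancel₀ hcw
  rw [dFun, ← hc, e1, e2, one_div, mul_inv, inv_div, inv_div, div_eq_mul_inv, div_eq_mul_inv]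

theorem detJK_isBigO {u : Fin n → ℂ} {v : ℂ → Fin n → ℂ} {e : Fin n → ℤ}
    (h : ∀ a b, (fun w => dFun Δ (u a) (v w b)) =O[Bornology.cobounded ℂ] fun w => w ^ e b) :
    (fun w => detJK Δ u (v w)) =O[Bornology.cobounded ℂ] fun w => w ^ ∑ b, e b := by
  unfold detJK
  simp_rw [Matrix.det_apply']
  refine IsBigO.fun_sum fun σ _ => ?_
  have h1 : (fun w => ∏ b, dFun Δ (u (σ b)) (v w b)) =O[Bornology.cobounded ℂ]
      fun w => w ^ ∑ b, e b := isBigO_prod_zpow fun b _ => h (σ b) b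
  exact h1.const_mul_left _

theorem amp_isBigO (τ : maps N n) (ξ : Fin N → ℂ) {v : ℂ → Fin n → ℂ}
    (h : ∀ k b, k < enumK1 τ b → ∀ a, (fun w => link (2 * Δ) (ξ a) (v w b) /
      (ξ a + v w b - 2 * Δ)) =O[Bornology.cobounded ℂ] fun w => w ^ (0 : ℤ)) :
    (fun w => ∏ k, amp Δ τ ξ (v w) k) =O[Bornology.cobounded ℂ] fun w => w ^ (0 : ℤ) := by
  have h1 : ∀ k, (fun w => amp Δ τ ξ (v w) k) =O[Bornology.cobounded ℂ] fun w => w ^ (0 : ℤ) := by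
    intro k
    unfold amp
    cases hk : τ.1 k with
    | none => simpa using isBigO_const_zpow 1
    | some a =>
      simp only [Option.elim_some, ampSome]
      refine IsBigO.const_mul_left ?_ _
      have := isBigO_prod_zpow (e := fun _ => 0)
        (s := Finset.univ.filter (fun b : Fin n => k < enumK1 τ b))
        fun b hb => h k b (Finset.mem_filter.1 hb).2 a
      simpa using this
  have := isBigO_prod_zpow (s := Finset.univ) (e := fun _ => 0) fun k _ => h1 k
  simpa using this

theorem link_div_update_isBigO (c a : ℂ) {ι : Type*} [DecidableEq ι] (y : ι → ℂ) (k b : ι) :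
    (fun w => link c a (Function.update y k w b) / (a + Function.update y k w b - c))
      =O[Bornology.cobounded ℂ] fun w => w ^ (0 : ℤ) := by
  by_cases hb : b = k
  · subst hb
    have h1 := link_update_isBigO c a y b b
    simp only [Function.update_self, if_true] at h1 ⊢
    have := isBigO_mul_zpow h1 (isBigO_affine_inv (one_ne_zero) (a - c))
    refine this.congr_left fun w => ?_
    rw [div_eq_mul_inv]
    congr 2
    ring
  · simp only [Function.update_of_ne hb]
    exact isBigO_const_zpow _

theorem one_sub_ne_zero_of_large {a : ℂ} (hcR : 4 < ‖(2 * Δ : ℂ)‖ * R) (ha : ‖a‖ = R) :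
    1 - 2 * (Δ : ℂ) * a ≠ 0 := by
  intro h
  have h1 : 2 * (Δ : ℂ) * a = 1 := by linear_combination -h
  have h2 := congrArg norm h1
  rw [norm_mul, ha, norm_one] at h2
  linarith

variable {ξ : Fin N → ℂ} {R' : ℝ}

theorem core_differentiableOn_right (hR : 1 + ‖(2 * Δ : ℂ)‖ < R) (hcR : 4 < ‖(2 * Δ : ℂ)‖ * R)
    (hξ : ∀ j, ‖ξ j‖ = R) (x : ℤ) (τ : maps N n) (Y : Fin N → ℤ) :
    DifferentiableOn ℂ (fun ζ => core Δ x τ ξ ζ Y)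
      {ζ | ∀ b, R + ‖(2 * Δ : ℂ)‖ + 1 < ‖ζ b‖} :=
  core_differentiableOn x τ Y (differentiableOn_const _) differentiableOn_id hR hcR
    (fun _ _ => hξ) fun _ he => he

theorem continuous_core_torus (hR : 1 + ‖(2 * Δ : ℂ)‖ < R) (hcR : 4 < ‖(2 * Δ : ℂ)‖ * R)
    (hξ : ∀ j, ‖ξ j‖ = R) (x : ℤ) (τ : maps N n) (Y : Fin N → ℤ) {ρ : Fin n → ℝ}
    (hρ : ∀ b, R + ‖(2 * Δ : ℂ)‖ + 1 < ρ b) :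
    Continuous fun θ => core Δ x τ ξ (torusMap 0 ρ θ) Y := by
  refine (core_differentiableOn_right hR hcR hξ x τ Y).continuousOn.comp_continuous
    (continuous_torusMap _) fun θ b => ?_
  rw [torusMap_mem fun b => ?_]
  · exact hρ b
  · have := hρ b
    have := norm_nonneg (2 * Δ : ℂ)
    linarith

/-- If all particles start at sites `≥ x`, only the maps without zeros contribute. -/
theorem torusIntegral_core_eq_zero (hR : 1 + ‖(2 * Δ : ℂ)‖ < R) (hcR : 4 < ‖(2 * Δ : ℂ)‖ * R)
    (hξ : ∀ j, ‖ξ j‖ = R) (hR' : R + ‖(2 * Δ : ℂ)‖ + 1 < R') {x : ℤ} (τ : maps N (n + 1))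
    {Y : Fin N → ℤ} (hY : ∀ k, x ≤ Y k) :
    torusIntegral (fun ζ => core Δ x τ ξ ζ Y) 0 (fun _ => R') = 0 := by
  have hc := norm_nonneg (2 * Δ : ℂ)
  have hR0 : 0 < R' := by linarith
  have hξ0 : ∀ j, ξ j ≠ 0 := fun j =>
    ne_zero_of_large (c := 2 * Δ) (by rw [hξ]; exact hR)
  rw [torusIntegral_succAbove' (torusIntegrable_of_continuous
    (continuous_core_torus hR hcR hξ x τ Y fun _ => hR')) 0]
  refine torusIntegral_eq_zero (fun _ => hR0) fun y hy => ?_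
  have hmem : ∀ w : ℂ, R + ‖(2 * Δ : ℂ)‖ + 1 < ‖w‖ → ∀ j,
      R + ‖(2 * Δ : ℂ)‖ + 1 < ‖((0 : Fin (n + 1)).insertNth w y : Fin (n + 1) → ℂ) j‖ := by
    intro w hw j
    refine Fin.succAboveCases 0 ?_ (fun j => ?_) j
    · simpa using hw
    · rw [Fin.insertNth_apply_succAbove, hy]
      exact hR'
  refine circleIntegral_eq_zero_of_isBigO (r := R + ‖(2 * Δ : ℂ)‖ + 1) (by linarith) hR' ?_ ?_
  · exact (core_differentiableOn_right hR hcR hξ x τ Y).comp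
      (differentiable_insertNth 0 y).differentiableOn fun w hw => hmem w hw
  · have hy' := hmem R' (by simpa [abs_of_pos hR0] using hR')
    set z : Fin (n + 1) → ℂ := (0 : Fin (n + 1)).insertNth (R' : ℂ) y with hz
    have e : ∀ w : ℂ, ((0 : Fin (n + 1)).insertNth w y : Fin (n + 1) → ℂ) =
        Function.update z 0 w := fun w => insertNth_eq_update 0 (R' : ℂ) w y
    simp_rw [e]
    have h1 : (fun w => ∏ a, ∏ b, link (2 * Δ) (ξ (enumJ1 τ a)) (Function.update z 0 w b))
        =O[Bornology.cobounded ℂ] fun w => w ^ ((n : ℤ) + 1) := by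
      have := isBigO_prod_zpow (s := Finset.univ) fun (a : Fin (n + 1)) _ =>
        isBigO_prod_zpow (s := Finset.univ) fun b _ =>
          link_update_isBigO (2 * Δ) (ξ (enumJ1 τ a)) z 0 b
      simpa using this
    have h2 : (fun w => detJK Δ (fun a => ξ (enumJ1 τ a)) (Function.update z 0 w))
        =O[Bornology.cobounded ℂ] fun w => w ^ (-2 : ℤ) := by
      have := detJK_isBigO (Δ := Δ) (u := fun a => ξ (enumJ1 τ a))
        (v := fun w => Function.update z 0 w) fun a b =>
          dFun_update_isBigO (hξ0 _) (one_sub_ne_zero_of_large hcR (hξ _)) z 0 b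
      simpa using this
    have h3 := scatProd_update_inv_isBigO (c := 2 * Δ) (y := z)
      (fun k => by have := hy' k; linarith) 0
    have h4 : (fun w => ∏ b, Function.update z 0 w b ^ (x - Y (enumK1 τ b) - 1))
        =O[Bornology.cobounded ℂ] fun w => w ^ (x - Y (enumK1 τ 0) - 1) := by
      have := isBigO_prod_zpow (s := Finset.univ) fun b _ =>
        isBigO_zpow_update z 0 b (x - Y (enumK1 τ b) - 1)
      simpa using this
    have h5 := amp_isBigO (Δ := Δ) τ ξ (v := fun w => Function.update z 0 w)
      fun k b _ a => link_div_update_isBigO (2 * Δ) (ξ a) z 0 b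
    have h6 := isBigO_mul_zpow (isBigO_mul_zpow (isBigO_mul_zpow (isBigO_mul_zpow h1 h2) h3) h4) h5
    have h7 := h6.const_mul_left (mapSign τ.1 *
      (scatProd (2 * Δ) fun a => ξ (enumJ1 τ a))⁻¹ * (∏ a, ξ (enumJ1 τ a) ^ x) *
      ∏ k, (τ.1 k).elim 1 fun a => ξ a ^ Y k)
    -- The exponents are `n + 1` from the links, `-2` from the determinant, `-n` from the scattering
    -- factors and `x - Y k - 1 ≤ -1` from the wave: at most `-2` in total.
    refine (isBigO_zpow_of_le h7 ?_).congr_left fun w => ?_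
    · have := hY (enumK1 τ 0)
      push_cast
      omega
    · rw [core, coefI, div_eq_mul_inv, mul_inv]
      ring

end

/-! ### Splitting off the first `ζ`-variable -/

theorem prod_Ioi_succAbove {M : Type*} [CommMonoid M] {m : ℕ} (f : Fin (m + 1) → Fin (m + 1) → M)
    (a : Fin (m + 1)) :
    ∏ i, ∏ j ∈ Finset.Ioi i, f i j =
      (∏ b : Fin m, if a < a.succAbove b then f a (a.succAbove b) else f (a.succAbove b) a) *
        ∏ i, ∏ j ∈ Finset.Ioi i, f (a.succAbove i) (a.succAbove j) := by
  have key : ∀ {n : ℕ} (g : Fin n → Fin n → M), ∏ i, ∏ j ∈ Finset.Ioi i, g i j =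
      ∏ i, ∏ j, if i < j then g i j else 1 := by
    intro n g
    refine Finset.prod_congr rfl fun i _ => ?_
    rw [← Finset.prod_filter]
    congr 1
    ext j
    simp
  rw [key, key, Fin.prod_univ_succAbove _ a, Fin.prod_univ_succAbove _ a, if_neg (lt_irrefl a),
    one_mul]
  simp_rw [Fin.prod_univ_succAbove _ a]
  rw [Finset.prod_mul_distrib, ← mul_assoc, ← Finset.prod_mul_distrib]
  congr 1
  · refine Finset.prod_congr rfl fun b _ => ?_
    rcases lt_or_gt_of_ne (Fin.succAbove_ne a b) with h | h
    · rw [if_neg h.not_gt, if_pos h, one_mul, if_neg h.not_gt]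
    · rw [if_pos h, if_neg h.not_gt, mul_one, if_pos h]
  · refine Finset.prod_congr rfl fun i _ => Finset.prod_congr rfl fun j _ => ?_
    simp only [(Fin.strictMono_succAbove a).lt_iff_lt]

/-- Removing `u a` from `scatProd c u`: for indices before `a` the factor cancels, for indices after
`a` it leaves the ratio of the two orders. This ratio is the one in the amplitude of a newly filled
particle. -/
theorem prod_scat_div_scatProd {m : ℕ} {c : ℂ} {u : Fin (m + 1) → ℂ} (hu : ∀ k, 1 + ‖c‖ < ‖u k‖)
    (a : Fin (m + 1)) :
    (∏ b : Fin m, scat c (u (a.succAbove b)) (u a)) / scatProd c u =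
      (∏ b : Fin m, if a < a.succAbove b then
        scat c (u (a.succAbove b)) (u a) / scat c (u a) (u (a.succAbove b)) else 1) /
        scatProd c (fun b => u (a.succAbove b)) := by
  have h1 := scatProd_ne_zero hu
  have h2 := scatProd_ne_zero (c := c) (y := fun b => u (a.succAbove b)) fun b => hu _
  have h3 : scatProd c u = _ := prod_Ioi_succAbove (fun i j => scat c (u i) (u j)) a
  rw [div_eq_div_iff h1 h2, h3, ← mul_assoc, ← Finset.prod_mul_distrib]
  congr 1
  refine Finset.prod_congr rfl fun b _ => ?_
  split_ifs with h
  · rw [div_mul_cancel₀ _ (scat_ne_zero (hu _) (hu _))]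
  · rw [one_mul]

section
variable {N m : ℕ} [NeZero N] (Δ : ℝ) (x : ℤ) (τ : maps N (m + 1))
  (ξ : Fin N → ℂ) (y : Fin m → ℂ)

/-- The factor of the integrand that does not depend on the first `ζ`-variable. -/
def coreTail (Y : Fin N → ℤ) : ℂ :=
  mapSign τ.1 * (∏ a, ∏ b, link (2 * Δ) (ξ (enumJ1 τ a)) (y b)) /
    (scatProd (2 * Δ) (fun a => ξ (enumJ1 τ a)) * scatProd (2 * Δ) y) *
    (∏ a, ξ (enumJ1 τ a) ^ x) * (∏ b : Fin m, y b ^ (x - Y (enumK1 τ b.succ) - 1)) *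
    (∏ k, amp Δ τ ξ (Fin.cons 0 y) k) * ∏ k, (τ.1 k).elim 1 fun a => ξ a ^ Y k

/-- The variable at the first particle never enters an amplitude, since no particle precedes the
first; the value `0` in `coreTail` is only a placeholder. -/
theorem amp_cons (h0 : τ.1 0 = none) (w : ℂ) (k : Fin N) :
    amp Δ τ ξ (Fin.cons w y) k = amp Δ τ ξ (Fin.cons 0 y) k := by
  unfold amp ampSome
  cases τ.1 k with
  | none => rfl
  | some a =>
    simp only [Option.elim_some]
    congr 1
    refine Finset.prod_congr rfl fun b hb => ?_
    refine Fin.cases (fun hb => ?_) (fun b _ => ?_) b hb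
    · have := (Finset.mem_filter.1 hb).2
      rw [enumK1_zero τ h0] at this
      exact absurd this (not_lt.2 (Fin.zero_le k))
    · simp

theorem core_cons (h0 : τ.1 0 = none) (w : ℂ) (Y : Fin N → ℤ) :
    core Δ x τ ξ (Fin.cons w y) Y = coreTail Δ x τ ξ y Y * w ^ (x - Y 0 - 1) *
      ((∏ a, link (2 * Δ) (ξ (enumJ1 τ a)) w) *
        detJK Δ (fun a => ξ (enumJ1 τ a)) (Fin.cons w y)) /
      ∏ k, scat (2 * Δ) w (y k) := by
  have h1 : ∏ a, ∏ b, link (2 * Δ) (ξ (enumJ1 τ a)) ((Fin.cons w y : Fin (m + 1) → ℂ) b) =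
      (∏ a, link (2 * Δ) (ξ (enumJ1 τ a)) w) * ∏ a, ∏ b, link (2 * Δ) (ξ (enumJ1 τ a)) (y b) := by
    rw [← Finset.prod_mul_distrib]
    refine Finset.prod_congr rfl fun a _ => ?_
    rw [Fin.prod_univ_succ]
    simp
  have h2 : ∏ b, (Fin.cons w y : Fin (m + 1) → ℂ) b ^ (x - Y (enumK1 τ b) - 1) =
      w ^ (x - Y 0 - 1) * ∏ b : Fin m, y b ^ (x - Y (enumK1 τ b.succ) - 1) := by
    rw [Fin.prod_univ_succ]
    simp [enumK1_zero τ h0]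
  rw [core, coefI, coreTail, h1, h2, scatProd_succ _ (Fin.cons w y)]
  simp_rw [amp_cons Δ τ ξ y h0 w]
  simp only [Fin.cons_zero, Fin.cons_succ]
  simp only [div_eq_mul_inv, mul_inv]
  ring

theorem detJK_cons (u : Fin (m + 1) → ℂ) (w : ℂ) :
    detJK Δ u (Fin.cons w y) =
      ∑ a : Fin (m + 1), (-1) ^ (a : ℕ) * dFun Δ (u a) w * detJK Δ (fun b => u (a.succAbove b)) y := by
  unfold detJK
  rw [Matrix.det_succ_column_zero]
  refine Finset.sum_congr rfl fun a _ => ?_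
  simp only [Matrix.of_apply, Fin.cons_zero]
  congr 1

/-- The regular part of the summand with the pole at `ζ = 1 / ξ_a`. -/
def corePole (Y : Fin N → ℤ) (a : Fin (m + 1)) (w : ℂ) : ℂ :=
  -(coreTail Δ x τ ξ y Y * (ξ (enumJ1 τ a))⁻¹ * (-1) ^ (a : ℕ) *
    detJK Δ (fun b => ξ (enumJ1 τ (a.succAbove b))) y) * w ^ (x - Y 0 - 1) *
    (∏ b, link (2 * Δ) (ξ (enumJ1 τ (a.succAbove b))) w) / ∏ k, scat (2 * Δ) w (y k)

/-- Expanding the determinant along its first column pairs each `d(ξ_a, w)` with its link factor,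
and the product is `1 / (1 - ξ_a w)`. The apparent poles at zeros of the links thus disappear, and
each summand has a simple pole at `1/ξ_a` besides the scattering denominators and the power of `w`.
-/
theorem core_cons_eq_sum (h0 : τ.1 0 = none) {w : ℂ} (Y : Fin N → ℤ) (hξ : ∀ j, ξ j ≠ 0)
    (hl : ∀ j, link (2 * Δ) (ξ j) w ≠ 0) (hw : ∀ j, 1 - ξ j * w ≠ 0) :
    core Δ x τ ξ (Fin.cons w y) Y =
      ∑ a, corePole Δ x τ ξ y Y a w / (w - (ξ (enumJ1 τ a))⁻¹) := by
  rw [core_cons Δ x τ ξ y h0, detJK_cons, Finset.mul_sum, Finset.mul_sum, Finset.sum_div]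
  refine Finset.sum_congr rfl fun a _ => ?_
  rw [corePole, Fin.prod_univ_succAbove _ a]
  have h1 := hξ (enumJ1 τ a)
  have h2 := hl (enumJ1 τ a)
  have h3 := hw (enumJ1 τ a)
  have e : (w - (ξ (enumJ1 τ a))⁻¹)⁻¹ = -ξ (enumJ1 τ a) * (1 - ξ (enumJ1 τ a) * w)⁻¹ := by
    have h4 : w - (ξ (enumJ1 τ a))⁻¹ = -(1 - ξ (enumJ1 τ a) * w) * (ξ (enumJ1 τ a))⁻¹ := by
      field_simp
      ring
    rw [h4, mul_inv, inv_inv, inv_neg]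
    ring
  have e2 : link (2 * Δ) (ξ (enumJ1 τ a)) w * dFun Δ (ξ (enumJ1 τ a)) w =
      (1 - ξ (enumJ1 τ a) * w)⁻¹ := by
    unfold dFun
    rw [show ξ (enumJ1 τ a) + w - 2 * Δ * ξ (enumJ1 τ a) * w =
      link (2 * Δ) (ξ (enumJ1 τ a)) w from rfl]
    field_simp
  rw [div_eq_mul_inv _ (w - _), e]
  simp only [div_eq_mul_inv]
  have e3 : (ξ (enumJ1 τ a))⁻¹ * ξ (enumJ1 τ a) = 1 := inv_mul_cancel₀ h1
  generalize link (2 * Δ) (ξ (enumJ1 τ a)) w = q1 at *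
  generalize dFun Δ (ξ (enumJ1 τ a)) w = q2 at *
  rw [← e2]
  linear_combination (-(coreTail Δ x τ ξ y Y * (-1) ^ (a : ℕ) *
    detJK Δ (fun b => ξ (enumJ1 τ (a.succAbove b))) y * w ^ (x - Y 0 - 1) *
    (∏ b, link (2 * Δ) (ξ (enumJ1 τ (a.succAbove b))) w) * (∏ k, scat (2 * Δ) w (y k))⁻¹ *
    (q1 * q2))) * e3

/-- No value of `τ` is taken at the first particle, so the indices not used by later particles are
precisely the elements of `J_1`. -/
theorem prod_filter_beyond (h0 : τ.1 0 = none) (a : Fin (m + 1)) (g : Fin N → ℂ) :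
    ∏ j ∈ (Finset.Ioi (enumJ1 τ a)).filter (fun j => ∀ k', 0 < k' →
      (fill τ h0 a).1 k' ≠ some j), g j =
      ∏ b : Fin m, if a < a.succAbove b then g (enumJ1 τ (a.succAbove b)) else 1 := by
  have h1 : (Finset.Ioi (enumJ1 τ a)).filter (fun j => ∀ k', 0 < k' →
      (fill τ h0 a).1 k' ≠ some j) =
      (Finset.univ.map (enumJ1 τ).toEmbedding).filter fun j => enumJ1 τ a < j := by
    rw [image_enumJ1]
    ext j
    simp only [Finset.mem_filter, Finset.mem_Ioi, Finset.mem_univ, true_and]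
    rw [and_comm]
    refine and_congr_left fun _ => ⟨fun h k => ?_, fun h k hk => ?_⟩
    · by_cases hk : k = 0
      · rw [hk, h0]; simp
      · have := h k (Fin.pos_iff_ne_zero.2 hk)
        rwa [fill_of_ne τ h0 a hk] at this
    · rw [fill_of_ne τ h0 a hk.ne']
      exact h k
  rw [h1, Finset.prod_filter, Finset.prod_map, Fin.prod_univ_succAbove _ a]
  simp

theorem amp_fill_zero (h0 : τ.1 0 = none) (a : Fin (m + 1)) :
    amp Δ (fill τ h0 a) ξ y 0 =
      (∏ b : Fin m, if a < a.succAbove b then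
        scat (2 * Δ) (ξ (enumJ1 τ (a.succAbove b))) (ξ (enumJ1 τ a)) /
          scat (2 * Δ) (ξ (enumJ1 τ a)) (ξ (enumJ1 τ (a.succAbove b))) else 1) *
      ∏ b, link (2 * Δ) (ξ (enumJ1 τ a)) (y b) / (ξ (enumJ1 τ a) + y b - 2 * Δ) := by
  rw [amp, fill_zero, Option.elim_some, ampSome, prod_filter_beyond τ h0 a
    fun j => scat (2 * Δ) (ξ j) (ξ (enumJ1 τ a)) / scat (2 * Δ) (ξ (enumJ1 τ a)) (ξ j)]
  congr 1
  rw [Finset.filter_true_of_mem]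
  intro b _
  rw [enumK1_fill, ← enumK1_zero τ h0]
  exact (enumK1 τ).strictMono (Fin.succ_pos b)

theorem amp_fill_of_ne (h0 : τ.1 0 = none) (a : Fin (m + 1)) {k : Fin N} (hk : k ≠ 0) (w : ℂ) :
    amp Δ (fill τ h0 a) ξ y k = amp Δ τ ξ (Fin.cons w y) k := by
  unfold amp ampSome
  rw [fill_of_ne τ h0 a hk]
  cases τ.1 k with
  | none => rfl
  | some a1 =>
    simp only [Option.elim_some]
    congr 1
    · refine Finset.prod_congr (Finset.filter_congr fun j _ => ?_) fun _ _ => rfl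
      refine forall_congr' fun k' => imp_congr_right fun hk' => ?_
      rw [fill_of_ne τ h0 a ((Fin.zero_le k).trans_lt hk').ne']
    · rw [Finset.prod_filter, Finset.prod_filter, Fin.prod_univ_succ,
        if_neg (by rw [enumK1_zero τ h0]; exact not_lt.2 (Fin.zero_le k)), one_mul]
      refine Finset.prod_congr rfl fun b _ => ?_
      rw [enumK1_fill, Fin.cons_succ]

/-- The residue at `ζ = 1 / ξ_a` is the integrand of the map in which the first particle
gets the momentum `ξ_a`. -/
theorem corePole_inv (h0 : τ.1 0 = none) (Y : Fin N → ℤ) (hξ : ∀ j, 1 + ‖(2 * Δ : ℂ)‖ < ‖ξ j‖)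
    (hy : ∀ b j, ξ j + y b - 2 * Δ ≠ 0) (a : Fin (m + 1)) :
    corePole Δ x τ ξ y Y a (ξ (enumJ1 τ a))⁻¹ = -core Δ x (fill τ h0 a) ξ y Y := by
  set c : ℂ := 2 * Δ with hc
  set z := ξ (enumJ1 τ a) with hz
  have hz0 : z ≠ 0 := ne_zero_of_large (hξ _)
  -- At `ζ = 1/z` a link becomes a scattering factor, and the scattering factors of `ζ` become the
  -- denominators `z + y b - c` of the amplitude of the first particle.
  have h1 : ∏ b : Fin m, link c (ξ (enumJ1 τ (a.succAbove b))) z⁻¹ =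
      (∏ b : Fin m, scat c (ξ (enumJ1 τ (a.succAbove b))) z) * (z ^ m)⁻¹ := by
    rw [← inv_pow, ← Fin.prod_const, ← Finset.prod_mul_distrib]
    refine Finset.prod_congr rfl fun b _ => ?_
    unfold link scat
    field_simp
    ring
  have h2 : ∏ b : Fin m, scat c z⁻¹ (y b) = (∏ b, (z + y b - c)) * (z ^ m)⁻¹ := by
    rw [← inv_pow, ← Fin.prod_const, ← Finset.prod_mul_distrib]
    refine Finset.prod_congr rfl fun b _ => ?_
    unfold scat
    field_simp
  have h3 := prod_scat_div_scatProd (c := c) (u := fun a => ξ (enumJ1 τ a)) (fun k => hξ _) a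
  have h4 : ∏ k, amp Δ (fill τ h0 a) ξ y k = amp Δ (fill τ h0 a) ξ y 0 *
      ∏ k, amp Δ τ ξ (Fin.cons 0 y) k := by
    rw [← Finset.mul_prod_erase _ _ (Finset.mem_univ (0 : Fin N)),
      ← Finset.mul_prod_erase Finset.univ (fun k => amp Δ τ ξ (Fin.cons 0 y) k)
      (Finset.mem_univ (0 : Fin N)), amp.eq_1 Δ τ ξ (Fin.cons 0 y) 0, h0, Option.elim_none, one_mul]
    congr 1
    refine Finset.prod_congr rfl fun k hk => ?_
    rw [amp_fill_of_ne Δ τ ξ y h0 a (Finset.ne_of_mem_erase hk) 0]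
  have h5 : ∏ k, ((fill τ h0 a).1 k).elim 1 (fun a => ξ a ^ Y k) = z ^ Y 0 *
      ∏ k, (τ.1 k).elim 1 fun a => ξ a ^ Y k := by
    rw [← Finset.mul_prod_erase _ _ (Finset.mem_univ (0 : Fin N)),
      ← Finset.mul_prod_erase Finset.univ (fun k => (τ.1 k).elim 1 fun a => ξ a ^ Y k)
      (Finset.mem_univ (0 : Fin N)), h0, fill_zero, Option.elim_none, one_mul, Option.elim_some]
    congr 1
    refine Finset.prod_congr rfl fun k hk => ?_
    rw [fill_of_ne τ h0 a (Finset.ne_of_mem_erase hk)]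
  have h6 : ∏ b, link c z (y b) / (z + y b - c) =
      (∏ b, link c z (y b)) / ∏ b, (z + y b - c) :=
    Finset.prod_div_distrib _ _
  -- The power of `ζ` turns into `z ^ Y 0`, the wave of the filled particle, and removes the factor
  -- `z ^ x` that `z` carried as a member of `J_1`.
  have h7 : z⁻¹ * z⁻¹ ^ (x - Y 0 - 1) = z ^ Y 0 / z ^ x := by
    rw [← zpow_one_add₀ (inv_ne_zero hz0), inv_zpow', ← zpow_sub₀ hz0]
    congr 1
    ring
  have hzx : z ^ x ≠ 0 := zpow_ne_zero _ hz0
  have hzm : z ^ m ≠ 0 := pow_ne_zero _ hz0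
  have hP : ∏ b, (z + y b - c) ≠ 0 := Finset.prod_ne_zero_iff.2 fun b _ => hy b _
  rw [corePole, coreTail, core, coefI, h4, h5, amp_fill_zero, mapSign_fill, ← hc, ← hz, h1, h2, h6,
    Fin.prod_univ_succAbove (fun a' => ∏ b, link c (ξ (enumJ1 τ a')) (y b)) a,
    Fin.prod_univ_succAbove (fun a' => ξ (enumJ1 τ a') ^ x) a, ← hz]
  simp_rw [enumJ1_fill, enumK1_fill]
  generalize (∏ b : Fin m, if a < a.succAbove b then
        scat c (ξ (enumJ1 τ (a.succAbove b))) z /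
          scat c z (ξ (enumJ1 τ (a.succAbove b))) else 1) = q1 at *
  generalize (∏ b : Fin m, scat c (ξ (enumJ1 τ (a.succAbove b))) z) = q2 at *
  generalize scatProd c (fun a => ξ (enumJ1 τ a)) = q3 at *
  generalize scatProd c (fun b => ξ (enumJ1 τ (a.succAbove b))) = q4 at *
  generalize (∏ b, (z + y b - c)) = q5 at *
  generalize z⁻¹ ^ (x - Y 0 - 1) = q6 at *
  have h8 : q6 = z * (z ^ Y 0 / z ^ x) := by
    rw [← h7]
    field_simp
  have h9 : q2 * (z ^ m)⁻¹ / (q5 * (z ^ m)⁻¹) = q2 / q5 := by field_simp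
  have h10 : (z ^ x * (z ^ x)⁻¹) * (z⁻¹ * z) * ((z ^ m)⁻¹ * ((z ^ m)⁻¹)⁻¹) = 1 := by
    rw [mul_inv_cancel₀ hzx, inv_mul_cancel₀ hz0, mul_inv_cancel₀ (inv_ne_zero hzm)]
    ring
  rw [h8]
  simp only [div_eq_mul_inv, mul_inv] at h3 ⊢
  set A := ∏ k, amp Δ τ ξ (Fin.cons 0 y) k
  set E := ∏ k, (τ.1 k).elim 1 fun a => ξ a ^ Y k
  set B := mapSign τ.1 * (∏ b, link c z (y b)) *
    (∏ i, ∏ b, link c (ξ (enumJ1 τ (a.succAbove i))) (y b)) * (scatProd c y)⁻¹ *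
    (∏ i, ξ (enumJ1 τ (a.succAbove i)) ^ x) * (∏ b : Fin m, y b ^ (x - Y (enumK1 τ b.succ) - 1)) *
    A * E * detJK Δ (fun b => ξ (enumJ1 τ (a.succAbove b))) y * z ^ Y 0 * q5⁻¹ *
    (-1) ^ (a : ℕ) with hB
  linear_combination (exp := 1) -B * (q2 * q3⁻¹) * h10 - B * h3

end

/-! ### The first `ζ`-variable on a small circle -/

section
variable {N m : ℕ} {Δ R R' : ℝ} {ξ : Fin N → ℂ}

/-- The integrand without the scattering factors that involve the first `ζ`-variable. -/
def coreRegular (Δ : ℝ) (x : ℤ) (τ : maps N (m + 1)) (ξ : Fin N → ℂ) (Y : Fin N → ℤ)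
    (z : Fin (m + 1) → ℂ) : ℂ :=
  mapSign τ.1 * (∏ a, ∏ b, link (2 * Δ) (ξ (enumJ1 τ a)) (z b)) *
    detJK Δ (fun a => ξ (enumJ1 τ a)) z /
    (scatProd (2 * Δ) (fun a => ξ (enumJ1 τ a)) * scatProd (2 * Δ) fun b : Fin m => z b.succ) *
    (∏ a, ξ (enumJ1 τ a) ^ x) * (∏ b, z b ^ (x - Y (enumK1 τ b) - 1)) *
    (∏ k, amp Δ τ ξ z k) * ∏ k, (τ.1 k).elim 1 fun a => ξ a ^ Y k

theorem core_eq_coreRegular (x : ℤ) (τ : maps N (m + 1)) (Y : Fin N → ℤ)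
    (z : Fin (m + 1) → ℂ) : core Δ x τ ξ z Y =
      coreRegular Δ x τ ξ Y z / ∏ k : Fin m, (1 + z 0 * z k.succ - 2 * Δ * z 0) := by
  rw [core, coefI, coreRegular, scatProd_succ _ z]
  unfold scat
  simp only [div_eq_mul_inv, mul_inv]
  ring

variable [NeZero N]

/-- For `|z_0| < 1/R` neither `1 - ξ z_0` nor a link vanishes, and `x - Y 0 - 1 ≥ 0` excludes a pole
at the origin. Apart from the split-off scattering factors, nothing is singular inside the small
circle. -/
theorem coreRegular_differentiableOn (hR : 1 + ‖(2 * Δ : ℂ)‖ < R) (hcR : 4 < ‖(2 * Δ : ℂ)‖ * R)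
    (hξ : ∀ j, ‖ξ j‖ = R) {x : ℤ} (τ : maps N (m + 1)) (h0 : τ.1 0 = none) {Y : Fin N → ℤ}
    (hY : Y 0 < x) : DifferentiableOn ℂ (coreRegular Δ x τ ξ Y)
      {z | ‖z 0‖ < R⁻¹ ∧ ∀ k : Fin m, R + ‖(2 * Δ : ℂ)‖ + 1 < ‖z k.succ‖} := by
  have hc := norm_nonneg (2 * Δ : ℂ)
  have hξl : ∀ j, 1 + ‖(2 * Δ : ℂ)‖ < ‖ξ j‖ := fun j => by rw [hξ]; exact hR
  have hlink : ∀ z ∈ {z : Fin (m + 1) → ℂ | ‖z 0‖ < R⁻¹ ∧ ∀ k : Fin m,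
      R + ‖(2 * Δ : ℂ)‖ + 1 < ‖z k.succ‖}, ∀ (j : Fin N) b,
      1 - ξ j * z b ≠ 0 ∧ link (2 * Δ) (ξ j) (z b) ≠ 0 := by
    rintro z ⟨hz0, hz⟩ j b
    refine Fin.cases ?_ (fun b => ?_) b
    · exact ⟨one_sub_mul_ne_zero_of_small (by linarith) (hξ j) hz0,
        link_ne_zero_of_small hR (hξ j) hz0⟩
    · have := hz b
      exact ⟨one_sub_mul_ne_zero (by linarith) (hξ j) (by linarith),
        link_ne_zero hcR (hξ j) (by linarith)⟩
  unfold coreRegular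
  refine (((DifferentiableOn.fun_mul (DifferentiableOn.fun_mul (differentiableOn_div ?_ ?_ ?_)
    (differentiableOn_const _)) ?_).fun_mul ?_).fun_mul (differentiableOn_const _))
  · refine DifferentiableOn.fun_mul (DifferentiableOn.fun_mul (differentiableOn_const _)
      (differentiableOn_prod fun a _ => differentiableOn_prod fun b _ =>
        link_differentiableOn (differentiableOn_const _)
          (Differentiable.differentiableOn (by fun_prop))))
      (detJK_differentiableOn (differentiableOn_const _) differentiableOn_id
        (fun e he a b => (hlink e he _ b).1) fun e he a b => (hlink e he _ b).2)
  · exact (differentiableOn_const _).fun_mul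
      (differentiable_scatProd_comp _ _).differentiableOn
  · exact fun z hz => mul_ne_zero (scatProd_ne_zero fun a => hξl _)
      (scatProd_ne_zero fun b => by have := hz.2 b; linarith)
  · refine differentiableOn_prod fun b _ => differentiableOn_zpow
      (Differentiable.differentiableOn (by fun_prop)) ?_
    refine Fin.cases (Or.inr ?_) (fun b => Or.inl fun z hz => ?_) b
    · rw [enumK1_zero τ h0]
      omega
    · exact ne_zero_of_large (c := 2 * Δ) (by have := hz.2 b; linarith)
  · refine differentiableOn_prod fun k _ => amp_differentiableOn τ (differentiableOn_const _)
      differentiableOn_id (fun z _ i j => scat_ne_zero (hξl i) (hξl j)) (fun z hz k b hb a => ?_) k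
    obtain ⟨b, rfl⟩ : ∃ b' : Fin m, b = b'.succ := by
      refine Fin.exists_succ_eq.2 ?_ |>.imp fun _ h => h.symm
      rintro rfl
      rw [enumK1_zero τ h0] at hb
      exact absurd hb (not_lt.2 (Fin.zero_le k))
    exact add_sub_ne_zero (hξ a) (by have := hz.2 b; simp only [id]; linarith)

/-- The first variable is tied to the pole of a scattering factor and tends to `0`. The exponents `m
+ 1`, `-2` and `1 - m` cancel, and the waves leave `Y 0 - Y k < 0` for a later particle `k` of
`K_1`. -/
theorem coreRegular_isBigO (hR : 1 + ‖(2 * Δ : ℂ)‖ < R) (hcR : 4 < ‖(2 * Δ : ℂ)‖ * R)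
    (hξ : ∀ j, ‖ξ j‖ = R) {x : ℤ} (τ : maps N (m + 1)) (h0 : τ.1 0 = none) {Y : Fin N → ℤ}
    (hY : StrictMono Y) {y : Fin m → ℂ} (hy : ∀ k, R + ‖(2 * Δ : ℂ)‖ + 1 < ‖y k‖) (k : Fin m) :
    (fun w => coreRegular Δ x τ ξ Y (Fin.cons (2 * Δ - w)⁻¹ (Function.update y k w)))
      =O[Bornology.cobounded ℂ] fun w => w⁻¹ := by
  have hc := norm_nonneg (2 * Δ : ℂ)
  have hξ0 : ∀ j, ξ j ≠ 0 := fun j =>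
    ne_zero_of_large (c := 2 * Δ) (by rw [hξ]; exact hR)
  set v : ℂ → Fin (m + 1) → ℂ := fun w => Fin.cons (2 * Δ - w)⁻¹ (Function.update y k w)
  have hv0 : ∀ w, v w 0 = (2 * Δ - w)⁻¹ := fun _ => rfl
  have hvs : ∀ w b, v w (Fin.succ b) = Function.update y k w b := fun _ _ => rfl
  have h1 : (fun w => ∏ a, ∏ b, link (2 * Δ) (ξ (enumJ1 τ a)) (v w b))
      =O[Bornology.cobounded ℂ] fun w => w ^ ((m : ℤ) + 1) := by
    have := isBigO_prod_zpow (s := Finset.univ) fun (a : Fin (m + 1)) _ =>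
      isBigO_mul_zpow (link_inv_isBigO (2 * Δ) (ξ (enumJ1 τ a)))
        (isBigO_prod_zpow (s := Finset.univ) fun b _ =>
          link_update_isBigO (2 * Δ) (ξ (enumJ1 τ a)) y k b)
    simp only [Finset.sum_ite_eq', Finset.mem_univ, if_true] at this
    have e : ∀ (u : ℂ) w, ∏ b, link (2 * Δ) u (v w b) =
        link (2 * Δ) u (2 * Δ - w)⁻¹ * ∏ b, link (2 * Δ) u (Function.update y k w b) :=
      fun u w => Fin.prod_univ_succ _
    simp only [e]
    simpa using this
  have h2 : (fun w => detJK Δ (fun a => ξ (enumJ1 τ a)) (v w))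
      =O[Bornology.cobounded ℂ] fun w => w ^ (-2 : ℤ) := by
    have := detJK_isBigO (Δ := Δ) (u := fun a => ξ (enumJ1 τ a)) (v := v)
      (e := Fin.cons 0 fun b => if b = k then -2 else 0) fun a b => by
        refine Fin.cases ?_ (fun b => ?_) b
        · simp only [hv0, Fin.cons_zero]
          exact dFun_inv_isBigO (Δ := Δ) (hξ0 (enumJ1 τ a))
        · simp only [hvs, Fin.cons_succ]
          exact dFun_update_isBigO (hξ0 (enumJ1 τ a))
            (one_sub_ne_zero_of_large hcR (hξ _)) y k b
    simpa [Fin.sum_univ_succ] using this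
  have h3 := scatProd_update_inv_isBigO (c := 2 * Δ) (y := y)
    (fun k => by have := hy k; linarith) k
  have h4 : (fun w => ∏ b, v w b ^ (x - Y (enumK1 τ b) - 1))
      =O[Bornology.cobounded ℂ] fun w => w ^ (Y 0 - Y (enumK1 τ k.succ)) := by
    have h5 := isBigO_prod_zpow (s := Finset.univ) fun (b : Fin m) _ =>
      isBigO_zpow_update y k b (x - Y (enumK1 τ b.succ) - 1)
    simp only [Finset.sum_ite_eq', Finset.mem_univ, if_true] at h5
    have h6 := isBigO_mul_zpow (isBigO_inv_zpow (2 * Δ) (x - Y (enumK1 τ 0) - 1)) h5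
    refine (isBigO_zpow_of_le h6 ?_).congr_left fun w => ?_
    · rw [enumK1_zero τ h0]
      omega
    · simp only [Fin.prod_univ_succ, hv0, hvs]
  have h5 := amp_isBigO (Δ := Δ) τ ξ (v := v) fun k' b hb a => by
    obtain ⟨b, rfl⟩ : ∃ b' : Fin m, b = b'.succ := by
      refine Fin.exists_succ_eq.2 ?_ |>.imp fun _ h => h.symm
      rintro rfl
      rw [enumK1_zero τ h0] at hb
      exact absurd hb (not_lt.2 (Fin.zero_le k'))
    simp only [hvs]
    exact link_div_update_isBigO (2 * Δ) (ξ a) y k b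
  have h6 := isBigO_mul_zpow (isBigO_mul_zpow (isBigO_mul_zpow (isBigO_mul_zpow h1 h2) h3) h4) h5
  have h7 := h6.const_mul_left (mapSign τ.1 *
    (scatProd (2 * Δ) fun a => ξ (enumJ1 τ a))⁻¹ * (∏ a, ξ (enumJ1 τ a) ^ x) *
    ∏ k, (τ.1 k).elim 1 fun a => ξ a ^ Y k)
  have h8 : Y 0 < Y (enumK1 τ k.succ) := by
    refine hY ?_
    rw [← enumK1_zero τ h0]
    exact (enumK1 τ).strictMono (Fin.succ_pos k)
  have h9 := (isBigO_zpow_of_le h7 (b := -1) (by omega)).congr_left (f₂ := fun w =>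
    coreRegular Δ x τ ξ Y (v w)) fun w => by
      rw [coreRegular, div_eq_mul_inv, mul_inv]
      simp only [hvs]
      ring
  simp only [zpow_neg_one] at h9
  exact h9

/-- The determinant has two equal columns when two of the outer variables coincide, which is the
vanishing needed for `torusIntegral_scattering_eq_zero`. The circle `ρ0` encloses all scattering
poles, of modulus below `1 / (R + 1)`, but none of the points `1/ξ_a`. -/
theorem torusIntegral_core_inner_eq_zero (hR : 1 + ‖(2 * Δ : ℂ)‖ < R)
    (hcR : 4 < ‖(2 * Δ : ℂ)‖ * R) (hξ : ∀ j, ‖ξ j‖ = R) (hR' : R + ‖(2 * Δ : ℂ)‖ + 1 < R')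
    {x : ℤ} (τ : maps N (m + 1)) (h0 : τ.1 0 = none) {Y : Fin N → ℤ} (hYm : StrictMono Y)
    (hY : Y 0 < x) {ρ0 : ℝ} (hρ0 : (R + 1)⁻¹ < ρ0) (hρ1 : ρ0 < R⁻¹) :
    torusIntegral (fun z => core Δ x τ ξ z Y) 0
      (Fin.cons ρ0 fun _ => R' : Fin (m + 1) → ℝ) = 0 := by
  have hc := norm_nonneg (2 * Δ : ℂ)
  simp_rw [core_eq_coreRegular]
  refine torusIntegral_scattering_eq_zero (r0 := R + ‖(2 * Δ : ℂ)‖ + 1) (by linarith) hR'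
    (by convert hρ0 using 2; ring) hρ1
    (coreRegular_differentiableOn hR hcR hξ τ h0 hY) (fun y _ k l hkl hy => ?_)
    fun y hy k => coreRegular_isBigO hR hcR hξ τ h0 hYm hy k
  have : detJK Δ (fun a => ξ (enumJ1 τ a))
      (Fin.cons (2 * Δ - y k)⁻¹ y : Fin (m + 1) → ℂ) = 0 := by
    refine Matrix.det_zero_of_column_eq (i := k.succ) (j := l.succ)
      (fun h => hkl (Fin.succ_injective _ h).symm) fun i => ?_
    simp [hy]
  rw [coreRegular, this]
  simp

theorem continuous_core_inner (hR : 1 + ‖(2 * Δ : ℂ)‖ < R)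
    (hcR : 4 < ‖(2 * Δ : ℂ)‖ * R) (hξ : ∀ j, ‖ξ j‖ = R) (hR' : R + ‖(2 * Δ : ℂ)‖ + 1 < R')
    {x : ℤ} (τ : maps N (m + 1)) (h0 : τ.1 0 = none) {Y : Fin N → ℤ}
    (hY : Y 0 < x) {ρ0 : ℝ} (hρ0 : (R + 1)⁻¹ < ρ0) (hρ1 : ρ0 < R⁻¹) :
    Continuous fun θ => core Δ x τ ξ
      (torusMap 0 (Fin.cons ρ0 fun _ => R' : Fin (m + 1) → ℝ) θ) Y := by
  have hc := norm_nonneg (2 * Δ : ℂ)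
  have hpos : 0 < ρ0 := lt_trans (inv_pos.2 (by linarith)) hρ0
  have hmem := torusMap_mem (ρ := (Fin.cons ρ0 fun _ => R' : Fin (m + 1) → ℝ)) fun i => by
    refine Fin.cases ?_ (fun i => ?_) i
    · simpa using hpos
    · simp only [Fin.cons_succ]; linarith
  simp_rw [core_eq_coreRegular]
  refine Continuous.div ?_ ?_ fun θ => Finset.prod_ne_zero_iff.2 fun k _ => ?_
  · refine (coreRegular_differentiableOn hR hcR hξ τ h0 hY).continuousOn.comp_continuous
      (continuous_torusMap _) fun θ => ⟨?_, fun k => ?_⟩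
    · rw [hmem]
      simpa using hρ1
    · rw [hmem]
      simpa using hR'
  · have := continuous_torusMap (Fin.cons ρ0 fun _ => R' : Fin (m + 1) → ℝ)
    fun_prop
  · intro h
    have h1 := norm_sub_gt (c := 2 * (Δ : ℂ)) (y := torusMap 0
      (Fin.cons ρ0 fun _ => R' : Fin (m + 1) → ℝ) θ k.succ) (r0 := R + ‖(2 * Δ : ℂ)‖ + 1)
      (by rw [hmem]; simpa using hR')
    have h2 := hmem θ 0
    rw [Fin.cons_zero] at h2
    generalize torusMap 0 (Fin.cons ρ0 fun _ => R' : Fin (m + 1) → ℝ) θ = z at *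
    have h3 : z 0 * (z k.succ - 2 * Δ) = -1 := by linear_combination h
    have h4 := congrArg norm h3
    rw [norm_mul, h2, norm_neg, norm_one] at h4
    have h5 : (R + 1)⁻¹ * (R + 1) < ρ0 * ‖z k.succ - 2 * Δ‖ :=
      mul_lt_mul hρ0 (by linarith) (by linarith) hpos.le
    rw [inv_mul_cancel₀ (by linarith)] at h5
    linarith

end

theorem continuous_circleIntegral_cons {m : ℕ} {f : (Fin (m + 1) → ℂ) → ℂ} {ρ0 : ℝ}
    {ρ : Fin m → ℝ}
    (hf : Continuous fun θ => f (torusMap 0 (Fin.cons ρ0 ρ : Fin (m + 1) → ℝ) θ)) :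
    Continuous fun θ => ∮ w in C(0, ρ0), f (Fin.cons w (torusMap 0 ρ θ)) := by
  have e : ∀ (s : ℝ) (θ : Fin m → ℝ), (Fin.cons (circleMap 0 ρ0 s) (torusMap 0 ρ θ) :
      Fin (m + 1) → ℂ) = torusMap 0 (Fin.cons ρ0 ρ : Fin (m + 1) → ℝ) (Fin.cons s θ) := by
    intro s θ
    funext i
    refine Fin.cases ?_ (fun i => ?_) i
    · simp [torusMap, circleMap]
    · simp [torusMap]
  unfold circleIntegral
  simp_rw [e]
  refine intervalIntegral.continuous_parametric_intervalIntegral_of_continuous' ?_ _ _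
  have h1 : Continuous fun p : (Fin m → ℝ) × ℝ => (Fin.cons p.2 p.1 : Fin (m + 1) → ℝ) := by
    refine continuous_pi fun i => ?_
    refine Fin.cases ?_ (fun i => ?_) i
    · simpa using continuous_snd
    · simp only [Fin.cons_succ]
      fun_prop
  have h2 : Continuous (deriv (circleMap 0 ρ0)) := by
    rw [funext fun θ => deriv_circleMap 0 ρ0 θ]
    fun_prop
  exact (h2.comp continuous_snd).smul (hf.comp h1)

section
variable {N m : ℕ} [NeZero N] {Δ R R' : ℝ} {ξ : Fin N → ℂ}

/-- The scattering denominators vanish only at points of modulus below `1 / (R + 1)`, so they are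
not met when the contour moves from `R'` to `ρ0`. -/
theorem corePole_differentiableOn (hR : 1 + ‖(2 * Δ : ℂ)‖ < R)
    (hR' : R + ‖(2 * Δ : ℂ)‖ + 1 < R') {x : ℤ} (τ : maps N (m + 1)) {Y : Fin N → ℤ}
    {y : Fin m → ℂ} (hy : ∀ k, ‖y k‖ = R') (a : Fin (m + 1)) :
    DifferentiableOn ℂ (corePole Δ x τ ξ y Y a) {w | (R + 1)⁻¹ < ‖w‖} := by
  have hc := norm_nonneg (2 * Δ : ℂ)
  have hinv : 0 < (R + 1)⁻¹ := inv_pos.2 (by linarith)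
  unfold corePole
  refine differentiableOn_div (((differentiableOn_const _).fun_mul (differentiableOn_zpow
    differentiableOn_id (Or.inl fun w hw => ?_))).fun_mul (differentiableOn_prod fun b _ =>
      link_differentiableOn (differentiableOn_const _) differentiableOn_id)) ?_ fun w hw => ?_
  · rintro rfl
    simp only [mem_ofPred_eq, norm_zero] at hw
    linarith
  · unfold scat
    exact Differentiable.differentiableOn (by fun_prop)
  · refine Finset.prod_ne_zero_iff.2 fun k _ h => ?_
    have hw' : (R + 1)⁻¹ < ‖w‖ := hw
    have h1 := norm_sub_gt (c := 2 * (Δ : ℂ)) (y := y k) (r0 := R + ‖(2 * Δ : ℂ)‖ + 1)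
      (by rw [hy]; exact hR')
    have h3 : w * (y k - 2 * Δ) = -1 := by unfold scat at h; linear_combination h
    have h4 := congrArg norm h3
    rw [norm_mul, norm_neg, norm_one] at h4
    have h5 : (R + 1)⁻¹ * (R + 1) < ‖w‖ * ‖y k - 2 * Δ‖ :=
      mul_lt_mul hw' (by linarith) (by linarith) (norm_nonneg _)
    rw [inv_mul_cancel₀ (by linarith)] at h5
    linarith

/-- Each summand of `core_cons_eq_sum` has exactly one pole between the two circles, at `1/ξ_a` with
modulus `1/R`; `corePole_inv` gives its residue. -/
theorem circleIntegral_core_cons (hR : 1 + ‖(2 * Δ : ℂ)‖ < R)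
    (hcR : 4 < ‖(2 * Δ : ℂ)‖ * R) (hξ : ∀ j, ‖ξ j‖ = R) (hR' : R + ‖(2 * Δ : ℂ)‖ + 1 < R')
    {x : ℤ} (τ : maps N (m + 1)) (h0 : τ.1 0 = none) {Y : Fin N → ℤ}
    {ρ0 : ℝ} (hρ0 : (R + 1)⁻¹ < ρ0) (hρ1 : ρ0 < R⁻¹) {y : Fin m → ℂ} (hy : ∀ k, ‖y k‖ = R') :
    (∮ w in C(0, R'), core Δ x τ ξ (Fin.cons w y) Y) =
      (∮ w in C(0, ρ0), core Δ x τ ξ (Fin.cons w y) Y) +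
        ∑ a, -(2 * Real.pi * I) * core Δ x (fill τ h0 a) ξ y Y := by
  have hc := norm_nonneg (2 * Δ : ℂ)
  have hξl : ∀ j, 1 + ‖(2 * Δ : ℂ)‖ < ‖ξ j‖ := fun j => by rw [hξ]; exact hR
  have hξ0 : ∀ j, ξ j ≠ 0 := fun j => ne_zero_of_large (hξl j)
  have hR0 : 0 < R := by linarith
  have hR0' : 0 < R' := by linarith
  have hpos : 0 < ρ0 := lt_trans (inv_pos.2 (by linarith)) hρ0
  have hinvR : R⁻¹ < R' := by
    have : R⁻¹ < 1 := inv_lt_one_of_one_lt₀ (by linarith)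
    linarith
  have hd := corePole_differentiableOn (ξ := ξ) hR hR' (x := x) τ (Y := Y) hy
  have hmem : ∀ {ρ : ℝ} (_ : ρ0 ≤ ρ) {w : ℂ}, w ∈ sphere (0 : ℂ) ρ →
      w ∈ {w : ℂ | (R + 1)⁻¹ < ‖w‖} := by
    intro ρ h w hw
    rw [mem_sphere_zero_iff_norm] at hw
    simp only [mem_ofPred_eq]
    linarith
  have hint : ∀ {ρ : ℝ}, ρ0 ≤ ρ → ρ ≠ R⁻¹ → ∀ a ∈ Finset.univ, CircleIntegrable
      (fun w => corePole Δ x τ ξ y Y a w / (w - (ξ (enumJ1 τ a))⁻¹)) 0 ρ := by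
    intro ρ h hne a _
    refine ContinuousOn.circleIntegrable (hpos.le.trans h) (ContinuousOn.div
      ((hd a).continuousOn.mono fun w hw => hmem h hw) (by fun_prop) fun w hw h1 => ?_)
    rw [mem_sphere_zero_iff_norm] at hw
    rw [sub_eq_zero.1 h1, norm_inv, hξ] at hw
    exact hne hw.symm
  have h1 : (∮ w in C(0, R'), core Δ x τ ξ (Fin.cons w y) Y) =
      ∑ a, ∮ w in C(0, R'), corePole Δ x τ ξ y Y a w / (w - (ξ (enumJ1 τ a))⁻¹) := by
    rw [← circleIntegral.integral_fun_sum (hint (by linarith) hinvR.ne')]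
    refine circleIntegral.integral_congr hR0'.le fun w hw => ?_
    rw [mem_sphere_zero_iff_norm] at hw
    exact core_cons_eq_sum Δ x τ ξ y h0 Y hξ0
      (fun j => link_ne_zero hcR (hξ j) (by rw [hw]; linarith))
      fun j => one_sub_mul_ne_zero (by linarith) (hξ j) (by rw [hw]; linarith)
  have h2 : (∮ w in C(0, ρ0), core Δ x τ ξ (Fin.cons w y) Y) =
      ∑ a, ∮ w in C(0, ρ0), corePole Δ x τ ξ y Y a w / (w - (ξ (enumJ1 τ a))⁻¹) := by
    rw [← circleIntegral.integral_fun_sum (hint le_rfl hρ1.ne)]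
    refine circleIntegral.integral_congr hpos.le fun w hw => ?_
    rw [mem_sphere_zero_iff_norm] at hw
    exact core_cons_eq_sum Δ x τ ξ y h0 Y hξ0
      (fun j => link_ne_zero_of_small hR (hξ j) (by rw [hw]; exact hρ1))
      fun j => one_sub_mul_ne_zero_of_small hR0 (hξ j) (by rw [hw]; exact hρ1)
  rw [h1, h2, ← Finset.sum_add_distrib]
  refine Finset.sum_congr rfl fun a _ => ?_
  have hn : ‖(ξ (enumJ1 τ a))⁻¹‖ = R⁻¹ := by rw [norm_inv, hξ]
  rw [circleIntegral_annulus_pole hpos (by rw [hn]; exact hρ1) (by rw [hn]; exact hinvR)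
    (isOpen_lt continuous_const continuous_norm) (fun w hw _ => hρ0.trans_le hw) (hd a),
    corePole_inv Δ x τ ξ y h0 Y hξl
      (fun b j => add_sub_ne_zero (hξ j) (by rw [hy]; linarith))]
  ring

theorem torusIntegral_core_eq_sum_fill (hR : 1 + ‖(2 * Δ : ℂ)‖ < R)
    (hcR : 4 < ‖(2 * Δ : ℂ)‖ * R) (hξ : ∀ j, ‖ξ j‖ = R) (hR' : R + ‖(2 * Δ : ℂ)‖ + 1 < R')
    {x : ℤ} (τ : maps N (m + 1)) (h0 : τ.1 0 = none) {Y : Fin N → ℤ} (hYm : StrictMono Y)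
    (hY : Y 0 < x) :
    torusIntegral (fun ζ => core Δ x τ ξ ζ Y) 0 (fun _ => R') =
      -(2 * Real.pi * I) *
        ∑ a, torusIntegral (fun ζ => core Δ x (fill τ h0 a) ξ ζ Y) 0 (fun _ => R') := by
  have hc := norm_nonneg (2 * Δ : ℂ)
  have hR0' : 0 < R' := by linarith
  obtain ⟨ρ0, hρ0, hρ1⟩ : ∃ ρ0, (R + 1)⁻¹ < ρ0 ∧ ρ0 < R⁻¹ :=
    exists_between (inv_strictAnti₀ (by linarith) (by linarith))
  -- The value `none` stands for the integral over the small circle, `some a` for the residue at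
  -- `1/ξ_a`, so that all contributions form one finite sum.
  have h1 : torusIntegral (fun ζ => core Δ x τ ξ ζ Y) 0 (fun _ => R') =
      torusIntegral (fun y => ∑ o : Option (Fin (m + 1)), o.elim
        (∮ w in C(0, ρ0), core Δ x τ ξ (Fin.cons w y) Y)
        fun a => -(2 * Real.pi * I) * core Δ x (fill τ h0 a) ξ y Y) 0 (fun _ => R') := by
    have e : (fun _ : Fin (m + 1) => R') = Fin.cons R' fun _ => R' := by
      funext i
      refine Fin.cases rfl (fun _ => rfl) i
    rw [e, torusIntegral_cons]
    · refine torusIntegral_congr (fun _ => hR0') fun y hy => ?_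
      rw [circleIntegral_core_cons hR hcR hξ hR' τ h0 hρ0 hρ1 hy, Fintype.sum_option]
      rfl
    · rw [← e]
      exact continuous_core_torus hR hcR hξ x τ Y fun _ => hR'
  have hin := continuous_core_inner hR hcR hξ hR' τ h0 hY hρ0 hρ1
  rw [h1, torusIntegral_finsetSum, Fintype.sum_option]
  · simp only [Option.elim_none, Option.elim_some]
    rw [← torusIntegral_cons (f := fun z => core Δ x τ ξ z Y) hin,
      torusIntegral_core_inner_eq_zero hR hcR hξ hR' τ h0 hYm hY hρ0 hρ1, zero_add,
      Finset.mul_sum]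
    refine Finset.sum_congr rfl fun a _ => ?_
    exact torusIntegral_smul (𝕜 := ℂ) (-(2 * Real.pi * I)) _ _ _
  · rintro (_ | a) -
    · exact continuous_circleIntegral_cons (f := fun z => core Δ x τ ξ z Y) hin
    · exact continuous_const.mul (continuous_core_torus hR hcR hξ x _ Y fun _ => hR')

end

/-! ### Telescoping over the number of `ζ`-variables -/

theorem maps_zero_ne_none {N : ℕ} (τ : maps N 0) (k : Fin N) : τ.1 k ≠ none := by
  intro h
  obtain ⟨b, -⟩ := exists_enumK1 τ h
  exact b.elim0

theorem maps_card_eq_none {N : ℕ} (τ : maps N N) (k : Fin N) : τ.1 k = none := by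
  have h : setK1 τ.1 = Finset.univ := by
    rw [← Finset.card_eq_iff_eq_univ, card_setK1, Fintype.card_fin]
  exact mem_setK1.1 (h ▸ Finset.mem_univ k)

section
variable {N m : ℕ} [NeZero N]

/-- The map `σ` with the value at the first particle changed to `0`. -/
def unfill (σ : maps N m) (h : σ.1 0 ≠ none) : maps N (m + 1) :=
  ⟨Function.update σ.1 0 none, by
    refine Finset.mem_filter.2 ⟨Finset.mem_univ _, ?_, fun j => ?_⟩
    · have h1 : (Finset.univ.filter fun k => Function.update σ.1 0 none k = none) =
          insert 0 (setK1 σ.1) := by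
        ext k
        by_cases hk : k = 0
        · subst hk; simp
        · simp [setK1, hk]
      rw [h1, Finset.card_insert_of_notMem (fun h' => h (mem_setK1.1 h')), card_setK1]
    · rw [Finset.card_le_one]
      intro k hk k' hk'
      simp only [Finset.mem_filter, Finset.mem_univ, true_and] at hk hk'
      have h1 : k ≠ 0 := fun h1 => by simp [h1] at hk
      have h2 : k' ≠ 0 := fun h1 => by simp [h1] at hk'
      rw [Function.update_of_ne h1] at hk
      rw [Function.update_of_ne h2] at hk'
      exact maps_injective σ hk hk'⟩

/-- A map with nonzero value at the first particle arises from exactly one map with zero there and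
one choice of an element of its `J_1`. -/
theorem sum_fill {M : Type*} [AddCommMonoid M] (g : maps N m → M) :
    ∑ p : {τ : maps N (m + 1) // τ.1 0 = none} × Fin (m + 1), g (fill p.1.1 p.1.2 p.2) =
      ∑ σ : {σ : maps N m // ¬σ.1 0 = none}, g σ.1 := by
  refine Fintype.sum_bijective (fun p => ⟨fill p.1.1 p.1.2 p.2, by rw [fill_zero]; simp⟩)
    ⟨?_, ?_⟩ _ _ fun _ => rfl
  · rintro ⟨⟨τ, h⟩, a⟩ ⟨⟨τ', h'⟩, a'⟩ he
    have he' : fill τ h a = fill τ' h' a' := congrArg Subtype.val he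
    have h1 : τ = τ' := by
      apply Subtype.ext
      funext k
      by_cases hk : k = 0
      · rw [hk, h, h']
      · rw [← fill_of_ne τ h a hk, ← fill_of_ne τ' h' a' hk, he']
    subst h1
    have h2 := fill_zero τ h a
    rw [he', fill_zero] at h2
    rw [(enumJ1 τ).injective (Option.some.inj h2)]
  · rintro ⟨σ, hσ⟩
    obtain ⟨j, hj⟩ := Option.ne_none_iff_exists'.1 hσ
    have h0 : (unfill σ hσ).1 0 = none := by simp [unfill]
    have hne : ∀ k, k ≠ 0 → (unfill σ hσ).1 k = σ.1 k := fun k hk => Function.update_of_ne hk _ _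
    obtain ⟨a, ha⟩ := exists_enumJ1 (unfill σ hσ) (j := j) fun k hk => by
      by_cases hk0 : k = 0
      · rw [hk0, h0] at hk
        cases hk
      · rw [hne k hk0] at hk
        exact hk0 (maps_injective σ hk hj)
    refine ⟨⟨⟨unfill σ hσ, h0⟩, a⟩, Subtype.ext (Subtype.ext (funext fun k => ?_))⟩
    by_cases hk : k = 0
    · subst hk
      simp only [fill_zero, ha, hj]
    · simp only [fill_of_ne _ _ _ hk, hne k hk]

variable {Δ R R' : ℝ} {ξ : Fin N → ℂ}

/-- The contributions of all maps cancel, except for those of the maps without zeros when all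
particles start at sites `≥ x`. -/
theorem sum_contourIntegral_core (hR : 1 + ‖(2 * Δ : ℂ)‖ < R)
    (hcR : 4 < ‖(2 * Δ : ℂ)‖ * R) (hξ : ∀ j, ‖ξ j‖ = R) (hR' : R + ‖(2 * Δ : ℂ)‖ + 1 < R')
    (x : ℤ) {Y : Fin N → ℤ} (hY : StrictMono Y) :
    ∑ n ∈ Finset.range (N + 1), ∑ τ : maps N n,
        contourIntegral n R' (fun ζ => core Δ x τ ξ ζ Y) =
      if x ≤ Y 0 then ∑ τ : maps N 0, contourIntegral 0 R' (fun ζ => core Δ x τ ξ ζ Y)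
      else 0 := by
  split_ifs with hx
  · rw [Finset.sum_range_succ', Finset.sum_eq_zero fun n _ => ?_, zero_add]
    refine Finset.sum_eq_zero fun τ _ => ?_
    rw [contourIntegral, torusIntegral_core_eq_zero hR hcR hξ hR' τ fun k =>
      hx.trans (hY.monotone (Fin.zero_le k)), mul_zero]
  · push Not at hx
    set S : ∀ n, maps N n → ℂ := fun n τ => contourIntegral n R' fun ζ => core Δ x τ ξ ζ Y with hS
    have hsplit : ∀ n, ∑ τ, S n τ = ∑ τ : {τ : maps N n // τ.1 0 = none}, S n τ.1 +
        ∑ τ : {τ : maps N n // ¬τ.1 0 = none}, S n τ.1 := fun n =>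
      (Fintype.sum_subtype_add_sum_subtype (fun τ : maps N n => τ.1 0 = none) (S n)).symm
    -- The factor `-2πi` of the residues is absorbed by the change of normalisation from `n + 1` to
    -- `n` integrals.
    have hstep : ∀ n, ∑ τ : {τ : maps N (n + 1) // τ.1 0 = none}, S (n + 1) τ.1 =
        -∑ τ : {τ : maps N n // ¬τ.1 0 = none}, S n τ.1 := by
      intro n
      rw [← sum_fill, Fintype.sum_prod_type, ← Finset.sum_neg_distrib]
      refine Finset.sum_congr rfl fun τ _ => ?_
      simp only [hS, contourIntegral]
      rw [torusIntegral_core_eq_sum_fill hR hcR hξ hR' τ.1 τ.2 hY hx, ← Finset.mul_sum]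
      have hpi : (2 * Real.pi * I : ℂ) ≠ 0 := Complex.two_pi_I_ne_zero
      rw [pow_succ, mul_inv]
      field_simp
    have h0 : ∑ τ : {τ : maps N 0 // τ.1 0 = none}, S 0 τ.1 = 0 :=
      Finset.sum_eq_zero fun τ _ => absurd τ.2 (maps_zero_ne_none τ.1 0)
    have hN : ∑ τ : {τ : maps N N // ¬τ.1 0 = none}, S N τ.1 = 0 :=
      Finset.sum_eq_zero fun τ _ => absurd (maps_card_eq_none τ.1 0) τ.2
    -- At each level the maps with zero at the first particle cancel what the previous level left
    -- over. At level `N` nothing is left, since all values are then zero.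
    have hsum : ∀ k, ∑ n ∈ Finset.range (k + 1), ∑ τ, S n τ =
        ∑ τ : {τ : maps N k // ¬τ.1 0 = none}, S k τ.1 := by
      intro k
      induction k with
      | zero => rw [Finset.sum_range_one, hsplit, h0, zero_add]
      | succ k ih => rw [Finset.sum_range_succ, ih, hsplit, hstep]; ring
    exact (hsum N).trans hN

end

/-! ### Exchanging two neighbouring particles -/

/-- A transposition of adjacent indices reverses the order of that one pair only. -/
theorem swap_lt_swap {n : ℕ} {i j : Fin n} (hij : (j : ℕ) = i + 1) {k l : Fin n}
    (h : ¬(k = i ∧ l = j)) (h' : ¬(k = j ∧ l = i)) :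
    Equiv.swap i j k < Equiv.swap i j l ↔ k < l := by
  rw [Fin.ext_iff, Fin.ext_iff] at h h'
  simp only [Equiv.swap_apply_def, Fin.lt_def]
  split_ifs <;> simp_all [Fin.ext_iff] <;> omega

theorem lt_swap_iff {n : ℕ} {i j : Fin n} (hij : (j : ℕ) = i + 1) {k l : Fin n}
    (hi : k ≠ i) (hj : k ≠ j) : k < Equiv.swap i j l ↔ k < l := by
  rw [← swap_lt_swap hij (k := k) (l := l) (fun h => hi h.1) (fun h => hj h.1),
    Equiv.swap_apply_of_ne_of_ne hi hj]

/-- All pairs other than `(i, j)` are permuted among themselves. The factors `f i j` and `f j i` are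
multiplied across because the monoid has no division. -/
theorem prod_Ioi_swap {M : Type*} [CommMonoid M] {n : ℕ} {i j : Fin n} (hij : (j : ℕ) = i + 1)
    (f : Fin n → Fin n → M) :
    (∏ k, ∏ l ∈ Finset.Ioi k, f (Equiv.swap i j k) (Equiv.swap i j l)) * f i j =
      (∏ k, ∏ l ∈ Finset.Ioi k, f k l) * f j i := by
  have hlt : i < j := by rw [Fin.lt_def]; omega
  have key : ∀ g : Fin n → Fin n → M, ∏ k, ∏ l ∈ Finset.Ioi k, g k l =
      g i j * ∏ p ∈ (Finset.univ.filter fun p : Fin n × Fin n => p.1 < p.2).erase (i, j),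
        g p.1 p.2 := by
    intro g
    have h := Finset.mul_prod_erase (Finset.univ.filter fun p : Fin n × Fin n => p.1 < p.2)
      (fun p => g p.1 p.2) (a := (i, j)) (by simpa using hlt)
    rw [h, Finset.prod_filter, Fintype.prod_prod_type]
    refine Finset.prod_congr rfl fun k _ => ?_
    rw [← Finset.prod_filter]
    congr 1
    ext l
    simp
  rw [key, key, Equiv.swap_apply_left, Equiv.swap_apply_right]
  have h : ∏ p ∈ (Finset.univ.filter fun p : Fin n × Fin n => p.1 < p.2).erase (i, j),
        f (Equiv.swap i j p.1) (Equiv.swap i j p.2) =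
      ∏ p ∈ (Finset.univ.filter fun p : Fin n × Fin n => p.1 < p.2).erase (i, j), f p.1 p.2 := by
    refine Finset.prod_equiv ((Equiv.swap i j).prodCongr (Equiv.swap i j)) (fun p => ?_)
      fun p _ => rfl
    obtain ⟨k, l⟩ := p
    simp only [Finset.mem_erase, Finset.mem_filter, Finset.mem_univ, true_and, ne_eq,
      Equiv.prodCongr_apply, Prod.map_apply, Prod.mk.injEq]
    by_cases h1 : k = i ∧ l = j
    · obtain ⟨rfl, rfl⟩ := h1
      simp [hlt.not_gt]
    by_cases h2 : k = j ∧ l = i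
    · obtain ⟨rfl, rfl⟩ := h2
      simp [hlt.not_gt]
    rw [swap_lt_swap hij h1 h2]
    refine and_congr_left fun _ => not_congr ⟨fun h => absurd h h1, fun h => absurd ?_ h2⟩
    rwa [Equiv.swap_apply_eq_iff, Equiv.swap_apply_eq_iff, Equiv.swap_apply_left,
      Equiv.swap_apply_right] at h
  rw [h]
  ac_rfl

theorem scatProd_swap {n : ℕ} {i j : Fin n} (hij : (j : ℕ) = i + 1) (c : ℂ) (y : Fin n → ℂ) :
    scatProd c (y ∘ Equiv.swap i j) * scat c (y i) (y j) =
      scatProd c y * scat c (y j) (y i) :=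
  prod_Ioi_swap hij fun k l => scat c (y k) (y l)

section
variable {N n : ℕ} (τ : maps N n) (i j : Fin N)

/-- The map `τ` with the values at `i` and `j` exchanged. -/
def swapMap : maps N n :=
  ⟨τ.1 ∘ Equiv.swap i j, by
    have h : ∀ o, Finset.univ.filter (fun k => (τ.1 ∘ Equiv.swap i j) k = o) =
        (Finset.univ.filter fun k => τ.1 k = o).map (Equiv.swap i j).toEmbedding := by
      intro o
      ext k
      simp only [Finset.mem_filter, Finset.mem_univ, true_and, Finset.mem_map,
        Equiv.coe_toEmbedding, Function.comp]
      constructor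
      · exact fun hk => ⟨_, hk, Equiv.swap_apply_self _ _ _⟩
      · rintro ⟨l, hl, rfl⟩
        rwa [Equiv.swap_apply_self]
    refine Finset.mem_filter.2 ⟨Finset.mem_univ _, ?_, fun o => ?_⟩
    · rw [h, Finset.card_map]
      exact (Finset.mem_filter.1 τ.2).2.1
    · rw [h, Finset.card_map]
      exact (Finset.mem_filter.1 τ.2).2.2 o⟩

theorem swapMap_apply (k : Fin N) : (swapMap τ i j).1 k = τ.1 (Equiv.swap i j k) := rfl

theorem swapMap_swapMap : swapMap (swapMap τ i j) i j = τ :=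
  Subtype.ext (funext fun k => by rw [swapMap_apply, swapMap_apply, Equiv.swap_apply_self])

theorem enumJ1_swapMap : enumJ1 (swapMap τ i j) = enumJ1 τ := by
  refine DFunLike.coe_injective (enumJ1_unique _ (fun b k => ?_) (enumJ1 τ).strictMono).symm
  exact enumJ1_mem τ b _

variable {i j}

/-- Unless both `i` and `j` lie in `K_1`, the exchange keeps the elements of `K_1` in order, so each
`ζ`-variable stays with its particle. -/
theorem enumK1_swapMap (hij : (j : ℕ) = i + 1) (h : ¬(τ.1 i = none ∧ τ.1 j = none)) (b : Fin n) :
    enumK1 (swapMap τ i j) b = Equiv.swap i j (enumK1 τ b) := by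
  refine (congrFun (enumK1_unique (swapMap τ i j)
    (f := fun b => Equiv.swap i j (enumK1 τ b)) (fun b => ?_) fun b b' hb => ?_) b).symm
  · rw [swapMap_apply, Equiv.swap_apply_self]
    exact enumK1_mem τ b
  · refine (swap_lt_swap hij (fun h' => h ?_) fun h' => h ?_).2 ((enumK1 τ).strictMono hb)
    · rw [← h'.1, ← h'.2]
      exact ⟨enumK1_mem τ b, enumK1_mem τ b'⟩
    · rw [← h'.1, ← h'.2]
      exact ⟨enumK1_mem τ b', enumK1_mem τ b⟩

theorem waveMult_swapMap (hij : (j : ℕ) = i + 1) (h : ¬(τ.1 i = none ∧ τ.1 j = none))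
    (ξ : Fin N → ℂ) (ζ : Fin n → ℂ) (k : Fin N) :
    waveMult (swapMap τ i j) ξ ζ k = waveMult τ ξ ζ (Equiv.swap i j k) := by
  cases hk : τ.1 (Equiv.swap i j k) with
  | none =>
    obtain ⟨b, hb⟩ := exists_enumK1 τ hk
    rw [← hb, waveMult_enumK1, show k = enumK1 (swapMap τ i j) b by
      rw [enumK1_swapMap τ hij h, hb, Equiv.swap_apply_self], waveMult_enumK1]
  | some a => rw [waveMult_some _ _ _ hk, waveMult_some _ _ _ ((swapMap_apply τ i j k).trans hk)]

theorem neg_one_pow_inversions :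
    ((-1) ^ inversions τ.1 : ℂ) = ∏ k, ∏ l ∈ Finset.Ioi k,
      if ∃ a b : Fin N, τ.1 k = some a ∧ τ.1 l = some b ∧ b < a then -1 else 1 := by
  classical
  have h : ∏ k, ∏ l ∈ Finset.Ioi k,
      (if ∃ a b : Fin N, τ.1 k = some a ∧ τ.1 l = some b ∧ b < a then (-1 : ℂ) else 1) =
      ∏ p : Fin N × Fin N, if p.1 < p.2 ∧ ∃ a b : Fin N, τ.1 p.1 = some a ∧ τ.1 p.2 = some b ∧
        b < a then (-1 : ℂ) else 1 := by
    rw [Fintype.prod_prod_type]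
    refine Finset.prod_congr rfl fun k _ => ?_
    simp_rw [ite_and]
    rw [← Finset.prod_filter (fun l => k < l)]
    congr 1
    ext l
    simp
  rw [h, ← Finset.prod_filter, Finset.prod_const, inversions]

theorem neg_one_pow_inversions_swapMap (hij : (j : ℕ) = i + 1) :
    ((-1) ^ inversions (swapMap τ i j).1 *
      (if ∃ a b : Fin N, τ.1 i = some a ∧ τ.1 j = some b ∧ b < a then -1 else 1) : ℂ) =
    (-1) ^ inversions τ.1 *
      (if ∃ a b : Fin N, τ.1 j = some a ∧ τ.1 i = some b ∧ b < a then -1 else 1) := by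
  rw [neg_one_pow_inversions, neg_one_pow_inversions]
  exact prod_Ioi_swap hij fun k l =>
    if ∃ a b : Fin N, τ.1 k = some a ∧ τ.1 l = some b ∧ b < a then (-1 : ℂ) else 1

theorem shift_swapMap (hij : (j : ℕ) = i + 1) :
    shift (swapMap τ i j).1 = shift τ.1 +
      ((τ.1 i).elim 0 (fun _ => -1) + (τ.1 j).elim 0 fun _ => 1) := by
  have key : ∀ σ : Fin N → Option (Fin N), shift σ =
      ∑ k, (σ k).elim 0 fun a => ((a : ℕ) : ℤ) - ((k : ℕ) : ℤ) := by
    intro σ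
    refine Finset.sum_congr rfl fun k _ => ?_
    cases σ k <;> rfl
  have hne : i ≠ j := fun h => by rw [h] at hij; omega
  have h1 : shift (swapMap τ i j).1 =
      ∑ k, (τ.1 k).elim 0 fun a => ((a : ℕ) : ℤ) - ((Equiv.swap i j k : ℕ) : ℤ) := by
    rw [key, ← Equiv.sum_comp (Equiv.swap i j)]
    simp_rw [swapMap_apply, Equiv.swap_apply_self]
  have h2 : ∑ k, ((τ.1 k).elim 0 fun _ => ((k : ℕ) : ℤ) - ((Equiv.swap i j k : ℕ) : ℤ)) =
      (τ.1 i).elim 0 (fun _ => -1) + (τ.1 j).elim 0 fun _ => 1 := by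
    rw [Fintype.sum_eq_add i j hne]
    · rw [Equiv.swap_apply_left, Equiv.swap_apply_right, hij]
      push_cast
      congr 1 <;> congr 1 <;> funext <;> ring
    · rintro k ⟨h1, h2⟩
      rw [Equiv.swap_apply_of_ne_of_ne h1 h2]
      cases τ.1 k <;> simp
  rw [h1, ← h2, key, ← Finset.sum_add_distrib]
  refine Finset.sum_congr rfl fun k _ => ?_
  cases τ.1 k <;> simp

/-- The sum of the shifts is unchanged and exactly one inversion is created. -/
theorem mapSign_swapMap_some (hij : (j : ℕ) = i + 1) {a a' : Fin N} (hi : τ.1 i = some a)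
    (hj : τ.1 j = some a') (h : a < a') : mapSign (swapMap τ i j).1 = -mapSign τ.1 := by
  have h1 := neg_one_pow_inversions_swapMap τ hij
  have h2 := shift_swapMap τ hij
  rw [if_neg (by
    rintro ⟨b, b', hb, hb', hlt⟩
    rw [← Option.some.inj (hi.symm.trans hb), ← Option.some.inj (hj.symm.trans hb')] at hlt
    exact absurd hlt h.not_gt), if_pos ⟨a', a, hj, hi, h⟩] at h1
  simp only [hi, hj, Option.elim_some] at h2
  unfold mapSign
  rw [h2, neg_add_cancel, add_zero]
  linear_combination (-1 : ℂ) ^ shift τ.1 * h1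

/-- The value moves one place to the right without passing another value: no inversion changes and
the shift drops by one. -/
theorem mapSign_swapMap_none (hij : (j : ℕ) = i + 1) {a : Fin N} (hi : τ.1 i = some a)
    (hj : τ.1 j = none) : mapSign (swapMap τ i j).1 = -mapSign τ.1 := by
  have h1 := neg_one_pow_inversions_swapMap τ hij
  have h2 := shift_swapMap τ hij
  simp only [hi, hj, Option.elim_some, Option.elim_none, reduceCtorEq, false_and, and_false,
    exists_false, if_false] at h1 h2
  unfold mapSign
  rw [h2, add_zero, zpow_add₀ (by norm_num), zpow_neg_one]
  linear_combination (-1 : ℂ) ^ shift τ.1 * (-1 : ℂ)⁻¹ * h1 + (-1 : ℂ) ^ shift τ.1 *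
    (-1) ^ inversions τ.1 * (by norm_num : (-1 : ℂ)⁻¹ = -1)

theorem swapMap_ne_iff (hij : (j : ℕ) = i + 1) {k : Fin N} (hi : k ≠ i) (hj : k ≠ j)
    (o : Option (Fin N)) :
    (∀ k', k < k' → (swapMap τ i j).1 k' ≠ o) ↔ ∀ k', k < k' → τ.1 k' ≠ o := by
  constructor
  · intro h k' hk'
    have := h (Equiv.swap i j k') ((lt_swap_iff hij hi hj).2 hk')
    rwa [swapMap_apply, Equiv.swap_apply_self] at this
  · intro h k' hk'
    exact h _ ((lt_swap_iff hij hi hj).2 hk')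

theorem swapMap_of_gt (hij : (j : ℕ) = i + 1) {k : Fin N} (hk : j < k) :
    (swapMap τ i j).1 k = τ.1 k := by
  rw [swapMap_apply, Equiv.swap_apply_of_ne_of_ne _ hk.ne']
  rintro rfl
  rw [Fin.lt_def] at hk
  omega

variable (Δ : ℝ) (ξ : Fin N → ℂ) (ζ : Fin n → ℂ)

theorem amp_swapMap (hij : (j : ℕ) = i + 1) (h : ¬(τ.1 i = none ∧ τ.1 j = none)) {k : Fin N}
    (hi : k ≠ i) (hj : k ≠ j) : amp Δ (swapMap τ i j) ξ ζ k = amp Δ τ ξ ζ k := by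
  unfold amp ampSome
  rw [swapMap_apply, Equiv.swap_apply_of_ne_of_ne hi hj]
  simp_rw [enumK1_swapMap τ hij h, swapMap_ne_iff τ hij hi hj, lt_swap_iff hij hi hj]

theorem lt_iff_of_adjacent (hij : (j : ℕ) = i + 1) {k : Fin N} : i < k ↔ k = j ∨ j < k := by
  rw [Fin.lt_def, Fin.lt_def, Fin.ext_iff]
  omega

/-- The particle with the larger value `a'` now precedes the one with `a`. As `a < a'`, the index
`a` lies outside the product over indices above `a'` in any case. -/
theorem amp_swapMap_left (hij : (j : ℕ) = i + 1) {a a' : Fin N} (hi : τ.1 i = some a)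
    (hj : τ.1 j = some a') (h : a < a') :
    amp Δ (swapMap τ i j) ξ ζ i = amp Δ τ ξ ζ j := by
  have hn : ¬(τ.1 i = none ∧ τ.1 j = none) := by simp [hi]
  unfold amp
  rw [swapMap_apply, Equiv.swap_apply_left, hj, Option.elim_some, Option.elim_some, ampSome,
    ampSome]
  congr 1
  · refine Finset.prod_congr ?_ fun _ _ => rfl
    ext l
    simp only [Finset.mem_filter, Finset.mem_Ioi]
    refine and_congr_right fun hl => ⟨fun hh k hk => ?_, fun hh k hk => ?_⟩
    · rw [← swapMap_of_gt τ hij hk]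
      exact hh k ((lt_iff_of_adjacent hij).2 (Or.inr hk))
    · rcases (lt_iff_of_adjacent hij).1 hk with rfl | hk
      · rw [swapMap_apply, Equiv.swap_apply_right, hi]
        intro he
        rw [← Option.some.inj he] at hl
        exact absurd hl h.not_gt
      · rw [swapMap_of_gt τ hij hk]
        exact hh k hk
  · refine Finset.prod_congr (Finset.filter_congr fun b _ => ?_) fun _ _ => rfl
    have hbi : enumK1 τ b ≠ i := fun hb => by
      have := enumK1_mem τ b
      rw [hb, hi] at this
      cases this
    have hbj : enumK1 τ b ≠ j := fun hb => by
      have := enumK1_mem τ b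
      rw [hb, hj] at this
      cases this
    rw [enumK1_swapMap τ hij hn, Equiv.swap_apply_of_ne_of_ne hbi hbj, lt_iff_of_adjacent hij]
    simp [hbj]

/-- After the exchange `a'` is no longer used by a later particle, so the product of the particle
with value `a` gains the factor of the pair `(a, a')`. -/
theorem amp_swapMap_right (hij : (j : ℕ) = i + 1) {a a' : Fin N} (hi : τ.1 i = some a)
    (hj : τ.1 j = some a') (h : a < a') :
    amp Δ (swapMap τ i j) ξ ζ j =
      scat (2 * Δ) (ξ a') (ξ a) / scat (2 * Δ) (ξ a) (ξ a') * amp Δ τ ξ ζ i := by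
  have hn : ¬(τ.1 i = none ∧ τ.1 j = none) := by simp [hi]
  unfold amp
  rw [swapMap_apply, Equiv.swap_apply_right, hi, Option.elim_some, Option.elim_some, ampSome,
    ampSome, ← mul_assoc]
  congr 1
  · rw [← Finset.prod_erase_mul _ _ (a := a')
      (s := (Finset.Ioi a).filter fun l => ∀ k', j < k' → (swapMap τ i j).1 k' ≠ some l), mul_comm]
    · congr 1
      refine Finset.prod_congr ?_ fun _ _ => rfl
      ext l
      simp only [Finset.mem_filter, Finset.mem_Ioi, Finset.mem_erase]
      rw [and_left_comm]
      refine and_congr_right fun hl => ⟨fun hh k hk => ?_, fun hh => ⟨fun he => ?_, fun k hk => ?_⟩⟩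
      · rcases (lt_iff_of_adjacent hij).1 hk with rfl | hk
        · rw [hj]
          exact fun he => hh.1 (Option.some.inj he).symm
        · rw [← swapMap_of_gt τ hij hk]
          exact hh.2 k hk
      · refine hh j ((lt_iff_of_adjacent hij).2 (Or.inl rfl)) ?_
        rw [hj, he]
      · rw [swapMap_of_gt τ hij hk]
        exact hh k ((lt_iff_of_adjacent hij).2 (Or.inr hk))
    · refine Finset.mem_filter.2 ⟨Finset.mem_Ioi.2 h, fun k hk he => ?_⟩
      rw [swapMap_of_gt τ hij hk] at he
      exact hk.ne (maps_injective τ hj he)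
  · refine Finset.prod_congr (Finset.filter_congr fun b _ => ?_) fun _ _ => rfl
    have hbi : enumK1 τ b ≠ i := fun hb => by
      have := enumK1_mem τ b
      rw [hb, hi] at this
      cases this
    have hbj : enumK1 τ b ≠ j := fun hb => by
      have := enumK1_mem τ b
      rw [hb, hj] at this
      cases this
    rw [enumK1_swapMap τ hij hn, Equiv.swap_apply_of_ne_of_ne hbi hbj, lt_iff_of_adjacent hij]
    simp [hbj]

/-- Moving past its neighbour in `K_1`, the particle loses the link factor with that neighbour's
variable. -/
theorem amp_swapMap_enumK1 (hij : (j : ℕ) = i + 1) {a : Fin N} (hi : τ.1 i = some a) {b : Fin n}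
    (hb : enumK1 τ b = j) :
    amp Δ τ ξ ζ i = link (2 * Δ) (ξ a) (ζ b) / (ξ a + ζ b - 2 * Δ) *
      amp Δ (swapMap τ i j) ξ ζ j := by
  have hj : τ.1 j = none := hb ▸ enumK1_mem τ b
  have hn : ¬(τ.1 i = none ∧ τ.1 j = none) := by simp [hi]
  unfold amp
  rw [swapMap_apply, Equiv.swap_apply_right, hi, Option.elim_some, Option.elim_some, ampSome,
    ampSome, mul_left_comm]
  congr 1
  · refine Finset.prod_congr ?_ fun _ _ => rfl
    ext l
    simp only [Finset.mem_filter, Finset.mem_Ioi]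
    refine and_congr_right fun hl => ⟨fun hh k hk => ?_, fun hh k hk => ?_⟩
    · rw [swapMap_of_gt τ hij hk]
      exact hh k ((lt_iff_of_adjacent hij).2 (Or.inr hk))
    · rcases (lt_iff_of_adjacent hij).1 hk with rfl | hk
      · rw [hj]
        simp
      · rw [← swapMap_of_gt τ hij hk]
        exact hh k hk
  · rw [← Finset.mul_prod_erase (Finset.univ.filter fun b => i < enumK1 τ b) _ (a := b)]
    · congr 1
      refine Finset.prod_congr ?_ fun _ _ => rfl
      ext b'
      simp only [Finset.mem_filter, Finset.mem_erase, Finset.mem_univ, true_and]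
      rw [enumK1_swapMap τ hij hn, lt_iff_of_adjacent hij]
      have hbi : enumK1 τ b' ≠ i := fun hb => by
        have := enumK1_mem τ b'
        rw [hb, hi] at this
        cases this
      by_cases hbb : b' = b
      · subst hbb
        rw [hb, Equiv.swap_apply_right]
        simp only [ne_eq, not_true_eq_false, false_and, false_iff, not_lt]
        rw [Fin.le_def]
        omega
      · have hbj : enumK1 τ b' ≠ j := fun h => hbb ((enumK1 τ).injective (h.trans hb.symm))
        rw [Equiv.swap_apply_of_ne_of_ne hbi hbj]
        simp [hbb, hbj]
    · refine Finset.mem_filter.2 ⟨Finset.mem_univ _, ?_⟩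
      rw [hb, Fin.lt_def]
      omega

theorem prod_split {M : Type*} [CommMonoid M] (g : Fin N → M) (h : i ≠ j) :
    ∏ k, g k = g i * g j * ∏ k ∈ (Finset.univ.erase i).erase j, g k := by
  rw [← Finset.mul_prod_erase Finset.univ g (Finset.mem_univ i),
    ← Finset.mul_prod_erase (Finset.univ.erase i) g (a := j) (by simp [h.symm]), mul_assoc]

end

theorem torusIntegral_comp_swap {m : ℕ} (f : (Fin m → ℂ) → ℂ) (r : ℝ) (a b : Fin m) :
    torusIntegral (fun z => f (z ∘ Equiv.swap a b)) 0 (fun _ => r) =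
      torusIntegral f 0 (fun _ => r) := by
  set e : (Fin m → ℝ) ≃ᵐ (Fin m → ℝ) :=
    MeasurableEquiv.piCongrLeft (fun _ => ℝ) (Equiv.swap a b)
  have he : ∀ θ : Fin m → ℝ, e θ = θ ∘ Equiv.swap a b := by
    intro θ
    funext k
    have := MeasurableEquiv.piCongrLeft_apply_apply (β := fun _ => ℝ) (Equiv.swap a b) θ
      (Equiv.swap a b k)
    rw [Equiv.swap_apply_self] at this
    exact this
  have hem : MeasurePreserving e := volume_measurePreserving_piCongrLeft _ _
  have hpre : e ⁻¹' Icc (0 : Fin m → ℝ) (fun _ => 2 * Real.pi) = Icc 0 fun _ => 2 * Real.pi := by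
    ext θ
    simp only [mem_preimage, he, mem_Icc, Pi.le_def, Function.comp, Pi.zero_apply]
    exact and_congr ((Equiv.swap a b).forall_congr_left (p := fun k => 0 ≤ θ k)).symm
      ((Equiv.swap a b).forall_congr_left (p := fun k => θ k ≤ 2 * Real.pi)).symm
  unfold torusIntegral
  rw [← hem.setIntegral_preimage_emb e.measurableEmbedding, hpre]
  refine setIntegral_congr_fun measurableSet_Icc fun θ _ => ?_
  simp only [he]
  congr 1
  · exact Equiv.prod_comp (Equiv.swap a b) fun k => (r : ℂ) * exp (θ k * I) * I
  · congr 1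
    funext k
    simp [torusMap]

section
variable {N n : ℕ} (Δ : ℝ) (x : ℤ) (τ : maps N n) (ξ : Fin N → ℂ) (ζ : Fin n → ℂ) {i j : Fin N}

theorem coreCoef_swapMap_aux {p q : ℂ} (hs : mapSign (swapMap τ i j).1 = -mapSign τ.1)
    (h : (∏ k, amp Δ τ ξ ζ k) * p = (∏ k, amp Δ (swapMap τ i j) ξ ζ k) * q) :
    coreCoef Δ x τ ξ ζ * p + coreCoef Δ x (swapMap τ i j) ξ ζ * q = 0 := by
  unfold coreCoef coefI
  rw [enumJ1_swapMap, hs]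
  simp only [div_eq_mul_inv]
  set C := mapSign τ.1 * (∏ a, ∏ b, link (2 * Δ) (ξ (enumJ1 τ a)) (ζ b)) *
    detJK Δ (fun a => ξ (enumJ1 τ a)) ζ *
    (scatProd (2 * Δ) (fun a => ξ (enumJ1 τ a)) * scatProd (2 * Δ) ζ)⁻¹ *
    (∏ a, ξ (enumJ1 τ a) ^ x) * (∏ b, ζ b ^ (x - 1)) with hC
  linear_combination C * h

/-- The two-body relation: amplitudes before and after the exchange are in the ratio of the
scattering factors, with opposite signs of the maps. Up to exchanging the roles of `τ` and `swapMap
τ i j`, it suffices to treat `a < a'`, or a nonzero value followed by a zero. -/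
theorem coreCoef_add_swapMap (hij : (j : ℕ) = i + 1) (hn : ¬(τ.1 i = none ∧ τ.1 j = none))
    (hξ : ∀ a b, scat (2 * Δ) (ξ a) (ξ b) ≠ 0) (hζ : ∀ b, ζ b ≠ 0)
    (hl : ∀ a b, ξ a + ζ b - 2 * Δ ≠ 0) :
    coreCoef Δ x τ ξ ζ * scat (2 * Δ) (waveMult τ ξ ζ j) (waveMult τ ξ ζ i) +
      coreCoef Δ x (swapMap τ i j) ξ ζ *
        scat (2 * Δ) (waveMult τ ξ ζ i) (waveMult τ ξ ζ j) = 0 := by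
  have hne : i ≠ j := fun h => by rw [h] at hij; omega
  have hrest : ∀ τ : maps N n, ¬(τ.1 i = none ∧ τ.1 j = none) →
      ∏ k ∈ (Finset.univ.erase i).erase j, amp Δ (swapMap τ i j) ξ ζ k =
        ∏ k ∈ (Finset.univ.erase i).erase j, amp Δ τ ξ ζ k := by
    intro τ hn
    refine Finset.prod_congr rfl fun k hk => ?_
    simp only [Finset.mem_erase, Finset.mem_univ, and_true] at hk
    exact amp_swapMap τ Δ ξ ζ hij hn hk.2 hk.1
  have key1 : ∀ (τ : maps N n) {a a' : Fin N}, τ.1 i = some a → τ.1 j = some a' → a < a' →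
      coreCoef Δ x τ ξ ζ * scat (2 * Δ) (waveMult τ ξ ζ j) (waveMult τ ξ ζ i) +
      coreCoef Δ x (swapMap τ i j) ξ ζ *
        scat (2 * Δ) (waveMult τ ξ ζ i) (waveMult τ ξ ζ j) = 0 := by
    intro τ a a' hi hj h
    refine coreCoef_swapMap_aux Δ x τ ξ ζ (mapSign_swapMap_some τ hij hi hj h) ?_
    rw [prod_split _ hne, prod_split (fun k => amp Δ (swapMap τ i j) ξ ζ k) hne,
      hrest τ (by simp [hi]), waveMult_some _ _ _ hi, waveMult_some _ _ _ hj,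
      amp_swapMap_left τ Δ ξ ζ hij hi hj h, amp_swapMap_right τ Δ ξ ζ hij hi hj h]
    have := hξ a a'
    field_simp
  have key2 : ∀ (τ : maps N n) {a : Fin N}, τ.1 i = some a → τ.1 j = none →
      coreCoef Δ x τ ξ ζ * scat (2 * Δ) (waveMult τ ξ ζ j) (waveMult τ ξ ζ i) +
      coreCoef Δ x (swapMap τ i j) ξ ζ *
        scat (2 * Δ) (waveMult τ ξ ζ i) (waveMult τ ξ ζ j) = 0 := by
    intro τ a hi hj
    refine coreCoef_swapMap_aux Δ x τ ξ ζ (mapSign_swapMap_none τ hij hi hj) ?_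
    obtain ⟨b, hb⟩ := exists_enumK1 τ hj
    have h1 : amp Δ τ ξ ζ j = 1 := by rw [amp, hj, Option.elim_none]
    have h2 : amp Δ (swapMap τ i j) ξ ζ i = 1 := by
      rw [amp, swapMap_apply, Equiv.swap_apply_left, hj, Option.elim_none]
    rw [prod_split _ hne, prod_split (fun k => amp Δ (swapMap τ i j) ξ ζ k) hne,
      hrest τ (by simp [hi]), waveMult_some _ _ _ hi, ← hb, waveMult_enumK1, hb,
      amp_swapMap_enumK1 τ Δ ξ ζ hij hi hb, h1, h2]
    -- With one multiplier equal to `1/ζ`, the scattering factors in the two orders are `(ξ + ζ -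
    -- c)/ζ` and `(ξ + ζ - cξζ)/ζ`; their ratio is the link factor of the amplitude.
    have h3 := hζ b
    have h4 := hl a b
    unfold scat link
    field_simp
    ring
  have hsymm : ∀ τ : maps N n, ¬(τ.1 i = none ∧ τ.1 j = none) →
      coreCoef Δ x (swapMap τ i j) ξ ζ *
        scat (2 * Δ) (waveMult (swapMap τ i j) ξ ζ j) (waveMult (swapMap τ i j) ξ ζ i) +
      coreCoef Δ x (swapMap (swapMap τ i j) i j) ξ ζ *
        scat (2 * Δ) (waveMult (swapMap τ i j) ξ ζ i) (waveMult (swapMap τ i j) ξ ζ j) = 0 →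
      coreCoef Δ x τ ξ ζ * scat (2 * Δ) (waveMult τ ξ ζ j) (waveMult τ ξ ζ i) +
      coreCoef Δ x (swapMap τ i j) ξ ζ *
        scat (2 * Δ) (waveMult τ ξ ζ i) (waveMult τ ξ ζ j) = 0 := by
    intro τ hn h
    rw [swapMap_swapMap, waveMult_swapMap τ hij hn, waveMult_swapMap τ hij hn,
      Equiv.swap_apply_left, Equiv.swap_apply_right] at h
    rw [add_comm]
    exact h
  have hsi : (swapMap τ i j).1 i = τ.1 j := by rw [swapMap_apply, Equiv.swap_apply_left]
  have hsj : (swapMap τ i j).1 j = τ.1 i := by rw [swapMap_apply, Equiv.swap_apply_right]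
  cases hi : τ.1 i with
  | none =>
    cases hj : τ.1 j with
    | none => exact absurd ⟨hi, hj⟩ hn
    | some a' => exact hsymm τ hn (key2 _ (hsi.trans hj) (hsj.trans hi))
  | some a =>
    cases hj : τ.1 j with
    | none => exact key2 τ hi hj
    | some a' =>
      rcases lt_trichotomy a a' with h | h | h
      · exact key1 τ hi hj h
      · exact absurd (maps_injective τ hi (h ▸ hj)) hne
      · exact hsymm τ hn (key1 _ (hsi.trans hj) (hsj.trans hi) h)

variable {b b' : Fin n}

theorem enumK1_succ_of_adjacent (hij : (j : ℕ) = i + 1) (hb : enumK1 τ b = i)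
    (hb' : enumK1 τ b' = j) : (b' : ℕ) = b + 1 := by
  have h1 : b < b' := (enumK1 τ).lt_iff_lt.1 (by rw [hb, hb', Fin.lt_def]; omega)
  rw [Fin.lt_def] at h1
  by_contra h2
  have hlt : (b : ℕ) + 1 < n := by omega
  have h3 : enumK1 τ b < enumK1 τ ⟨b + 1, hlt⟩ :=
    (enumK1 τ).strictMono (by rw [Fin.lt_def]; simp)
  have h4 : enumK1 τ ⟨b + 1, hlt⟩ < enumK1 τ b' :=
    (enumK1 τ).strictMono (by rw [Fin.lt_def]; simp only; omega)
  rw [hb, Fin.lt_def] at h3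
  rw [hb', Fin.lt_def] at h4
  omega

theorem enumK1_swap_apply (hb : enumK1 τ b = i) (hb' : enumK1 τ b' = j) (b0 : Fin n) :
    enumK1 τ (Equiv.swap b b' b0) = Equiv.swap i j (enumK1 τ b0) := by
  by_cases h1 : b0 = b
  · rw [h1, Equiv.swap_apply_left, hb, hb', Equiv.swap_apply_left]
  by_cases h2 : b0 = b'
  · rw [h2, Equiv.swap_apply_right, hb, hb', Equiv.swap_apply_right]
  rw [Equiv.swap_apply_of_ne_of_ne h1 h2, Equiv.swap_apply_of_ne_of_ne]
  · exact fun h => h1 ((enumK1 τ).injective (h.trans hb.symm))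
  · exact fun h => h2 ((enumK1 τ).injective (h.trans hb'.symm))

theorem waveMult_comp_swap (hb : enumK1 τ b = i) (hb' : enumK1 τ b' = j) (k : Fin N) :
    waveMult τ ξ (ζ ∘ Equiv.swap b b') k = waveMult τ ξ ζ (Equiv.swap i j k) := by
  cases hk : τ.1 k with
  | none =>
    obtain ⟨b0, rfl⟩ := exists_enumK1 τ hk
    rw [waveMult_enumK1, ← enumK1_swap_apply τ hb hb', waveMult_enumK1]
    rfl
  | some a =>
    have h1 : k ≠ i := fun h => by
      have := enumK1_mem τ b
      rw [hb, ← h, hk] at this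
      cases this
    have h2 : k ≠ j := fun h => by
      have := enumK1_mem τ b'
      rw [hb', ← h, hk] at this
      cases this
    rw [Equiv.swap_apply_of_ne_of_ne h1 h2, waveMult_some _ _ _ hk, waveMult_some _ _ _ hk]

theorem amp_comp_swap (hij : (j : ℕ) = i + 1) (hb : enumK1 τ b = i) (hb' : enumK1 τ b' = j)
    (k : Fin N) : amp Δ τ ξ (ζ ∘ Equiv.swap b b') k = amp Δ τ ξ ζ k := by
  unfold amp ampSome
  cases hk : τ.1 k with
  | none => rfl
  | some a =>
    simp only [Option.elim_some]
    congr 1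
    have h1 : k ≠ i := fun h => by
      have := enumK1_mem τ b
      rw [hb, ← h, hk] at this
      cases this
    have h2 : k ≠ j := fun h => by
      have := enumK1_mem τ b'
      rw [hb', ← h, hk] at this
      cases this
    refine Finset.prod_equiv (Equiv.swap b b') (fun b0 => ?_) fun _ _ => rfl
    simp only [Finset.mem_filter, Finset.mem_univ, true_and]
    rw [enumK1_swap_apply τ hb hb', lt_swap_iff hij h1 h2]

/-- For two neighbours in `K_1` the exchange acts on the variables `ζ`. The determinant is
antisymmetric, the links and amplitudes are symmetric, and `scatProd` changes by the scattering
ratio. -/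
theorem coreCoef_add_comp_swap (hij : (j : ℕ) = i + 1) (hb : enumK1 τ b = i)
    (hb' : enumK1 τ b' = j) (hζ : ∀ b, ζ b ≠ 0) (hs : ∀ b b', scat (2 * Δ) (ζ b) (ζ b') ≠ 0) :
    coreCoef Δ x τ ξ ζ * scat (2 * Δ) (waveMult τ ξ ζ j) (waveMult τ ξ ζ i) +
      coreCoef Δ x τ ξ (ζ ∘ Equiv.swap b b') *
        scat (2 * Δ) (waveMult τ ξ ζ i) (waveMult τ ξ ζ j) = 0 := by
  have hbb := enumK1_succ_of_adjacent τ hij hb hb'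
  have hne : b ≠ b' := fun h => by rw [h] at hbb; omega
  have h1 : ∏ a, ∏ b0, link (2 * Δ) (ξ (enumJ1 τ a)) ((ζ ∘ Equiv.swap b b') b0) =
      ∏ a, ∏ b0, link (2 * Δ) (ξ (enumJ1 τ a)) (ζ b0) :=
    Finset.prod_congr rfl fun a _ =>
      Equiv.prod_comp (Equiv.swap b b') fun b0 => link (2 * Δ) (ξ (enumJ1 τ a)) (ζ b0)
  have h2 : detJK Δ (fun a => ξ (enumJ1 τ a)) (ζ ∘ Equiv.swap b b') =
      -detJK Δ (fun a => ξ (enumJ1 τ a)) ζ := by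
    have := Matrix.det_permute' (Equiv.swap b b')
      (Matrix.of fun a b : Fin n => dFun Δ (ξ (enumJ1 τ a)) (ζ b))
    rw [Equiv.Perm.sign_swap hne] at this
    simp only [Units.val_neg, Units.val_one, Int.cast_neg, Int.cast_one, neg_one_mul] at this
    exact this
  have h3 := scatProd_swap hbb (2 * Δ) ζ
  have h4 : ∏ b0, (ζ ∘ Equiv.swap b b') b0 ^ (x - 1) = ∏ b0, ζ b0 ^ (x - 1) :=
    Equiv.prod_comp (Equiv.swap b b') fun b0 => ζ b0 ^ (x - 1)
  have h5 := waveMult_enumK1 τ ξ ζ b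
  have h6 := waveMult_enumK1 τ ξ ζ b'
  rw [hb] at h5
  rw [hb'] at h6
  unfold coreCoef coefI
  simp_rw [amp_comp_swap Δ τ ξ ζ hij hb hb']
  rw [h1, h2, h4, h5, h6]
  have z1 := hζ b
  have z2 := hζ b'
  -- Inverting both momenta reverses the order of the arguments, up to a factor symmetric in the
  -- two.
  have e1 : scat (2 * Δ) (ζ b')⁻¹ (ζ b)⁻¹ = scat (2 * Δ) (ζ b) (ζ b') * ((ζ b)⁻¹ * (ζ b')⁻¹) := by
    unfold scat
    field_simp
    ring
  have e2 : scat (2 * Δ) (ζ b)⁻¹ (ζ b')⁻¹ = scat (2 * Δ) (ζ b') (ζ b) * ((ζ b)⁻¹ * (ζ b')⁻¹) := by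
    unfold scat
    field_simp
    ring
  have e3 : (scatProd (2 * Δ) ζ)⁻¹ * scat (2 * Δ) (ζ b) (ζ b') =
      (scatProd (2 * Δ) (ζ ∘ Equiv.swap b b'))⁻¹ * scat (2 * Δ) (ζ b') (ζ b) := by
    have n1 : scatProd (2 * Δ) ζ ≠ 0 := Finset.prod_ne_zero_iff.2 fun i _ =>
      Finset.prod_ne_zero_iff.2 fun j _ => hs i j
    have n2 : scatProd (2 * Δ) (ζ ∘ Equiv.swap b b') ≠ 0 := Finset.prod_ne_zero_iff.2 fun i _ =>
      Finset.prod_ne_zero_iff.2 fun j _ => hs _ _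
    field_simp
    linear_combination h3
  rw [e1, e2]
  simp only [div_eq_mul_inv, mul_inv]
  set C := mapSign τ.1 * (∏ a, ∏ b, link (2 * Δ) (ξ (enumJ1 τ a)) (ζ b)) *
    detJK Δ (fun a => ξ (enumJ1 τ a)) ζ * (scatProd (2 * Δ) (fun a => ξ (enumJ1 τ a)))⁻¹ *
    (∏ a, ξ (enumJ1 τ a) ^ x) * (∏ b, ζ b ^ (x - 1)) * (∏ k, amp Δ τ ξ ζ k) *
    ((ζ b)⁻¹ * (ζ b')⁻¹) with hC
  linear_combination C * e3

end

section
variable {m : ℕ} {r : ℝ}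

theorem contourIntegral_congr (hr : 0 < r) {f g : (Fin m → ℂ) → ℂ}
    (h : ∀ z, (∀ i, ‖z i‖ = r) → f z = g z) : contourIntegral m r f = contourIntegral m r g := by
  rw [contourIntegral, contourIntegral, torusIntegral_congr (fun _ => hr) h]

theorem contourIntegral_finsetSum {ι : Type*} (s : Finset ι) {f : ι → (Fin m → ℂ) → ℂ}
    (hf : ∀ i ∈ s, Continuous fun θ => f i (torusMap 0 (fun _ => r) θ)) :
    contourIntegral m r (fun z => ∑ i ∈ s, f i z) = ∑ i ∈ s, contourIntegral m r (f i) := by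
  simp only [contourIntegral]
  rw [torusIntegral_finsetSum s hf, Finset.mul_sum]

theorem contourIntegral_const_mul (a : ℂ) (f : (Fin m → ℂ) → ℂ) :
    contourIntegral m r (fun z => a * f z) = a * contourIntegral m r f := by
  simp only [contourIntegral]
  rw [torusIntegral_const_mul]
  ring

theorem contourIntegral_add_sub (c : ℂ) {f g h : (Fin m → ℂ) → ℂ}
    (hf : Continuous fun θ => f (torusMap 0 (fun _ => r) θ))
    (hg : Continuous fun θ => g (torusMap 0 (fun _ => r) θ))
    (hh : Continuous fun θ => h (torusMap 0 (fun _ => r) θ)) :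
    contourIntegral m r f + contourIntegral m r g - c * contourIntegral m r h =
      contourIntegral m r fun z => f z + g z - c * h z := by
  have h1 := torusIntegrable_of_continuous (ρ := fun _ => r) hf
  have h2 := torusIntegrable_of_continuous (ρ := fun _ => r) hg
  have h3 := torusIntegrable_of_continuous (f := fun z => c * h z) (ρ := fun _ => r)
    (continuous_const.mul hh)
  have h4 : TorusIntegrable (fun z => f z + g z) 0 fun _ : Fin m => r := h1.add h2
  simp only [contourIntegral]
  rw [torusIntegral_sub h4 h3, torusIntegral_add h1 h2, torusIntegral_const_mul]
  ring

end

/-! ### Free action and boundary condition for the plane waves -/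

section
variable {N n : ℕ}

theorem prod_zpow_update {w : Fin N → ℂ} (hw : ∀ k, w k ≠ 0) (X : Fin N → ℤ) (i : Fin N) (v : ℤ) :
    ∏ k, w k ^ Function.update X i v k = (∏ k, w k ^ X k) * w i ^ (v - X i) := by
  rw [← Finset.mul_prod_erase Finset.univ _ (Finset.mem_univ i),
    ← Finset.mul_prod_erase Finset.univ (fun k => w k ^ X k) (Finset.mem_univ i),
    Function.update_self, Finset.prod_congr rfl fun k hk => by
      rw [Function.update_of_ne (Finset.ne_of_mem_erase hk)], zpow_sub₀ (hw i)]
  have := zpow_ne_zero (X i) (hw i)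
  field_simp

variable {Δ : ℝ} {x : ℤ} {τ : maps N n} {ξ : Fin N → ℂ} {ζ : Fin n → ℂ}

theorem core_update (hξ : ∀ j, ξ j ≠ 0) (hζ : ∀ b, ζ b ≠ 0) (X : Fin N → ℤ) (i : Fin N) (v : ℤ) :
    core Δ x τ ξ ζ (Function.update X i v) =
      core Δ x τ ξ ζ X * waveMult τ ξ ζ i ^ (v - X i) := by
  rw [core_eq_wave Δ x τ ξ ζ hζ, core_eq_wave Δ x τ ξ ζ hζ,
    prod_zpow_update (waveMult_ne_zero τ ξ ζ hξ hζ)]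
  ring

theorem core_free (hξ : ∀ j, ξ j ≠ 0) (hζ : ∀ b, ζ b ≠ 0) (X : Fin N → ℤ) :
    ∑ i, (core Δ x τ ξ ζ (Function.update X i (X i + 1)) +
        core Δ x τ ξ ζ (Function.update X i (X i - 1)) - 2 * Δ * core Δ x τ ξ ζ X) =
      core Δ x τ ξ ζ X * mapEnergy Δ τ ξ ζ := by
  rw [mapEnergy_eq_sum, Finset.mul_sum]
  refine Finset.sum_congr rfl fun i _ => ?_
  rw [core_update hξ hζ, core_update hξ hζ, add_sub_cancel_left, sub_sub_cancel_left, zpow_one,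
    zpow_neg_one, energy]
  ring

/-- The defect equals the wave times `w_i + 1/w_j - c = scat(w_j, w_i) / w_j`. Absorbing `1/w_j`
makes the exponents at `i` and `j` equal, so the remaining monomial is invariant under exchanging
the two multipliers. -/
theorem core_boundary (hξ : ∀ j, ξ j ≠ 0) (hζ : ∀ b, ζ b ≠ 0) {X : Fin N → ℤ} {i j : Fin N}
    (hX : X j = X i + 1) :
    core Δ x τ ξ ζ (Function.update X i (X i + 1)) +
        core Δ x τ ξ ζ (Function.update X j (X j - 1)) - 2 * Δ * core Δ x τ ξ ζ X =
      coreCoef Δ x τ ξ ζ * scat (2 * Δ) (waveMult τ ξ ζ j) (waveMult τ ξ ζ i) *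
        ∏ k, waveMult τ ξ ζ k ^ Function.update X j (X i) k := by
  have hw := waveMult_ne_zero τ ξ ζ hξ hζ
  rw [core_update hξ hζ, core_update hξ hζ, add_sub_cancel_left, sub_sub_cancel_left, zpow_one,
    zpow_neg_one, core_eq_wave Δ x τ ξ ζ hζ, prod_zpow_update hw, hX,
    show X i - (X i + 1) = -1 by ring, zpow_neg_one, scat]
  have := hw j
  field_simp
  ring

theorem prod_wave_swap {w w' : Fin N → ℂ} {i j : Fin N} (h : ∀ k, w' k = w (Equiv.swap i j k))
    (X : Fin N → ℤ) :
    ∏ k, w' k ^ Function.update X j (X i) k = ∏ k, w k ^ Function.update X j (X i) k := by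
  simp_rw [h]
  rw [← Equiv.prod_comp (Equiv.swap i j) fun k => w k ^ Function.update X j (X i) k]
  refine Finset.prod_congr rfl fun k _ => ?_
  congr 1
  by_cases hi : k = i
  · subst hi
    rw [Equiv.swap_apply_left, Function.update_self]
    by_cases hj : k = j
    · subst hj; simp
    · rw [Function.update_of_ne hj]
  by_cases hj : k = j
  · subst hj
    rw [Equiv.swap_apply_right, Function.update_self, Function.update_of_ne (Ne.symm hi)]
  · rw [Equiv.swap_apply_of_ne_of_ne hi hj]

theorem sum_energy_swap {w w' : Fin N → ℂ} {i j : Fin N}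
    (h : ∀ k, w' k = w (Equiv.swap i j k)) :
    ∑ k, energy Δ (w' k) = ∑ k, energy Δ (w k) := by
  simp_rw [h]
  exact Equiv.sum_comp (Equiv.swap i j) fun k => energy Δ (w k)

end

section
variable {N n : ℕ} {Δ R R' : ℝ} {ξ : Fin N → ℂ}

theorem continuous_mapEnergy (τ : maps N n) {T : Type*} [TopologicalSpace T] {u : T → Fin N → ℂ}
    {v : T → Fin n → ℂ} (hu : Continuous u) (hv : Continuous v) (hu0 : ∀ s j, u s j ≠ 0)
    (hv0 : ∀ s b, v s b ≠ 0) : Continuous fun s => mapEnergy Δ τ (u s) (v s) := by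
  have h1 : ∀ {f : T → ℂ}, Continuous f → (∀ s, f s ≠ 0) → Continuous fun s => energy Δ (f s) :=
    fun hf h0 => (hf.add (hf.inv₀ h0)).sub continuous_const
  unfold mapEnergy
  refine (continuous_finsetSum _ fun b _ => h1 (by fun_prop) fun s => hv0 s b).add
    (continuous_finsetSum _ fun k _ => ?_)
  cases τ.1 k with
  | none => exact continuous_const
  | some a => exact h1 (by fun_prop) fun s => hu0 s a

theorem continuous_core_mul_mapEnergy (hR : 1 + ‖(2 * Δ : ℂ)‖ < R)
    (hcR : 4 < ‖(2 * Δ : ℂ)‖ * R) (hξ : ∀ j, ‖ξ j‖ = R) (hR' : R + ‖(2 * Δ : ℂ)‖ + 1 < R')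
    (x : ℤ) (τ : maps N n) (l : ℕ) (Y : Fin N → ℤ) :
    Continuous fun θ => core Δ x τ ξ (torusMap 0 (fun _ => R') θ) Y *
      mapEnergy Δ τ ξ (torusMap 0 (fun _ => R') θ) ^ l := by
  have hc := norm_nonneg (2 * Δ : ℂ)
  refine (continuous_core_torus hR hcR hξ x τ Y fun _ => hR').mul
    ((continuous_mapEnergy τ continuous_const (continuous_torusMap _)
      (fun _ j => ne_zero_of_large (c := 2 * Δ) (by rw [hξ]; exact hR)) fun θ b => ?_).pow l)
  refine ne_zero_of_large (c := 2 * Δ) ?_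
  rw [torusMap_mem fun _ => by linarith]
  linarith

/-- The `ζ`-integral of the waves for the maps with `n` zeros, with `l` powers of the energy. -/
def waveIntegral (Δ : ℝ) (x : ℤ) (R' : ℝ) (ξ : Fin N → ℂ) (n l : ℕ) (Y : Fin N → ℤ) : ℂ :=
  ∑ τ : maps N n, contourIntegral n R' fun ζ => core Δ x τ ξ ζ Y * mapEnergy Δ τ ξ ζ ^ l

/-- Only the sum over `τ` satisfies the condition: the defects of `τ` and of `τ` with the values at
`i` and `j` exchanged are opposite. Powers of the energy do no harm, being symmetric in the
multipliers. -/
theorem boundaryCondition_waveIntegral (hR : 1 + ‖(2 * Δ : ℂ)‖ < R)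
    (hcR : 4 < ‖(2 * Δ : ℂ)‖ * R) (hξ : ∀ j, ‖ξ j‖ = R) (hR' : R + ‖(2 * Δ : ℂ)‖ + 1 < R')
    (x : ℤ) (n l : ℕ) : BoundaryCondition Δ (waveIntegral Δ x R' ξ n l) := by
  intro X i j hij hX
  have hc := norm_nonneg (2 * Δ : ℂ)
  have hR0' : 0 < R' := by linarith
  have hξl : ∀ j, 1 + ‖(2 * Δ : ℂ)‖ < ‖ξ j‖ := fun j => by rw [hξ]; exact hR
  have hξ0 : ∀ j, ξ j ≠ 0 := fun j => ne_zero_of_large (hξl j)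
  have hζl : ∀ ζ : Fin n → ℂ, (∀ b, ‖ζ b‖ = R') → ∀ b, 1 + ‖(2 * Δ : ℂ)‖ < ‖ζ b‖ :=
    fun ζ h b => by rw [h]; linarith
  have hζ0 : ∀ ζ : Fin n → ℂ, (∀ b, ‖ζ b‖ = R') → ∀ b, ζ b ≠ 0 := fun ζ h b =>
    ne_zero_of_large (hζl ζ h b)
  have hne : i ≠ j := fun h => by rw [h] at hij; omega
  set T : maps N n → (Fin n → ℂ) → ℂ := fun τ ζ =>
    coreCoef Δ x τ ξ ζ * scat (2 * Δ) (waveMult τ ξ ζ j) (waveMult τ ξ ζ i) *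
      (∏ k, waveMult τ ξ ζ k ^ Function.update X j (X i) k) *
      (∑ k, energy Δ (waveMult τ ξ ζ k)) ^ l with hT
  have hcont := fun (τ : maps N n) Y => continuous_core_mul_mapEnergy hR hcR hξ hR' x τ l Y
  have h1 : ∀ τ : maps N n,
      contourIntegral n R' (fun ζ => core Δ x τ ξ ζ (Function.update X i (X i + 1)) *
        mapEnergy Δ τ ξ ζ ^ l) +
      contourIntegral n R' (fun ζ => core Δ x τ ξ ζ (Function.update X j (X j - 1)) *
        mapEnergy Δ τ ξ ζ ^ l) -
      2 * Δ * contourIntegral n R' (fun ζ => core Δ x τ ξ ζ X * mapEnergy Δ τ ξ ζ ^ l) =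
      contourIntegral n R' (T τ) := by
    intro τ
    rw [contourIntegral_add_sub _ (hcont τ _) (hcont τ _) (hcont τ _)]
    refine contourIntegral_congr hR0' fun ζ hζ => ?_
    have := core_boundary (Δ := Δ) (x := x) (τ := τ) hξ0 (hζ0 ζ hζ) hX
    simp only [hT]
    rw [← this, mapEnergy_eq_sum]
    ring
  -- If both particles lie in `K_1`, exchanging their variables preserves the integral but reverses
  -- the sign of the integrand, so the integral is its own negative.
  have hnone : ∀ τ : maps N n, τ.1 i = none → τ.1 j = none → contourIntegral n R' (T τ) = 0 := by
    intro τ hi hj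
    obtain ⟨b, hb⟩ := exists_enumK1 τ hi
    obtain ⟨b', hb'⟩ := exists_enumK1 τ hj
    have h2 : contourIntegral n R' (fun ζ => T τ (ζ ∘ Equiv.swap b b')) =
        contourIntegral n R' (T τ) := by
      rw [contourIntegral, contourIntegral, torusIntegral_comp_swap]
    have h3 : contourIntegral n R' (fun ζ => T τ (ζ ∘ Equiv.swap b b')) =
        -contourIntegral n R' (T τ) := by
      rw [← neg_one_mul, ← contourIntegral_const_mul]
      refine contourIntegral_congr hR0' fun ζ hζ => ?_
      have h4 := coreCoef_add_comp_swap Δ x τ ξ ζ hij hb hb' (hζ0 ζ hζ)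
        fun b b' => scat_ne_zero (hζl ζ hζ b) (hζl ζ hζ b')
      have h5 := waveMult_comp_swap τ ξ ζ hb hb'
      simp only [hT]
      rw [prod_wave_swap h5, sum_energy_swap h5, h5, h5, Equiv.swap_apply_left,
        Equiv.swap_apply_right]
      linear_combination ((∏ k, waveMult τ ξ ζ k ^ Function.update X j (X i) k) *
        (∑ k, energy Δ (waveMult τ ξ ζ k)) ^ l) * h4
    have h4 := h2.symm.trans h3
    exact self_eq_neg.1 h4
  have h2 : ∀ τ : maps N n, contourIntegral n R' (T τ) +
      contourIntegral n R' (T (swapMap τ i j)) = 0 := by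
    intro τ
    by_cases hn : τ.1 i = none ∧ τ.1 j = none
    · have hsi : (swapMap τ i j).1 i = none := by rw [swapMap_apply, Equiv.swap_apply_left, hn.2]
      have hsj : (swapMap τ i j).1 j = none := by rw [swapMap_apply, Equiv.swap_apply_right, hn.1]
      rw [hnone τ hn.1 hn.2, hnone _ hsi hsj, add_zero]
    · rw [← neg_eq_iff_add_eq_zero, ← neg_one_mul, ← contourIntegral_const_mul]
      refine contourIntegral_congr hR0' fun ζ hζ => ?_
      have h4 := coreCoef_add_swapMap Δ x τ ξ ζ hij hn (fun a b => scat_ne_zero (hξl a) (hξl b))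
        (hζ0 ζ hζ) fun a b => add_sub_ne_zero (hξ a) (by rw [hζ]; linarith)
      have h5 := waveMult_swapMap τ hij hn ξ ζ
      simp only [hT]
      rw [prod_wave_swap h5, sum_energy_swap h5, h5, h5, Equiv.swap_apply_left,
        Equiv.swap_apply_right]
      linear_combination (-(∏ k, waveMult τ ξ ζ k ^ Function.update X j (X i) k) *
        (∑ k, energy Δ (waveMult τ ξ ζ k)) ^ l) * h4
  unfold waveIntegral
  rw [Finset.mul_sum, ← Finset.sum_add_distrib, ← Finset.sum_sub_distrib]
  rw [Finset.sum_congr rfl fun τ _ => h1 τ]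
  refine Finset.sum_involution (fun τ _ => swapMap τ i j) (fun τ _ => h2 τ) (fun τ _ hτ he => ?_)
    (fun _ _ => Finset.mem_univ _) fun τ _ => swapMap_swapMap τ i j
  refine hτ ?_
  -- A fixed point of the involution has equal values at `i` and `j`; injectivity off zero forces
  -- both to be zero.
  have h3 : τ.1 i = τ.1 j := by
    conv_lhs => rw [← he]
    rw [swapMap_apply, Equiv.swap_apply_left]
  cases hi : τ.1 i with
  | none => exact hnone τ hi (h3 ▸ hi)
  | some a => exact absurd (maps_injective τ hi (h3 ▸ hi)) hne

theorem hamAct_waveIntegral (hR : 1 + ‖(2 * Δ : ℂ)‖ < R)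
    (hcR : 4 < ‖(2 * Δ : ℂ)‖ * R) (hξ : ∀ j, ‖ξ j‖ = R) (hR' : R + ‖(2 * Δ : ℂ)‖ + 1 < R')
    (x : ℤ) (n l : ℕ) (X : Config N) :
    hamAct Δ (fun X' => waveIntegral Δ x R' ξ n l X'.1) X =
      waveIntegral Δ x R' ξ n (l + 1) X.1 := by
  have hc := norm_nonneg (2 * Δ : ℂ)
  have hR0' : 0 < R' := by linarith
  have hξ0 : ∀ j, ξ j ≠ 0 := fun j =>
    ne_zero_of_large (c := 2 * Δ) (by rw [hξ]; exact hR)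
  rw [hamAct_eq_free _ (boundaryCondition_waveIntegral hR hcR hξ hR' x n l)]
  have hcont := fun (τ : maps N n) Y => continuous_core_mul_mapEnergy hR hcR hξ hR' x τ l Y
  unfold waveIntegral
  simp_rw [Finset.mul_sum, ← Finset.sum_add_distrib, ← Finset.sum_sub_distrib]
  rw [Finset.sum_comm]
  refine Finset.sum_congr rfl fun τ _ => ?_
  rw [Finset.sum_congr rfl fun i _ => contourIntegral_add_sub (2 * (Δ : ℂ))
    (hcont τ (Function.update X.1 i (X.1 i + 1))) (hcont τ (Function.update X.1 i (X.1 i - 1)))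
    (hcont τ X.1), ← contourIntegral_finsetSum]
  · refine contourIntegral_congr hR0' fun ζ hζ => ?_
    have := core_free (Δ := Δ) (x := x) (τ := τ) (ζ := ζ) hξ0
      (fun b => ne_zero_of_large (c := 2 * Δ) (by rw [hζ]; linarith)) X.1
    refine Eq.trans ?_ ((congrArg (· * mapEnergy Δ τ ξ ζ ^ l) this).trans (by ring))
    simp only [Finset.sum_mul]
    refine Finset.sum_congr rfl fun i _ => ?_
    ring
  · exact fun i _ => ((hcont τ _).add (hcont τ _)).sub (continuous_const.mul (hcont τ _))

end

/-! ### Maps without zeros are permutations -/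

/-- Unordered pairs of indices are listed through `σ`; the conditional restores the order in which
`f` takes its arguments. -/
theorem prod_Ioi_perm {M : Type*} [CommMonoid M] {N : ℕ} (σ : Equiv.Perm (Fin N))
    (f : Fin N → Fin N → M) :
    ∏ i, ∏ j ∈ Finset.Ioi i, f i j =
      ∏ l, ∏ k ∈ Finset.Ioi l, if σ l < σ k then f (σ l) (σ k) else f (σ k) (σ l) := by
  have key : ∀ g : Fin N → Fin N → M, (∀ i, g i i = 1) →
      ∏ i, ∏ j, g i j = ∏ l, ∏ k ∈ Finset.Ioi l, g l k * g k l := by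
    intro g hg
    have h := Finset.prod_prod_Ioi_mul_eq_prod_prod_off_diag fun i j => g j i
    rw [h]
    refine Finset.prod_congr rfl fun i _ => ?_
    rw [← Finset.prod_compl_mul_prod {i}, Finset.prod_singleton, hg, mul_one]
  set g : Fin N → Fin N → M := fun i j => if i < j then f i j else 1 with hg
  have h1 : ∏ i, ∏ j ∈ Finset.Ioi i, f i j = ∏ i, ∏ j, g i j := by
    refine Finset.prod_congr rfl fun i _ => ?_
    rw [← Finset.prod_filter]
    congr 1
    ext j
    simp
  have h2 : ∏ i, ∏ j, g i j = ∏ l, ∏ k, g (σ l) (σ k) := by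
    rw [← Equiv.prod_comp σ]
    exact Finset.prod_congr rfl fun i _ => (Equiv.prod_comp σ (g (σ i))).symm
  rw [h1, h2, key _ fun i => if_neg (lt_irrefl _)]
  refine Finset.prod_congr rfl fun l _ => Finset.prod_congr rfl fun k hk => ?_
  rcases lt_or_gt_of_ne (σ.injective.ne (Finset.mem_Ioi.1 hk).ne) with h | h
  · simp [hg, h, h.not_gt]
  · simp [hg, h, h.not_gt]

section
variable {N : ℕ}

/-- The map without zeros that belongs to a permutation. -/
def permMap (σ : Equiv.Perm (Fin N)) : maps N 0 :=
  ⟨fun k => some (σ k), by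
    refine Finset.mem_filter.2 ⟨Finset.mem_univ _, by simp, fun j => ?_⟩
    rw [Finset.card_le_one]
    intro a ha b hb
    simp only [Finset.mem_filter, Finset.mem_univ, true_and, Option.some.injEq] at ha hb
    exact σ.injective (ha.trans hb.symm)⟩

theorem permMap_apply (σ : Equiv.Perm (Fin N)) (k : Fin N) : (permMap σ).1 k = some (σ k) := rfl

theorem permMap_bijective : Function.Bijective (permMap (N := N)) := by
  constructor
  · intro σ σ' h
    ext k
    have := congrFun (congrArg Subtype.val h) k
    rw [permMap_apply, permMap_apply] at this
    rw [Option.some.inj this]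
  · intro τ
    have h : ∀ k, ∃ a, τ.1 k = some a := fun k =>
      Option.ne_none_iff_exists'.1 (maps_zero_ne_none τ k)
    choose f hf using h
    have hinj : Function.Injective f := fun k k' hk =>
      maps_injective τ (hf k) (by rw [hk]; exact hf k')
    refine ⟨Equiv.ofBijective f (Finite.injective_iff_bijective.1 hinj), Subtype.ext (funext
      fun k => ?_)⟩
    rw [permMap_apply, hf]
    rfl

theorem mapSign_permMap (σ : Equiv.Perm (Fin N)) :
    mapSign (permMap σ).1 = ((Equiv.Perm.sign σ : ℤ) : ℂ) := by
  have h1 : shift (permMap σ).1 = 0 := by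
    have : shift (permMap σ).1 = ∑ k, (((σ k : ℕ) : ℤ) - ((k : ℕ) : ℤ)) := rfl
    rw [this, Finset.sum_sub_distrib, Equiv.sum_comp σ fun k => ((k : ℕ) : ℤ), sub_self]
  rw [mapSign, h1, zpow_zero, one_mul, neg_one_pow_inversions, Equiv.Perm.sign_eq_prod_prod_Ioi]
  push_cast
  refine Finset.prod_congr rfl fun k _ => Finset.prod_congr rfl fun l hl => ?_
  simp only [permMap_apply, Option.some.injEq]
  have hne := σ.injective.ne (Finset.mem_Ioi.1 hl).ne
  by_cases h : σ k < σ l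
  · rw [if_neg, if_pos h]
    · simp
    · rintro ⟨a, b, rfl, rfl, hlt⟩
      exact absurd hlt h.not_gt
  · rw [if_pos ⟨_, _, rfl, rfl, lt_of_le_of_ne (not_lt.1 h) hne.symm⟩, if_neg h]
    simp

variable {Δ : ℝ} {ξ : Fin N → ℂ}

/-- The amplitude of `k` collects a ratio of scattering factors for each earlier `l` with `σ l > σ
k`. Multiplying by `scatProd ξ` reverses exactly these pairs and gives the numerator of the Bethe
function. -/
theorem prod_amp_permMap (σ : Equiv.Perm (Fin N)) (ζ : Fin 0 → ℂ)
    (hξ : ∀ a b, scat (2 * Δ) (ξ a) (ξ b) ≠ 0) :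
    ∏ k, amp Δ (permMap σ) ξ ζ k =
      scatProd (2 * Δ) (fun i => ξ (σ i)) / scatProd (2 * Δ) ξ := by
  have h1 : ∀ k, amp Δ (permMap σ) ξ ζ k = ∏ l, if l < k then (if σ k < σ l then
      scat (2 * Δ) (ξ (σ l)) (ξ (σ k)) / scat (2 * Δ) (ξ (σ k)) (ξ (σ l)) else 1) else 1 := by
    intro k
    rw [amp, permMap_apply, Option.elim_some, ampSome, Finset.univ_eq_empty, Finset.filter_empty,
      Finset.prod_empty, mul_one]
    simp_rw [← ite_and]
    rw [← Finset.prod_filter]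
    symm
    refine Finset.prod_equiv σ (fun l => ?_) fun _ _ => rfl
    simp only [Finset.mem_filter, Finset.mem_univ, true_and, Finset.mem_Ioi, permMap_apply, ne_eq,
      Option.some.injEq, σ.injective.eq_iff]
    constructor
    · rintro ⟨h1, h2⟩
      refine ⟨h2, fun k' hk' h => ?_⟩
      rw [h] at hk'
      exact absurd hk' h1.not_gt
    · rintro ⟨h1, h2⟩
      refine ⟨lt_of_le_of_ne (not_lt.1 fun h => h2 l h rfl) ?_, h1⟩
      rintro rfl
      exact lt_irrefl _ h1
  have h2 : scatProd (2 * Δ) ξ ≠ 0 := Finset.prod_ne_zero_iff.2 fun i _ =>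
      Finset.prod_ne_zero_iff.2 fun j _ => hξ i j
  rw [eq_div_iff h2, Finset.prod_congr rfl fun k _ => h1 k, Finset.prod_comm, scatProd, scatProd,
    prod_Ioi_perm σ fun i j => scat (2 * Δ) (ξ i) (ξ j), ← Finset.prod_mul_distrib]
  refine Finset.prod_congr rfl fun l _ => ?_
  rw [← Finset.prod_filter, show Finset.univ.filter (fun k => l < k) = Finset.Ioi l by ext; simp,
    ← Finset.prod_mul_distrib]
  refine Finset.prod_congr rfl fun k hk => ?_
  rcases lt_or_gt_of_ne (σ.injective.ne (Finset.mem_Ioi.1 hk).ne) with h | h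
  · rw [if_neg h.not_gt, if_pos h, one_mul]
  · rw [if_pos h, if_neg h.not_gt, div_mul_cancel₀ _ (hξ _ _)]

theorem contourIntegral_zero (r : ℝ) (f : (Fin 0 → ℂ) → ℂ) : contourIntegral 0 r f = f 0 := by
  rw [contourIntegral, torusIntegral_dim0]
  simp

theorem mapEnergy_zero (τ : maps N 0) (ζ : Fin 0 → ℂ) :
    mapEnergy Δ τ ξ ζ = ∑ j, energy Δ (ξ j) := by
  obtain ⟨σ, rfl⟩ := permMap_bijective.2 τ
  rw [mapEnergy, Finset.univ_eq_empty, Finset.sum_empty, zero_add]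
  exact Equiv.sum_comp σ fun j => energy Δ (ξ j)

theorem waveIntegral_zero (x : ℤ) (R' : ℝ) (l : ℕ) (X : Fin N → ℤ) :
    waveIntegral Δ x R' ξ 0 l X =
      waveIntegral Δ x R' ξ 0 0 X * (∑ j, energy Δ (ξ j)) ^ l := by
  unfold waveIntegral
  rw [Finset.sum_mul]
  refine Finset.sum_congr rfl fun τ _ => ?_
  rw [contourIntegral_zero, contourIntegral_zero, mapEnergy_zero, pow_zero, mul_one]

theorem waveIntegral_zero_eq_betheIntegrand (x : ℤ) (R' : ℝ) (X Y : Fin N → ℤ)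
    (hξ : ∀ a b, scat (2 * Δ) (ξ a) (ξ b) ≠ 0) (hξ0 : ∀ j, ξ j ≠ 0) :
    waveIntegral Δ x R' ξ 0 0 X * ∏ j, ξ j ^ (-Y j - 1) = betheIntegrand (2 * Δ) X Y ξ := by
  unfold waveIntegral betheIntegrand
  rw [← permMap_bijective.sum_comp, Finset.sum_mul, Finset.sum_div]
  refine Finset.sum_congr rfl fun σ _ => ?_
  rw [contourIntegral_zero, pow_zero, mul_one, core, coefI, mapSign_permMap, detJK, betheTerm,
    prod_amp_permMap σ _ hξ]
  have h1 : ∏ k, ((permMap σ).1 k).elim 1 (fun a => ξ a ^ X k) = ∏ j, ξ j ^ X (σ.symm j) := by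
    rw [← Equiv.prod_comp σ fun j => ξ j ^ X (σ.symm j)]
    simp [permMap_apply]
  have h2 : ∏ j, ξ j ^ (X (σ.symm j) - Y j - 1) =
      (∏ j, ξ j ^ X (σ.symm j)) * ∏ j, ξ j ^ (-Y j - 1) := by
    rw [← Finset.prod_mul_distrib]
    refine Finset.prod_congr rfl fun j _ => ?_
    rw [← zpow_add₀ (hξ0 j)]
    congr 1
    ring
  rw [h1, h2]
  simp [scatProd]
  ring

end

/-! ### Series and parameters in contour integrals -/

section
variable {m : ℕ} {r : ℝ}

/-- The product of circles with radius `r`. -/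
def torus (m : ℕ) (r : ℝ) : Set (Fin m → ℂ) := {z | ∀ i, ‖z i‖ = r}

theorem isCompact_torus (m : ℕ) (r : ℝ) : IsCompact (torus m r) := by
  have : torus m r = Set.univ.pi fun _ => sphere (0 : ℂ) r := by
    ext z
    simp [torus]
  rw [this]
  exact isCompact_univ_pi fun _ => isCompact_sphere _ _

theorem torusMap_mem_torus (hr : 0 < r) (θ : Fin m → ℝ) :
    torusMap 0 (fun _ => r) θ ∈ torus m r := torusMap_mem (fun _ => hr) θ

theorem continuous_comp_torusMap (hr : 0 < r) {f : (Fin m → ℂ) → ℂ}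
    (hf : ContinuousOn f (torus m r)) : Continuous fun θ => f (torusMap 0 (fun _ => r) θ) :=
  hf.comp_continuous (continuous_torusMap _) (torusMap_mem_torus hr)

theorem norm_contourIntegral_le (hr : 0 < r) {f : (Fin m → ℂ) → ℂ} {C : ℝ}
    (hf : ∀ z ∈ torus m r, ‖f z‖ ≤ C) : ‖contourIntegral m r f‖ ≤ r ^ m * C := by
  have h := norm_torusIntegral_le_of_norm_le_const (f := f) (c := 0) (R := fun _ => r)
    fun θ => hf _ (torusMap_mem_torus hr θ)
  rw [contourIntegral, norm_mul, norm_inv, norm_pow]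
  have hpi : ‖(2 * Real.pi * I : ℂ)‖ = 2 * Real.pi := by
    simp [abs_of_pos Real.pi_pos]
  rw [hpi]
  have hp : 0 < (2 * Real.pi) ^ m := by positivity
  rw [inv_mul_le_iff₀ hp]
  simpa [abs_of_pos hr, mul_assoc] using h

theorem continuous_contourIntegral {T : Type*} [TopologicalSpace T] [FirstCountableTopology T]
    [LocallyCompactSpace T] {h : T → (Fin m → ℂ) → ℂ}
    (hh : Continuous fun p : T × (Fin m → ℝ) => h p.1 (torusMap 0 (fun _ => r) p.2)) :
    Continuous fun s => contourIntegral m r (h s) := by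
  unfold contourIntegral torusIntegral
  refine continuous_const.mul (continuous_parametric_integral_of_continuous ?_ isCompact_Icc)
  simp only [smul_eq_mul, Function.uncurry_def]
  refine Continuous.mul ?_ hh
  fun_prop

theorem hasSum_contourIntegral (hr : 0 < r) {g : ℕ → (Fin m → ℂ) → ℂ} {G : (Fin m → ℂ) → ℂ}
    (hg : ∀ l, Continuous fun θ => g l (torusMap 0 (fun _ => r) θ)) {u : ℕ → ℝ}
    (hu : Summable u) (hgu : ∀ l, ∀ z ∈ torus m r, ‖g l z‖ ≤ u l)
    (hsum : ∀ z ∈ torus m r, HasSum (fun l => g l z) (G z)) :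
    HasSum (fun l => contourIntegral m r (g l)) (contourIntegral m r G) := by
  unfold contourIntegral torusIntegral
  refine HasSum.mul_left _ ?_
  refine hasSum_integral_of_dominated_convergence (fun l _ => r ^ m * u l)
    (fun l => ?_) (fun l => ?_) ?_ ?_ ?_
  · simp only [smul_eq_mul]
    refine Continuous.aestronglyMeasurable (Continuous.mul ?_ (hg l))
    fun_prop
  · refine Eventually.of_forall fun θ => ?_
    rw [norm_smul]
    have := hgu l _ (torusMap_mem_torus hr θ)
    have h2 : ‖∏ i : Fin m, (r : ℂ) * exp (θ i * I) * I‖ = r ^ m := by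
      simp [norm_prod, abs_of_pos hr]
    rw [h2]
    gcongr
  · exact Eventually.of_forall fun θ => hu.mul_left _
  · exact (continuous_const.integrableOn_Icc)
  · exact Eventually.of_forall fun θ => (hsum _ (torusMap_mem_torus hr θ)).const_smul _

theorem hasSum_exp_mul (a c e : ℂ) :
    HasSum (fun l : ℕ => c ^ l / l.factorial * (a * e ^ l)) (a * exp (c * e)) := by
  have h := NormedSpace.expSeries_div_hasSum_exp (c * e)
  rw [← Complex.exp_eq_exp_ℂ] at h
  have e : (fun l : ℕ => c ^ l / l.factorial * (a * e ^ l)) =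
      fun l => a * ((c * e) ^ l / l.factorial) := by
    funext l
    rw [mul_pow]
    ring
  rw [e]
  exact h.mul_left a

theorem exists_bound_of_isCompact {T : Type*} [TopologicalSpace T] {K : Set T} (hK : IsCompact K)
    {f : T → ℂ} (hf : ContinuousOn f K) : ∃ C, 0 ≤ C ∧ ∀ s ∈ K, ‖f s‖ ≤ C := by
  obtain ⟨C, hC⟩ := hK.exists_bound_of_continuousOn hf
  exact ⟨max C 0, le_max_right _ _, fun s hs => (hC s hs).trans (le_max_left _ _)⟩

theorem norm_pow_div_factorial (c : ℂ) (l : ℕ) :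
    ‖c ^ l / (l.factorial : ℂ)‖ = ‖c‖ ^ l / l.factorial := by
  rw [norm_div, norm_pow, Complex.norm_natCast]

theorem hasSum_contourIntegral_exp (hr : 0 < r) {f e : (Fin m → ℂ) → ℂ}
    (hf : ContinuousOn f (torus m r)) (he : ContinuousOn e (torus m r)) (c : ℂ) :
    HasSum (fun l : ℕ => c ^ l / l.factorial * contourIntegral m r fun z => f z * e z ^ l)
      (contourIntegral m r fun z => f z * exp (c * e z)) := by
  obtain ⟨C, hC0, hC⟩ := exists_bound_of_isCompact (isCompact_torus m r) hf
  obtain ⟨B, hB0, hB⟩ := exists_bound_of_isCompact (isCompact_torus m r) he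
  simp_rw [← contourIntegral_const_mul]
  refine hasSum_contourIntegral hr (fun l => ?_)
    (u := fun l => C * ((‖c‖ * B) ^ l / l.factorial))
    ((Real.summable_pow_div_factorial _).mul_left C) (fun l z hz => ?_)
    fun z _ => hasSum_exp_mul _ _ _
  · exact continuous_const.mul (continuous_comp_torusMap hr (hf.mul (he.pow l)))
  · rw [norm_mul, norm_pow_div_factorial, norm_mul, norm_pow]
    have h1 := hC z hz
    have h2 := hB z hz
    calc ‖c‖ ^ l / l.factorial * (‖f z‖ * ‖e z‖ ^ l)
        ≤ ‖c‖ ^ l / l.factorial * (C * B ^ l) := by gcongr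
      _ = _ := by rw [mul_pow]; ring

/-- Continuous functions are bounded on the compact tori, so the terms are dominated by a constant
times `(‖c‖ B)^l / l!`, uniformly in the outer variables. -/
theorem hasSum_contourIntegral_contourIntegral_exp {n : ℕ} {r' : ℝ} (hr : 0 < r) (hr' : 0 < r')
    {F : (Fin m → ℂ) → ℂ} {h e : (Fin m → ℂ) → (Fin n → ℂ) → ℂ} (hF : ContinuousOn F (torus m r))
    (hh : ContinuousOn (fun p : (Fin m → ℂ) × (Fin n → ℂ) => h p.1 p.2)
      (torus m r ×ˢ torus n r'))
    (he : ContinuousOn (fun p : (Fin m → ℂ) × (Fin n → ℂ) => e p.1 p.2)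
      (torus m r ×ˢ torus n r')) (c : ℂ) :
    HasSum (fun l : ℕ => c ^ l / l.factorial * contourIntegral m r fun z =>
        F z * contourIntegral n r' fun w => h z w * e z w ^ l)
      (contourIntegral m r fun z => F z * contourIntegral n r' fun w => h z w * exp (c * e z w)) := by
  have hK := (isCompact_torus m r).prod (isCompact_torus n r')
  obtain ⟨A, hA0, hA⟩ := exists_bound_of_isCompact (isCompact_torus m r) hF
  obtain ⟨C, hC0, hC⟩ := exists_bound_of_isCompact hK hh
  obtain ⟨B, hB0, hB⟩ := exists_bound_of_isCompact hK he
  have hsec : ∀ z ∈ torus m r, ∀ {g : (Fin m → ℂ) → (Fin n → ℂ) → ℂ},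
      ContinuousOn (fun p : (Fin m → ℂ) × (Fin n → ℂ) => g p.1 p.2)
        (torus m r ×ˢ torus n r') → ContinuousOn (g z) (torus n r') := by
    intro z hz g hg
    exact hg.comp (f := fun w => (z, w)) (by fun_prop) fun w hw => ⟨hz, hw⟩
  have hmul : ∀ l : ℕ, (c ^ l / l.factorial * contourIntegral m r fun z =>
      F z * contourIntegral n r' fun w => h z w * e z w ^ l) =
      contourIntegral m r fun z => c ^ l / l.factorial *
        (F z * contourIntegral n r' fun w => h z w * e z w ^ l) :=
    fun l => (contourIntegral_const_mul _ _).symm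
  simp only [hmul]
  refine hasSum_contourIntegral hr (fun l => ?_)
    (u := fun l => A * (r' ^ n * C) * ((‖c‖ * B) ^ l / l.factorial))
    ((Real.summable_pow_div_factorial _).mul_left _) (fun l z hz => ?_) fun z hz => ?_
  · refine continuous_const.mul ((continuous_comp_torusMap hr hF).mul ?_)
    refine continuous_contourIntegral
      (h := fun θ w => h (torusMap 0 (fun _ => r) θ) w * e (torusMap 0 (fun _ => r) θ) w ^ l) ?_
    exact (hh.mul (he.pow l)).comp_continuous
      (f := fun p : (Fin m → ℝ) × (Fin n → ℝ) =>
        (torusMap 0 (fun _ => r) p.1, torusMap 0 (fun _ => r') p.2))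
      (((continuous_torusMap _).comp continuous_fst).prodMk
        ((continuous_torusMap _).comp continuous_snd))
      fun p => ⟨torusMap_mem_torus hr _, torusMap_mem_torus hr' _⟩
  · have h1 : ‖contourIntegral n r' fun w => h z w * e z w ^ l‖ ≤ r' ^ n * (C * B ^ l) := by
      refine norm_contourIntegral_le hr' fun w hw => ?_
      rw [norm_mul, norm_pow]
      have h1 := hC (z, w) ⟨hz, hw⟩
      have h2 := hB (z, w) ⟨hz, hw⟩
      gcongr
    rw [norm_mul, norm_pow_div_factorial, norm_mul]
    have h2 := hA z hz
    calc ‖c‖ ^ l / l.factorial * (‖F z‖ * ‖contourIntegral n r' fun w => h z w * e z w ^ l‖)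
        ≤ ‖c‖ ^ l / l.factorial * (A * (r' ^ n * (C * B ^ l))) := by gcongr
      _ = _ := by rw [mul_pow]; ring
  · have h1 := (hasSum_contourIntegral_exp hr' (hsec z hz hh) (hsec z hz he) c).mul_left (F z)
    have e2 : (fun l : ℕ => c ^ l / l.factorial *
        (F z * contourIntegral n r' fun w => h z w * e z w ^ l)) = fun l : ℕ =>
        F z * (c ^ l / l.factorial * contourIntegral n r' fun w => h z w * e z w ^ l) := by
      funext l
      ring
    rw [e2]
    exact h1

end

/-! ### Powers and exponentials of the Hamiltonian -/

section
variable {N : ℕ} {Δ : ℝ}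

theorem hamiltonian_apply (ψ : HilbertN N) (X : Config N) :
    hamiltonian N Δ ψ X = hamAct Δ ψ X := by
  rw [hamAct_eq_tsum]
  rfl

theorem conj_hamEntry (A B : Finset ℤ) :
    (starRingEnd ℂ) (hamEntry Δ A B) = hamEntry Δ A B := by
  rw [hamEntry_eq_sum, map_sum]
  refine Finset.sum_congr rfl fun j _ => ?_
  rw [localH_single]
  split_ifs
  · simp
  · simp only [Finsupp.sub_apply, Finsupp.smul_apply, Finsupp.single_apply, smul_eq_mul, map_sub,
      map_mul, Complex.conj_ofReal]
    split_ifs <;> simp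

/-- The matrix entries are real and symmetric; the adjoint is compared with `H` by testing against
basis vectors. -/
theorem adjoint_hamiltonian :
    ContinuousLinearMap.adjoint (hamiltonian N Δ) = hamiltonian N Δ := by
  ext ψ X
  have h1 : inner ℂ (lp.single 2 X (1 : ℂ))
      (ContinuousLinearMap.adjoint (hamiltonian N Δ) ψ) =
      ContinuousLinearMap.adjoint (hamiltonian N Δ) ψ X := by
    rw [lp.inner_single_left]
    simp
  rw [← h1, ContinuousLinearMap.adjoint_inner_right, lp.inner_eq_tsum, hamiltonian_apply,
    hamAct_eq_tsum]
  refine tsum_congr fun X' => ?_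
  have h2 : hamiltonian N Δ (lp.single 2 X (1 : ℂ)) X' = hamEntry Δ (sites X') (sites X) := by
    rw [hamiltonian_apply, hamAct_eq_tsum, tsum_eq_single X]
    · simp
    · intro Z hZ
      rw [lp.single_apply, Pi.single_eq_of_ne hZ, mul_zero]
  rw [h2, RCLike.inner_apply, conj_hamEntry, hamEntry_symm, mul_comm]

theorem hasSum_exp_hamiltonian_apply (c : ℂ) (ψ : HilbertN N) (X : Config N) :
    HasSum (fun k : ℕ => c ^ k / k.factorial * (hamiltonian N Δ ^ k) ψ X)
      (NormedSpace.exp (c • hamiltonian N Δ) ψ X) := by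
  have h1 := NormedSpace.exp_series_hasSum_exp' (𝕂 := ℂ) (c • hamiltonian N Δ)
  have h2 := (h1.mapL (ContinuousLinearMap.apply ℂ (HilbertN N) ψ)).mapL
    (lp.evalCLM ℂ (fun _ : Config N => ℂ) 2 X)
  have e : (fun k : ℕ => c ^ k / k.factorial * (hamiltonian N Δ ^ k) ψ X) = fun k =>
      lp.evalCLM ℂ (fun _ : Config N => ℂ) 2 X (ContinuousLinearMap.apply ℂ (HilbertN N) ψ
        (((k.factorial : ℂ)⁻¹) • (c • hamiltonian N Δ) ^ k)) := by
    funext k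
    rw [smul_pow, map_smul, map_smul, map_smul, map_smul]
    simp only [smul_eq_mul]
    rw [← mul_assoc, div_eq_inv_mul]
    rfl
  rw [e]
  exact h2

/-- Self-adjointness moves the evolution to the other side of the inner product and reverses the
time; pairing with `e_Y` is evaluation at `Y`. -/
theorem inner_state (Y : Config N) (t : ℝ) (ψ : HilbertN N) :
    inner ℂ (state Δ Y t) ψ = NormedSpace.exp ((I * t) • hamiltonian N Δ) ψ Y := by
  rw [state, ← ContinuousLinearMap.adjoint_inner_right, ← ContinuousLinearMap.star_eq_adjoint,
    NormedSpace.star_exp, star_smul, ContinuousLinearMap.star_eq_adjoint, adjoint_hamiltonian,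
    lp.inner_single_left]
  simp

theorem hamAct_mul_const (φ : Config N → ℂ) (a : ℂ) (X : Config N) :
    hamAct Δ (fun X' => φ X' * a) X = hamAct Δ φ X * a := by
  rw [hamAct, hamAct, Finsupp.linearCombination_apply, Finsupp.linearCombination_apply,
    Finsupp.sum, Finsupp.sum, Finset.sum_mul]
  simp [mul_assoc]

theorem hamAct_finsetSum {ι : Type*} (s : Finset ι) (φ : ι → Config N → ℂ) (X : Config N) :
    hamAct Δ (fun X' => ∑ i ∈ s, φ i X') X = ∑ i ∈ s, hamAct Δ (φ i) X := by
  simp only [hamAct, Finsupp.linearCombination_apply, Finsupp.sum]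
  rw [Finset.sum_comm]
  simp [Finset.mul_sum]

theorem hamAct_contourIntegral {m : ℕ} {r : ℝ} {g : (Fin m → ℂ) → Config N → ℂ}
    (hg : ∀ X, Continuous fun θ => g (torusMap 0 (fun _ => r) θ) X) (X : Config N) :
    hamAct Δ (fun X' => contourIntegral m r fun z => g z X') X =
      contourIntegral m r fun z => hamAct Δ (g z) X := by
  simp only [hamAct, Finsupp.linearCombination_apply, Finsupp.sum, smul_eq_mul]
  rw [contourIntegral_finsetSum _ fun X' _ => continuous_const.mul (hg X')]
  exact Finset.sum_congr rfl fun X' _ => (contourIntegral_const_mul _ _).symm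

end

/-! ### The amplitudes as contour integrals -/

section
variable {N : ℕ} {Δ R R' : ℝ}

theorem continuousOn_core (hR : 1 + ‖(2 * Δ : ℂ)‖ < R) (hcR : 4 < ‖(2 * Δ : ℂ)‖ * R)
    (hR' : R + ‖(2 * Δ : ℂ)‖ + 1 < R') (x : ℤ) {n : ℕ} (τ : maps N n) (Y : Fin N → ℤ) :
    ContinuousOn (fun p : (Fin N → ℂ) × (Fin n → ℂ) => core Δ x τ p.1 p.2 Y)
      (torus N R ×ˢ torus n R') :=
  (core_differentiableOn x τ Y differentiableOn_fst differentiableOn_snd hR hcR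
    (fun _ hp => hp.1) fun _ hp b => by rw [hp.2 b]; exact hR').continuousOn

theorem continuousOn_mapEnergy (hR : 0 < R) (hR' : 0 < R') {n : ℕ} (τ : maps N n) :
    ContinuousOn (fun p : (Fin N → ℂ) × (Fin n → ℂ) => mapEnergy Δ τ p.1 p.2)
      (torus N R ×ˢ torus n R') := by
  rw [continuousOn_iff_continuous_domRestrict]
  refine continuous_mapEnergy τ (u := fun s : (torus N R ×ˢ torus n R' : Set _) => s.1.1)
    (v := fun s => s.1.2) (by fun_prop) (by fun_prop) (fun s j => ?_) fun s b => ?_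
  · rw [← norm_pos_iff, s.2.1 j]
    exact hR
  · rw [← norm_pos_iff, s.2.2 b]
    exact hR'

theorem continuous_waveIntegral (hR : 1 + ‖(2 * Δ : ℂ)‖ < R) (hcR : 4 < ‖(2 * Δ : ℂ)‖ * R)
    (hR' : R + ‖(2 * Δ : ℂ)‖ + 1 < R') (x : ℤ) (n l : ℕ) (Y : Fin N → ℤ) :
    Continuous fun θ => waveIntegral Δ x R' (torusMap 0 (fun _ => R) θ) n l Y := by
  have hc := norm_nonneg (2 * Δ : ℂ)
  have hR0 : 0 < R := by linarith
  have hR0' : 0 < R' := by linarith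
  refine continuous_finsetSum _ fun τ _ => continuous_contourIntegral ?_
  exact ((continuousOn_core hR hcR hR' x τ Y).mul
    ((continuousOn_mapEnergy hR0 hR0' τ).pow l)).comp_continuous
      (f := fun p : (Fin N → ℝ) × (Fin n → ℝ) =>
        (torusMap 0 (fun _ => R) p.1, torusMap 0 (fun _ => R') p.2))
      (((continuous_torusMap _).comp continuous_fst).prodMk
        ((continuous_torusMap _).comp continuous_snd))
      fun p => ⟨torusMap_mem_torus hR0 _, torusMap_mem_torus hR0' _⟩

/-- At each configuration `H` is a finite linear combination, so it passes under the integral, where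
it raises the power of the energy by one. -/
theorem pow_hamiltonian_apply (hR : 1 + ‖(2 * Δ : ℂ)‖ < R) (hcR : 4 < ‖(2 * Δ : ℂ)‖ * R)
    (hR' : R + ‖(2 * Δ : ℂ)‖ + 1 < R') (x : ℤ) (s : Finset ℕ) {F : (Fin N → ℂ) → ℂ}
    (hF : Continuous fun θ => F (torusMap 0 (fun _ => R) θ)) {ψ : HilbertN N}
    (hψ : ∀ X : Config N, ψ X = contourIntegral N R fun ξ =>
      (∑ n ∈ s, waveIntegral Δ x R' ξ n 0 X.1) * F ξ) (l : ℕ) (X : Config N) :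
    (hamiltonian N Δ ^ l) ψ X = contourIntegral N R fun ξ =>
      (∑ n ∈ s, waveIntegral Δ x R' ξ n l X.1) * F ξ := by
  have hc := norm_nonneg (2 * Δ : ℂ)
  have hR0 : 0 < R := by linarith
  induction l generalizing X with
  | zero => exact hψ X
  | succ l ih =>
    rw [pow_succ', mul_apply_eq_comp, hamiltonian_apply, funext ih,
      hamAct_contourIntegral]
    · refine contourIntegral_congr hR0 fun ξ hξ => ?_
      rw [hamAct_mul_const, hamAct_finsetSum]
      congr 1
      exact Finset.sum_congr rfl fun n _ => hamAct_waveIntegral hR hcR hξ hR' x n l X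
    · exact fun X => (continuous_finsetSum _ fun n _ =>
        continuous_waveIntegral hR hcR hR' x n l X.1).mul hF

/-- For `n = 0` the waves form the Bethe function, so this is orthogonality in the form used by
`pow_hamiltonian_apply`. -/
theorem single_apply_eq_contourIntegral (hR : 1 + ‖(2 * Δ : ℂ)‖ < R) (x : ℤ) (Y X : Config N) :
    (lp.single 2 Y (1 : ℂ) : HilbertN N) X = contourIntegral N R fun ξ =>
      (∑ n ∈ {0}, waveIntegral Δ x R' ξ n 0 X.1) * ∏ j, ξ j ^ (-Y.1 j - 1) := by
  have hc := norm_nonneg (2 * Δ : ℂ)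
  have hR0 : 0 < R := by linarith
  have h1 : (contourIntegral N R fun ξ =>
      (∑ n ∈ {0}, waveIntegral Δ x R' ξ n 0 X.1) * ∏ j, ξ j ^ (-Y.1 j - 1)) =
      contourIntegral N R (betheIntegrand (2 * Δ) X.1 Y.1) := by
    refine contourIntegral_congr hR0 fun ξ hξ => ?_
    have hl : ∀ j, 1 + ‖(2 * Δ : ℂ)‖ < ‖ξ j‖ := fun j => by rw [hξ]; exact hR
    rw [Finset.sum_singleton, waveIntegral_zero_eq_betheIntegrand x R' X.1 Y.1
      (fun a b => scat_ne_zero (hl a) (hl b)) fun j => ne_zero_of_large (hl j)]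
  rw [h1, contourIntegral, torusIntegral_betheIntegrand hR X.2 Y.2, lp.single_apply,
    Pi.single_apply]
  simp only [Subtype.ext_iff]
  split_ifs
  · exact (inv_mul_cancel₀ (pow_ne_zero _ Complex.two_pi_I_ne_zero)).symm
  · rw [mul_zero]

theorem continuousOn_prod_zpow (hR : 0 < R) (e : Fin N → ℤ) :
    ContinuousOn (fun ξ : Fin N → ℂ => ∏ j, ξ j ^ e j) (torus N R) := by
  refine continuousOn_finsetProd _ fun j _ => ContinuousOn.zpow₀ (by fun_prop) _ fun ξ hξ => ?_
  left
  rw [← norm_pos_iff, hξ j]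
  exact hR

theorem continuousOn_sum_energy (hR : 0 < R) :
    ContinuousOn (fun ξ : Fin N → ℂ => ∑ j, energy Δ (ξ j)) (torus N R) := by
  unfold energy
  refine continuousOn_finsetSum _ fun j _ => ((by fun_prop : ContinuousOn _ _).add
    (ContinuousOn.inv₀ (by fun_prop) fun ξ hξ => ?_)).sub continuousOn_const
  rw [← norm_pos_iff, hξ j]
  exact hR

theorem continuousOn_waveIntegral_zero (hR : 1 + ‖(2 * Δ : ℂ)‖ < R)
    (hcR : 4 < ‖(2 * Δ : ℂ)‖ * R)
    (hR' : R + ‖(2 * Δ : ℂ)‖ + 1 < R') (x : ℤ) (Y : Fin N → ℤ) :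
    ContinuousOn (fun ξ => waveIntegral Δ x R' ξ 0 0 Y) (torus N R) := by
  have hc := norm_nonneg (2 * Δ : ℂ)
  refine continuousOn_finsetSum _ fun τ _ => ?_
  simp only [contourIntegral_zero, pow_zero, mul_one]
  exact (continuousOn_core hR hcR hR' x τ Y).comp (f := fun ξ => (ξ, 0)) (by fun_prop)
    fun ξ hξ => ⟨hξ, fun b => b.elim0⟩

/-- With no zeros every map has the same energy `∑ ε(ξ_j)`, so the exponential series of `H` sums to
one common phase under the integral. -/
theorem state_apply_eq_contourIntegral (hR : 1 + ‖(2 * Δ : ℂ)‖ < R)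
    (hcR : 4 < ‖(2 * Δ : ℂ)‖ * R) (hR' : R + ‖(2 * Δ : ℂ)‖ + 1 < R') (x : ℤ) (Y : Config N)
    (t : ℝ) (X : Config N) :
    state Δ Y t X = contourIntegral N R fun ξ => waveIntegral Δ x R' ξ 0 0 X.1 *
      ((∏ j, ξ j ^ (-Y.1 j - 1)) * exp (-(I * t) * ∑ j, energy Δ (ξ j))) := by
  have hc := norm_nonneg (2 * Δ : ℂ)
  have hR0 : 0 < R := by linarith
  have hW := continuousOn_prod_zpow hR0 fun j => -Y.1 j - 1
  have h1 := hasSum_exp_hamiltonian_apply (Δ := Δ) (-(I * t)) (lp.single 2 Y (1 : ℂ)) X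
  have h2 := hasSum_contourIntegral_exp hR0
    ((continuousOn_waveIntegral_zero hR hcR hR' x X.1).mul hW)
    (continuousOn_sum_energy (Δ := Δ) hR0) (-(I * t))
  have h3 : (fun k : ℕ => (-(I * t)) ^ k / k.factorial *
      (hamiltonian N Δ ^ k) (lp.single 2 Y (1 : ℂ)) X) = fun k : ℕ =>
      (-(I * t)) ^ k / k.factorial * contourIntegral N R fun ξ =>
        (waveIntegral Δ x R' ξ 0 0 X.1 * ∏ j, ξ j ^ (-Y.1 j - 1)) *
          (∑ j, energy Δ (ξ j)) ^ k := by
    funext k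
    rw [pow_hamiltonian_apply hR hcR hR' x {0} (continuous_comp_torusMap hR0 hW)
      fun X => single_apply_eq_contourIntegral hR x Y X]
    congr 2
    funext ξ
    rw [Finset.sum_singleton, waveIntegral_zero x R' k]
    ring
  rw [h3] at h1
  refine (h1.unique h2).trans ?_
  exact contourIntegral_congr hR0 fun ξ _ => mul_assoc _ _ _

end

/-! ### The distribution of the left-most particle -/

section
variable {N : ℕ} [NeZero N] {Δ R R' : ℝ}

/-- The part of a state whose particles all lie at sites `≥ x`. -/
def truncate (x : ℤ) (ψ : HilbertN N) : HilbertN N :=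
  ⟨fun X => if x ≤ X.1 0 then ψ X else 0, by
    refine memℓp_gen ?_
    refine Summable.of_nonneg_of_le (fun X => by positivity) (fun X => ?_)
      ((lp.memℓp ψ).summable (by norm_num))
    split_ifs
    · exact le_rfl
    · simp⟩

theorem truncate_apply (x : ℤ) (ψ : HilbertN N) (X : Config N) :
    truncate x ψ X = if x ≤ X.1 0 then ψ X else 0 := rfl

/-- The configurations with left-most particle at a site `≥ x`, by the position of this particle. -/
def leftmostEquiv (x : ℤ) :
    (Σ m : Set.Ici x, {X : Config N // X.1 0 = m}) ≃ {X : Config N // x ≤ X.1 0} where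
  toFun p := ⟨p.2.1, by rw [p.2.2]; exact p.1.2⟩
  invFun X := ⟨⟨X.1.1 0, X.2⟩, X.1, rfl⟩
  left_inv := by
    rintro ⟨⟨m, hm⟩, X, hX⟩
    dsimp only at hX
    subst hX
    rfl
  right_inv _ := rfl

theorem probLeftmostGE_eq_tsum (Y : Config N) (t : ℝ) (x : ℤ) :
    probLeftmostGE Δ Y t x = ∑' X : Config N, if x ≤ X.1 0 then ‖state Δ Y t X‖ ^ 2 else 0 := by
  have hs : Summable fun X : {X : Config N // x ≤ X.1 0} => ‖state Δ Y t X.1‖ ^ 2 :=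
    (summable_sq (state Δ Y t)).subtype _
  have hs2 := (leftmostEquiv (N := N) x).summable_iff.2 hs
  have h1 := hs2.tsum_sigma' fun m => hs2.sigma_factor m
  have h2 := (leftmostEquiv (N := N) x).tsum_eq fun X => ‖state Δ Y t X.1‖ ^ 2
  have h3 := tsum_subtype {X : Config N | x ≤ X.1 0} fun X => ‖state Δ Y t X‖ ^ 2
  refine (h1.symm.trans h2).trans (h3.trans (tsum_congr fun X => ?_))
  rw [Set.indicator_apply]
  rfl

theorem probLeftmostGE_eq_inner (Y : Config N) (t : ℝ) (x : ℤ) :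
    (probLeftmostGE Δ Y t x : ℂ) = inner ℂ (state Δ Y t) (truncate x (state Δ Y t)) := by
  rw [probLeftmostGE_eq_tsum, lp.inner_eq_tsum, Complex.ofReal_tsum]
  refine tsum_congr fun X => ?_
  rw [truncate_apply, RCLike.inner_apply]
  split_ifs
  · rw [RCLike.mul_conj]
    simp
  · simp

/-- The cut-off is inserted pointwise in `ξ` by `sum_contourIntegral_core`. In this form the
truncated state is again a superposition of waves on which `H` acts freely. -/
theorem truncate_state_apply (hR : 1 + ‖(2 * Δ : ℂ)‖ < R)
    (hcR : 4 < ‖(2 * Δ : ℂ)‖ * R) (hR' : R + ‖(2 * Δ : ℂ)‖ + 1 < R') (x : ℤ) (Y : Config N)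
    (t : ℝ) (X : Config N) :
    truncate x (state Δ Y t) X = contourIntegral N R fun ξ =>
      (∑ n ∈ Finset.range (N + 1), waveIntegral Δ x R' ξ n 0 X.1) *
        ((∏ j, ξ j ^ (-Y.1 j - 1)) * exp (-(I * t) * ∑ j, energy Δ (ξ j))) := by
  have hc := norm_nonneg (2 * Δ : ℂ)
  have hR0 : 0 < R := by linarith
  have h : ∀ ξ : Fin N → ℂ, (∀ j, ‖ξ j‖ = R) →
      ∑ n ∈ Finset.range (N + 1), waveIntegral Δ x R' ξ n 0 X.1 =
        if x ≤ X.1 0 then waveIntegral Δ x R' ξ 0 0 X.1 else 0 := by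
    intro ξ hξ
    have := sum_contourIntegral_core hR hcR hξ hR' x X.2
    simpa only [waveIntegral, pow_zero, mul_one] using this
  rw [contourIntegral_congr hR0 fun ξ hξ => by rw [h ξ hξ], truncate_apply,
    state_apply_eq_contourIntegral hR hcR hR' x]
  split_ifs
  · rfl
  · simp only [zero_mul]
    rw [contourIntegral, torusIntegral]
    simp

theorem probLeftmostGE_eq_sum_contourIntegral (hR : 1 + ‖(2 * Δ : ℂ)‖ < R)
    (hcR : 4 < ‖(2 * Δ : ℂ)‖ * R) (hR' : R + ‖(2 * Δ : ℂ)‖ + 1 < R') (x : ℤ) (Y : Config N)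
    (t : ℝ) :
    (probLeftmostGE Δ Y t x : ℂ) = ∑ n ∈ Finset.range (N + 1), ∑ τ : maps N n,
      contourIntegral N R fun ξ => contourIntegral n R' fun ζ =>
        integrandI Δ Y t x τ ξ ζ * integrandF Δ Y τ ξ ζ := by
  have hc := norm_nonneg (2 * Δ : ℂ)
  have hR0 : 0 < R := by linarith
  have hR0' : 0 < R' := by linarith
  set F : (Fin N → ℂ) → ℂ := fun ξ =>
    (∏ j, ξ j ^ (-Y.1 j - 1)) * exp (-(I * t) * ∑ j, energy Δ (ξ j)) with hFdef
  have hF : ContinuousOn F (torus N R) :=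
    (continuousOn_prod_zpow hR0 _).mul
      (continuousOn_const.mul (continuousOn_sum_energy hR0)).cexp
  have h1 := hasSum_exp_hamiltonian_apply (Δ := Δ) (I * t) (truncate x (state Δ Y t)) Y
  rw [← inner_state, ← probLeftmostGE_eq_inner] at h1
  have h2 : HasSum (fun l : ℕ => ∑ n ∈ Finset.range (N + 1), ∑ τ : maps N n,
      (I * t) ^ l / l.factorial * contourIntegral N R fun ξ => F ξ * contourIntegral n R'
        fun ζ => core Δ x τ ξ ζ Y.1 * mapEnergy Δ τ ξ ζ ^ l)
      (∑ n ∈ Finset.range (N + 1), ∑ τ : maps N n, contourIntegral N R fun ξ =>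
        F ξ * contourIntegral n R' fun ζ =>
          core Δ x τ ξ ζ Y.1 * exp (I * t * mapEnergy Δ τ ξ ζ)) :=
    hasSum_sum fun n _ => hasSum_sum fun τ _ =>
      hasSum_contourIntegral_contourIntegral_exp hR0 hR0' hF
        (continuousOn_core hR hcR hR' x τ Y.1) (continuousOn_mapEnergy hR0 hR0' τ) _
  have hcont : ∀ (l n : ℕ) (τ : maps N n), Continuous fun θ =>
      (fun ξ => F ξ * contourIntegral n R' fun ζ => core Δ x τ ξ ζ Y.1 * mapEnergy Δ τ ξ ζ ^ l)
        (torusMap 0 (fun _ => R) θ) := fun l n τ =>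
    (continuous_comp_torusMap hR0 hF).mul (continuous_contourIntegral
      (((continuousOn_core hR hcR hR' x τ Y.1).mul
        ((continuousOn_mapEnergy hR0 hR0' τ).pow l)).comp_continuous
        (f := fun p : (Fin N → ℝ) × (Fin n → ℝ) =>
          (torusMap 0 (fun _ => R) p.1, torusMap 0 (fun _ => R') p.2))
        (((continuous_torusMap _).comp continuous_fst).prodMk
          ((continuous_torusMap _).comp continuous_snd))
        fun p => ⟨torusMap_mem_torus hR0 _, torusMap_mem_torus hR0' _⟩))
  -- The same quantity has two series: one from the powers of `H` applied to the truncated state and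
  -- evaluated at `Y`, one from expanding the exponential of the energy in the integrand. They agree
  -- term by term.
  have h3 : (fun l : ℕ => (I * t) ^ l / l.factorial *
      (hamiltonian N Δ ^ l) (truncate x (state Δ Y t)) Y) = fun l : ℕ =>
      ∑ n ∈ Finset.range (N + 1), ∑ τ : maps N n,
      (I * t) ^ l / l.factorial * contourIntegral N R fun ξ => F ξ * contourIntegral n R'
        fun ζ => core Δ x τ ξ ζ Y.1 * mapEnergy Δ τ ξ ζ ^ l := by
    funext l
    rw [pow_hamiltonian_apply hR hcR hR' x (Finset.range (N + 1))
      (continuous_comp_torusMap hR0 hF) (truncate_state_apply hR hcR hR' x Y t)]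
    simp_rw [← Finset.mul_sum]
    congr 1
    rw [Finset.sum_congr rfl fun n _ =>
      (contourIntegral_finsetSum Finset.univ fun τ _ => hcont l n τ).symm,
      ← contourIntegral_finsetSum (f := fun n ξ => ∑ τ : maps N n, F ξ * contourIntegral n R'
        fun ζ => core Δ x τ ξ ζ Y.1 * mapEnergy Δ τ ξ ζ ^ l) _
        fun n _ => continuous_finsetSum _ fun τ _ => hcont l n τ]
    congr 1
    funext ξ
    simp only [waveIntegral, Finset.sum_mul]
    exact Finset.sum_congr rfl fun n _ => Finset.sum_congr rfl fun τ _ => mul_comm _ _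
  rw [h3] at h1
  refine (h1.unique h2).trans (Finset.sum_congr rfl fun n _ => Finset.sum_congr rfl fun τ _ => ?_)
  refine contourIntegral_congr hR0 fun ξ hξ => ?_
  rw [← contourIntegral_const_mul]
  refine contourIntegral_congr hR0' fun ζ hζ => ?_
  rw [integrand_eq Δ x τ ξ ζ Y t fun j => ne_zero_of_large (c := 2 * Δ) (by rw [hξ]; exact hR)]
  simp only [hFdef, neg_mul]
  ring

end

end XXZ

end

theorem theorem4 (N : ℕ) [NeZero N] (Y : XXZ.Config N) (Δ : ℝ) (hΔ : Δ ≠ 0) (t : ℝ) (x : ℤ)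
    (R R' : ℝ)
    (hR₁ : max (2 * |Δ|⁻¹) (2 * (1 + 2 * |Δ|)) < R)
    (hR₂ : R < max (4 * |Δ|⁻¹) (4 * (1 + 2 * |Δ|)))
    (hR' : max (4 * |Δ|⁻¹) (4 * (1 + 2 * |Δ|)) < R' / 2) :
    (XXZ.probLeftmostGE Δ Y t x : ℂ) =
      ∑ n ∈ Finset.range (N + 1), ∑ τ : XXZ.maps N n,
        XXZ.contourIntegral N R fun ξ : Fin N → ℂ =>
          XXZ.contourIntegral n R' fun ζ : Fin n → ℂ =>
            XXZ.integrandI Δ Y t x τ ξ ζ * XXZ.integrandF Δ Y τ ξ ζ := by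
  have hc : ‖(2 * Δ : ℂ)‖ = 2 * |Δ| := by simp
  have h0 : 0 < |Δ| := abs_pos.2 hΔ
  have h1 := (le_max_left _ _).trans_lt hR₁
  have h2 := (le_max_right _ _).trans_lt hR₁
  have h3 := (le_max_right _ _).trans_lt hR'
  -- Both `R` and `1 + 2|Δ|` are smaller than `R'/2`.
  have h4 : R + 2 * |Δ| + 1 < R' := by linarith
  refine XXZ.probLeftmostGE_eq_sum_contourIntegral ?_ ?_ ?_ x Y t
  · rw [hc]
    linarith
  · rw [hc]
    have h5 := mul_lt_mul_of_pos_left h1 h0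
    have h6 : |Δ| * (2 * |Δ|⁻¹) = 2 := by field_simp
    linarith
  · rw [hc]
    exact h4
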